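/- **Setting.** A *stable noded Riemann surface* is $\alpha=(S,j,M,D)$, where $S$ is a closed smooth surface with smooth almost complex structure $j$, $M\subset S$ is finite, $D$ is a finite set of unordered pairs $\{x,y\}$, $x\ne y$, of points of $S\setminus M$, two different pairs being disjoint; the space obtained from $S$ by identifying $x\equiv y$ for all $\{x,y\}\in D$ is connected; and $2g(C)+\#(C\cap(|D|\cup M))\ge 3$ for every component $C$ of $S$, with $g(C)$ its genus and $|D|=\bigcup_{\{x,y\}\in D}\{x,y\}$. Let $\mathcal R$ be the category with these objects and with morphisms $\Phi=(\alpha,\phi,\alpha')$, where $\phi:(S,j)\to(S',j')$ is biholomorphic with $\phi(M)=M'$, $\phi(D)=D'$. The set $|\mathcal R|$ of isomorphism classes carries its natural (Deligne–Mumford) topology. Fix a gluing profile, i.e. a smooth diffeomorphism $\varphi:(0,1]\to[0,\infty)$. For $\alpha$ in $\mathcal R$ let $G$ be its automorphism group. *Gluing parameters.* $\mathbb B^\alpha$ is the set of maps $\mathfrak a$ assigning to $\{x,y\}\in D$ a formal expression $\mathfrak a^{\{x,y\}}=r[\hat x,\hat y]$ with $0\le r<1/2$ and $\hat x\subset T_xS$,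 $\hat y\subset T_yS$ oriented real lines, where $[\hat x,\hat y]=[\theta\hat x,\theta^{-1}\hat y]$ for $\theta\in S^1$ (unordered in $x,y$) and where all expressions with $r=0$ are equal; $r[\hat x,\theta\hat y]\mapsto r\theta$ are its complex coordinates. *Plumbing.* A small disk structure $\mathbf D$ assigns to the points $x\in|D|$ disjoint compact disks $D_x\ni x$ with smooth boundary (with $x$ in the interior), disjoint from $M$, with $G$-invariant union. Given $\mathfrak a$, for each $\{x,y\}$ with $\mathfrak a^{\{x,y\}}=r[\hat x,\hat y]$, $r\neq0$, let $R=\varphi(r)$ and let $h_x:(D_x,x)\to(\mathbb D,0)$, $h_y:(D_y,y)\to(\mathbb D,0)$ be the biholomorphic maps to the closed unit disk whose derivatives map $\hat x$, $\hat y$ to the positively oriented real line; remove $\{|h_x|<e^{-2\pi R}\}$ and $\{|h_y|<e^{-2\pi R}\}$ and identify $z\in D_x$ with $z'\in D_y$ if $h_x(z)h_y(z')=e^{-2\pi R}$. This defines $S_{\mathfrak a}$; for an almost complex structure $k$ with $k=j$ on the disks it defines $(S_{\mathfrak a},k_{\mathfrak a},M_{\mathfrak a},D_{\mathfrak a})$,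 where $D_{\mathfrak a}$ consists of the pairs with $r=0$. *Deformations.* $H^1(\alpha)=\Omega^{0,1}(\alpha)/\bar\partial\Gamma_0(\alpha)$, where $\Gamma_0(\alpha)$ is the space of smooth vector fields on $S$ vanishing on $M\cup|D|$ and $\Omega^{0,1}(\alpha)$ the space of smooth complex antilinear sections of $\mathrm{Hom}_{\mathbb R}(TS,TS)$. A good deformation compatible with $\mathbf D$ is a smooth family $v\mapsto j(v)$ of almost complex structures on $S$, defined on a $G$-invariant open neighborhood $V$ of $0$ in $H^1(\alpha)$, such that $j(0)=j$; $j(v)=j$ on all disks $D_x$; $[Dj(v)]:H^1(\alpha)\to H^1(S,j(v),M,D)$ is a complex linear isomorphism for all $v\in V$; and each $g\in G$ is biholomorphic from $(S,j(v))$ to $(S,j(g*v))$. *Good uniformizers.* Let $\mathbf D$, $v\mapsto j(v)$ be as above and let $O\subset V\times\mathbb B^\alpha$ be a $G$-invariant open neighborhood of $(0,0)$. Let $G\ltimes O$ be the translation groupoid, with objects $q\in O$ and morphisms $(g,q):q\to g*q$. Put $\Psi(v,\mathfrak a)=\alpha_{(v,\mathfrak a)}=(S_{\mathfrak a},j(v)_{\mathfrak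 a},M_{\mathfrak a},D_{\mathfrak a})$ and $\Psi(g,(v,\mathfrak a))=g_{\mathfrak a}:\alpha_{(v,\mathfrak a)}\to\alpha_{(g*v,g*\mathfrak a)}$, the map induced by $g$. The functor $\Psi:G\ltimes O\to\mathcal R$ (together with $\mathbf D$ and $v\mapsto j(v)$) is a *good uniformizer* associated to $\alpha$ if (i) $\Psi$ is fully faithful; (ii) $|\Psi|:G\backslash O\to|\mathcal R|$ is a homeomorphism onto an open neighborhood of $|\alpha|$; (iii) for each $q=(v,\mathfrak a)\in O$ the partial Kodaira–Spencer differential at $q$, that is the real linear map which sends an infinitesimal variation of $v$ and of the non-zero components of $\mathfrak a$ to the class in $H^1(\alpha_q)$ of the induced infinitesimal variation of the complex structure of $\alpha_q$, is an isomorphism; (iv) each $q\in O$ has an open neighborhood $U(q)\subset O$ such that every sequence $(q_k)$ in $U(q)$ for which $|\Psi(q_k)|$ converges in $|\mathcal R|$ has a subsequence converging to a point of $\mathrm{cl}_O(U(q))$. Let $F(\alpha)$ be the set of good uniformizers associated to $\alpha$. **Theorem.** There is exactly one functor $F:\mathcal R\to\mathrm{SET}$ with $\alpha\mapsto F(\alpha)$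 on objects such that, for every morphism $\Phi=(\alpha,\phi,\alpha')$ and every $\Psi\in F(\alpha)$ with data $\mathbf D$, $V$, $j(\cdot)$, $O$, the element $\Psi'=F(\Phi)(\Psi)\in F(\alpha')$ has the data $$D'_{\phi(x)}=\phi(D_x),\qquad V'=\phi_*V,\qquad j'(\phi_*v)=T\phi\circ j(v)\circ T\phi^{-1},\qquad O'=\phi_*O,$$ where $\phi_*$ denotes the maps $H^1(\alpha)\to H^1(\alpha')$, $[\tau]\mapsto[T\phi\circ\tau\circ T\phi^{-1}]$, and $\mathbb B^\alpha\to\mathbb B^{\alpha'}$, $r[\hat x,\hat y]\mapsto r[T\phi\,\hat x,T\phi\,\hat y]$. Moreover, let $\Phi:\alpha\to\alpha'$ be an isomorphism, $\Psi\in F(\alpha)$, $\Psi'=F(\Phi)(\Psi)$, and let $G'$ be the automorphism group of $\alpha'$. Then there is a smooth equivalence of translation groupoids (an equivalence of categories, smooth on objects and morphisms and a local diffeomorphism on objects) $$f_\Phi:G\ltimes O\to G'\ltimes O',\qquad q\mapsto\phi_*(q),\qquad (g,q)\mapsto(\phi\circ g\circ\phi^{-1},\phi_*(q)),$$ and a unique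 natural equivalence $\Gamma:\Psi\Rightarrow\Psi'\circ f_\Phi$ whose component at $(v,\mathfrak a)\in O$ is the biholomorphic map $\phi_{\mathfrak a}:\alpha_{(v,\mathfrak a)}\to\alpha'_{f_\Phi(v,\mathfrak a)}$ induced by $\phi$. The functor $f_\Phi$ is uniquely determined: it is the only functor $G\ltimes O\to G'\ltimes O'$ which is $\phi_*$ on objects and admits a natural equivalence $\Psi\Rightarrow\Psi'\circ f_\Phi$ with components induced by $\phi$. -/

import Mathlib

open CategoryTheory Set Filter Topology Manifold
open scoped ContDiff

noncomputable section

namespace NodedRiemann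

/-! ### Closed smooth surfaces -/

/-- The model space of a smooth surface. -/
abbrev Plane : Type := EuclideanSpace ℝ (Fin 2)

/-- The model with corners of a smooth surface without boundary. -/
abbrev IP : ModelWithCorners ℝ Plane Plane := 𝓘(ℝ, Plane)

/-- A set of charts with values in the plane whose sources cover `X`. -/
class SurfaceCharts (X : Type) [TopologicalSpace X] where
  charts : Set (OpenPartialHomeomorph X Plane)
  covers : ∀ x : X, ∃ c ∈ charts, x ∈ c.source

instance instChartedSpaceSurfaceCharts (X : Type) [TopologicalSpace X] [SurfaceCharts X] :
    ChartedSpace Plane X where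
  atlas := SurfaceCharts.charts
  chartAt x := (SurfaceCharts.covers x).choose
  mem_chart_source x := (SurfaceCharts.covers x).choose_spec.2
  chart_mem_atlas x := (SurfaceCharts.covers x).choose_spec.1

/-- A closed smooth surface: a compact Hausdorff space with a maximal smooth atlas
modelled on the plane (the set of charts consists of all smooth charts, so that two closed surfaces
with the same points, the same topology and the same smooth structure are equal). -/
class ClosedSurface (X : Type) extends TopologicalSpace X, SurfaceCharts X, T2Space X,
    CompactSpace X where
  isManifold : IsManifold IP ∞ X
  maximal : ∀ c ∈ IsManifold.maximalAtlas IP ∞ X, c ∈ charts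

attribute [instance] ClosedSurface.isManifold

/-- A field of real linear endomorphisms of the tangent spaces. -/
abbrev EndField (X : Type) [ClosedSurface X] : Type :=
  ∀ x : X, TangentSpace IP x →L[ℝ] TangentSpace IP x

/-- Smooth vector fields. -/
def IsSmoothVF {X : Type} [ClosedSurface X] (Y : ∀ x : X, TangentSpace IP x) : Prop :=
  ContMDiff IP IP.tangent ∞ (fun x => (⟨x, Y x⟩ : TangentBundle IP X))

/-- Smooth sections of `Hom_ℝ(TX, TX)`: those which map smooth vector fields to smooth
vector fields. -/
def IsSmoothEnd {X : Type} [ClosedSurface X] (τ : EndField X) : Prop :=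
  ∀ Y : ∀ x : X, TangentSpace IP x, IsSmoothVF Y → IsSmoothVF (fun x => τ x (Y x))

/-- Smooth almost complex structures. -/
@[ext]
structure AlmostComplex (X : Type) [ClosedSurface X] where
  J : EndField X
  sq : ∀ (x : X) (v : TangentSpace IP x), J x (J x v) = -v
  smooth : IsSmoothEnd J

/-- The expression of an endomorphism field in a chart. -/
def chartRep {X : Type} [ClosedSurface X] (c : OpenPartialHomeomorph X Plane) (τ : EndField X)
    (y : Plane) : Plane →L[ℝ] Plane :=
  (mfderiv IP IP c (c.symm y)) ∘L (τ (c.symm y)) ∘L (mfderiv IP IP c.symm y)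

/-- The `C^∞`-topology on the set of almost complex structures. -/
instance instTopologicalSpaceAlmostComplex (X : Type) [ClosedSurface X] :
    TopologicalSpace (AlmostComplex X) :=
  TopologicalSpace.generateFrom
    {N | ∃ (j : AlmostComplex X) (c : OpenPartialHomeomorph X Plane) (K : Set Plane) (m : ℕ) (ε : ℝ),
      c ∈ SurfaceCharts.charts ∧ IsCompact K ∧ K ⊆ c.target ∧ 0 < ε ∧
      N = {k | ∀ y ∈ K, ∀ i ≤ m,
        ‖iteratedFDeriv ℝ i (fun y' => chartRep c k.J y' - chartRep c j.J y') y‖ < ε}}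

/-- The genus of a component `C` of a closed orientable surface:
half of the rank of its first singular homology. -/
def genus {X : Type} [TopologicalSpace X] (C : Set X) : ℕ :=
  Module.finrank ℚ (((AlgebraicTopology.singularHomologyFunctor (ModuleCat.{0} ℚ) 1).obj
    (ModuleCat.of ℚ ℚ)).obj (TopCat.of C)) / 2

/-! ### The category of stable noded Riemann surfaces with unordered marked points -/

/-- The structure of a stable, possibly noded, Riemann surface with (unordered) marked points
on the set `X`. -/
structure StableStructure (X : Type) where
  surface : ClosedSurface X
  j : AlmostComplex X
  marked : Finset X
  nodes : Finset (Sym2 X)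
  nodes_not_diag : ∀ e ∈ nodes, ¬ e.IsDiag
  nodes_disjoint : ∀ e ∈ nodes, ∀ e' ∈ nodes, ∀ x, x ∈ e → x ∈ e' → e = e'
  nodes_marked : ∀ e ∈ nodes, ∀ x ∈ e, x ∉ marked
  connected : ConnectedSpace (Quot fun x y : X => s(x, y) ∈ nodes)
  stable : ∀ x : X, 3 ≤ 2 * genus (connectedComponent x) +
    (connectedComponent x ∩ ({y | ∃ e ∈ nodes, y ∈ e} ∪ (marked : Set X))).ncard

/-- A stable, possibly noded, Riemann surface `(S, j, M, D)` with unordered marked points. -/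
structure StableSurface : Type 1 where
  carrier : Type
  str : StableStructure carrier

namespace StableSurface

instance : CoeSort StableSurface Type := ⟨carrier⟩

instance (α : StableSurface) : ClosedSurface α := α.str.surface

/-- The almost complex structure as a field of endomorphisms. -/
def j (α : StableSurface) : EndField α := α.str.j.J

/-- The set `M` of marked points. -/
def marked (α : StableSurface) : Finset α := α.str.marked

/-- The set `D` of nodal pairs. -/
def nodes (α : StableSurface) : Finset (Sym2 α) := α.str.nodes

/-- The set `|D|` of nodal points. -/
def nodal (α : StableSurface) : Set α := {x | ∃ e ∈ α.nodes, x ∈ e}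

/-- `(S, k, M, D)` for another almost complex structure `k`. -/
def withJ (α : StableSurface) (k : AlmostComplex α) : StableSurface where
  carrier := α
  str := { α.str with j := k }

/-- Morphisms: biholomorphic maps which preserve the marked points and the nodal pairs. -/
structure Hom (α β : StableSurface) where
  toDiffeo : α ≃ₘ^∞⟮IP, IP⟯ β
  holo : ∀ (x : α) (v : TangentSpace IP x),
    mfderiv IP IP toDiffeo x (α.j x v) = β.j (toDiffeo x) (mfderiv IP IP toDiffeo x v)
  map_marked : toDiffeo '' (α.marked : Set α) = β.marked
  map_nodes : Sym2.map toDiffeo '' (α.nodes : Set (Sym2 α)) = β.nodes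

theorem Hom.ext' {α β : StableSurface} {f g : Hom α β} (h : ∀ x, f.toDiffeo x = g.toDiffeo x) :
    f = g := by
  obtain ⟨f, _, _, _⟩ := f
  obtain ⟨g, _, _, _⟩ := g
  have : f = g := Diffeomorph.ext h
  subst this
  rfl

theorem mfderiv_diffeo_comp {α β γ : StableSurface} (f : α ≃ₘ^∞⟮IP, IP⟯ β) (g : β ≃ₘ^∞⟮IP, IP⟯ γ)
    (x : α) (v : TangentSpace IP x) : mfderiv IP IP (f.trans g) x v =
      mfderiv IP IP g (f x) (mfderiv IP IP f x v) := by
  have h : mfderiv IP IP (f.trans g) x =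
      (mfderiv IP IP g (f x)).comp (mfderiv IP IP f x) := by
    rw [Diffeomorph.coe_trans]
    exact mfderiv_comp x (g.mdifferentiable (by simp) _) (f.mdifferentiable (by simp) _)
  exact DFunLike.congr_fun h v

theorem mfderiv_diffeo_refl {α : StableSurface} (x : α) (v : TangentSpace IP x) :
    mfderiv IP IP (Diffeomorph.refl IP α ∞) x v = v := by
  have h : mfderiv IP IP (Diffeomorph.refl IP α ∞) x = ContinuousLinearMap.id ℝ _ := by
    rw [Diffeomorph.coe_refl]
    exact mfderiv_id
  exact DFunLike.congr_fun h v

theorem mfderiv_symm_comp {α β : StableSurface} (f : α ≃ₘ^∞⟮IP, IP⟯ β) (x : α)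
    (v : TangentSpace IP x) :
    mfderiv IP IP f.symm (f x) (mfderiv IP IP f x v) = v := by
  have h := mfderiv_diffeo_comp f f.symm x v
  rw [Diffeomorph.self_trans_symm] at h
  exact h.symm.trans (mfderiv_diffeo_refl x v)

theorem mfderiv_comp_symm {α β : StableSurface} (f : α ≃ₘ^∞⟮IP, IP⟯ β) (x : α)
    (v : TangentSpace IP (f x)) :
    mfderiv IP IP f x (mfderiv IP IP f.symm (f x) v) = v := by
  obtain ⟨w, rfl⟩ : ∃ w, mfderiv IP IP f x w = v :=
    (f.mfderivToContinuousLinearEquiv (by simp) x).surjective v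
  rw [mfderiv_symm_comp]

/-- The identity morphism. -/
def Hom.id (α : StableSurface) : Hom α α where
  toDiffeo := Diffeomorph.refl IP α ∞
  holo x v := (mfderiv_diffeo_refl x (α.j x v)).trans
    (congrArg (α.j x) (mfderiv_diffeo_refl x v)).symm
  map_marked := by simp
  map_nodes := by simp

/-- Composition of morphisms. -/
def Hom.comp {α β γ : StableSurface} (f : Hom α β) (g : Hom β γ) : Hom α γ where
  toDiffeo := f.toDiffeo.trans g.toDiffeo
  holo x v := by
    refine (mfderiv_diffeo_comp _ _ x _).trans ?_
    rw [f.holo, g.holo]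
    exact congrArg (γ.j (g.toDiffeo (f.toDiffeo x))) (mfderiv_diffeo_comp _ _ x v).symm
  map_marked := by
    rw [Diffeomorph.coe_trans, image_comp, f.map_marked, g.map_marked]
  map_nodes := by
    rw [Diffeomorph.coe_trans, Sym2.map_comp, image_comp, f.map_nodes, g.map_nodes]

instance : Category StableSurface where
  Hom := Hom
  id := Hom.id
  comp := Hom.comp
  id_comp _ := Hom.ext' fun _ => rfl
  comp_id _ := Hom.ext' fun _ => rfl
  assoc _ _ _ := Hom.ext' fun _ => rfl

/-- The diffeomorphism underlying a morphism. -/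
def diffeo {α β : StableSurface} (f : α ⟶ β) : α ≃ₘ^∞⟮IP, IP⟯ β := Hom.toDiffeo f

theorem diffeo_holo {α β : StableSurface} (f : α ⟶ β) (x : α) (v : TangentSpace IP x) :
    mfderiv IP IP (diffeo f) x (α.j x v) = β.j (diffeo f x) (mfderiv IP IP (diffeo f) x v) :=
  Hom.holo f x v

theorem diffeo_id (α : StableSurface) : diffeo (𝟙 α) = Diffeomorph.refl IP α ∞ := rfl

theorem diffeo_comp {α β γ : StableSurface} (f : α ⟶ β) (g : β ⟶ γ) :
    diffeo (f ≫ g) = (diffeo f).trans (diffeo g) := rfl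

theorem diffeo_symm_holo {α β : StableSurface} (f : α ⟶ β) (y : β) (v : TangentSpace IP y) :
    mfderiv IP IP (diffeo f).symm y (β.j y v) =
      α.j ((diffeo f).symm y) (mfderiv IP IP (diffeo f).symm y v) := by
  obtain ⟨x, rfl⟩ := (diffeo f).surjective y
  obtain ⟨w, rfl⟩ : ∃ w, mfderiv IP IP (diffeo f) x w = v :=
    ((diffeo f).mfderivToContinuousLinearEquiv (by simp) x).surjective v
  have h1 : mfderiv IP IP (diffeo f).symm (diffeo f x)
      (β.j (diffeo f x) (mfderiv IP IP (diffeo f) x w)) = α.j x w := by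
    rw [← diffeo_holo, mfderiv_symm_comp]
  have h2 : ∀ x' : α, x' = x → ∀ u : Plane,
      (α.j x' (show TangentSpace IP x' from u) : Plane) =
        α.j x (show TangentSpace IP x from u) := by
    rintro _ rfl u; rfl
  refine h1.trans ((h2 _ ((diffeo f).symm_apply_apply x) _).trans ?_).symm
  exact congrArg (α.j x) (mfderiv_symm_comp (diffeo f) x w)

theorem map_mem_nodes {α β : StableSurface} (f : α ⟶ β) {e : Sym2 α} (he : e ∈ α.nodes) :
    Sym2.map (diffeo f) e ∈ β.nodes := by
  have h : Sym2.map (diffeo f) e ∈ Sym2.map (diffeo f) '' (α.nodes : Set (Sym2 α)) :=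
    mem_image_of_mem _ he
  have h2 : Sym2.map (diffeo f) '' (α.nodes : Set (Sym2 α)) = β.nodes := Hom.map_nodes f
  rw [h2] at h
  exact h

theorem symm_map_mem_nodes {α β : StableSurface} (f : α ⟶ β) {e : Sym2 β} (he : e ∈ β.nodes) :
    Sym2.map (diffeo f).symm e ∈ α.nodes := by
  have h2 : Sym2.map (diffeo f) '' (α.nodes : Set (Sym2 α)) = β.nodes := Hom.map_nodes f
  have h : e ∈ Sym2.map (diffeo f) '' (α.nodes : Set (Sym2 α)) := by rw [h2]; exact he
  obtain ⟨e', he', rfl⟩ := h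
  have : Sym2.map (diffeo f).symm (Sym2.map (diffeo f) e') = e' := by
    rw [Sym2.map_map]
    have : ((diffeo f).symm ∘ (diffeo f) : α → α) = _root_.id := by
      funext x; simp
    rw [this, Sym2.map_id, _root_.id]
  rw [this]
  exact he'

end StableSurface

/-! ### The deformation space `H¹(α)` -/

namespace StableSurface

/-- `Ω^{0,1}(α)`: the smooth sections of `Hom_ℝ(TS, TS)` which are complex antilinear. -/
def omega01 (α : StableSurface) : AddSubgroup (EndField α) where
  carrier := {τ | IsSmoothEnd τ ∧
    ∀ (x : α) (v : TangentSpace IP x), τ x (α.j x v) = -α.j x (τ x v)}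
  zero_mem' := ⟨fun _ _ => Bundle.contMDiff_zeroSection ℝ (TangentSpace IP : α → Type _),
    fun x v => by simp⟩
  add_mem' := by
    rintro τ σ ⟨h1, h2⟩ ⟨h3, h4⟩
    refine ⟨fun Y hY => (h1 Y hY).add_section (h3 Y hY), fun x v => ?_⟩
    simp only [Pi.add_apply, _root_.add_apply, h2, h4, map_add, neg_add]
  neg_mem' := by
    rintro τ ⟨h1, h2⟩
    refine ⟨fun Y hY => (h1 Y hY).neg_section, fun x v => ?_⟩
    simp only [Pi.neg_apply, _root_.neg_apply, h2, map_neg]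

theorem j_sq (α : StableSurface) (x : α) (v : TangentSpace IP x) : α.j x (α.j x v) = -v :=
  α.str.j.sq x v

theorem j_smooth (α : StableSurface) : IsSmoothEnd α.j := α.str.j.smooth

theorem smooth_const_smul {α : StableSurface} (c : ℝ) {Y : ∀ x : α, TangentSpace IP x}
    (h : IsSmoothVF Y) : IsSmoothVF (fun x => c • Y x) :=
  ContMDiff.const_smul_section h

/-- Complex numbers act on `Ω^{0,1}(α)` through the complex structure of `TS`. -/
instance (α : StableSurface) : SMul ℂ (omega01 α) where
  smul c τ := ⟨fun x => c.re • τ.1 x + c.im • ((α.j x) ∘L (τ.1 x)), by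
    refine ⟨fun Y hY => ?_, fun x v => ?_⟩
    · exact (smooth_const_smul c.re (τ.2.1 Y hY)).add_section
        (smooth_const_smul c.im (α.j_smooth _ (τ.2.1 Y hY)))
    · have h := τ.2.2 x v
      simp only [_root_.add_apply, _root_.smul_apply,
        ContinuousLinearMap.comp_apply, h, map_add, map_neg, map_smul, smul_neg, neg_add]⟩

theorem smul_omega01_apply {α : StableSurface} (c : ℂ) (τ : omega01 α) (x : α)
    (v : TangentSpace IP x) :
    (c • τ).1 x v = c.re • τ.1 x v + c.im • α.j x (τ.1 x v) := rfl

theorem omega01_ext {α : StableSurface} {τ σ : omega01 α}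
    (h : ∀ (x : α) (v : TangentSpace IP x), τ.1 x v = σ.1 x v) : τ = σ :=
  Subtype.ext (funext fun x => ContinuousLinearMap.ext (h x))

theorem add_omega01_apply {α : StableSurface} (τ σ : omega01 α) (x : α)
    (v : TangentSpace IP x) : (τ + σ).1 x v = τ.1 x v + σ.1 x v := rfl

instance (α : StableSurface) : Module ℂ (omega01 α) where
  one_smul τ := omega01_ext fun x v => by simp [smul_omega01_apply]
  mul_smul a b τ := omega01_ext fun x v => by
    simp only [smul_omega01_apply, Complex.mul_re, Complex.mul_im, map_add, map_smul, j_sq]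
    module
  smul_zero a := omega01_ext fun x v => by
    change a.re • (0 : TangentSpace IP x) + a.im • α.j x 0 = 0
    simp
  smul_add a τ σ := omega01_ext fun x v => by
    simp only [smul_omega01_apply, add_omega01_apply, map_add]
    module
  add_smul a b τ := omega01_ext fun x v => by
    simp only [smul_omega01_apply, add_omega01_apply, Complex.add_re, Complex.add_im]
    module
  zero_smul τ := omega01_ext fun x v => by
    simp only [smul_omega01_apply, Complex.zero_re, Complex.zero_im, zero_smul, add_zero]
    rfl

/-- `τ = ∂̄X` for the Cauchy-Riemann operator `∂̄` on vector fields of `(S, j)`,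
`∂̄X (Y) = ½ ([Y, X] + j [jY, X])`, which in a holomorphic coordinate is `½ (dX(Y) + i dX(iY))`. -/
def IsDbar (α : StableSurface) (X : ∀ x : α, TangentSpace IP x) (τ : EndField α) : Prop :=
  ∀ Y : ∀ x : α, TangentSpace IP x, IsSmoothVF Y → ∀ x : α,
    τ x (Y x) = (1 / 2 : ℝ) • (VectorField.mlieBracket IP Y X x +
      α.j x (VectorField.mlieBracket IP (fun x' => α.j x' (Y x')) X x))

/-- `∂̄ Γ₀(α)`, where `Γ₀(α)` consists of the smooth vector fields on `S` vanishing at the marked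
and the nodal points. (The image of the complex linear operator `∂̄` is already a complex
subspace.) -/
def dbarRange (α : StableSurface) : Submodule ℂ (omega01 α) :=
  Submodule.span ℂ {τ | ∃ X : ∀ x : α, TangentSpace IP x, IsSmoothVF X ∧
    (∀ x, x ∈ α.marked ∨ x ∈ α.nodal → X x = 0) ∧ IsDbar α X τ.1}

/-- The natural deformation space `H¹(α) = Ω^{0,1}(α) / ∂̄Γ₀(α)`. -/
def H1 (α : StableSurface) : Type := omega01 α ⧸ dbarRange α

instance (α : StableSurface) : AddCommGroup (H1 α) :=
  inferInstanceAs (AddCommGroup (omega01 α ⧸ dbarRange α))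

instance (α : StableSurface) : Module ℂ (H1 α) :=
  inferInstanceAs (Module ℂ (omega01 α ⧸ dbarRange α))

/-- The topology of the finite dimensional complex vector space `H¹(α)`. -/
instance (α : StableSurface) : TopologicalSpace (H1 α) := moduleTopology ℂ (H1 α)

/-- The class `[τ] ∈ H¹(α)`. -/
def H1.mk {α : StableSurface} : omega01 α →ₗ[ℂ] H1 α := (dbarRange α).mkQ

/-- The push forward `φ ∘ τ ∘ φ⁻¹`, i.e. `Tφ ∘ τ ∘ Tφ⁻¹`. -/
def pushEnd {α β : StableSurface} (f : α ≃ₘ^∞⟮IP, IP⟯ β) (τ : EndField α) : EndField β :=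
  fun y => (mfderiv IP IP f.symm y).inverse ∘L (τ (f.symm y)) ∘L (mfderiv IP IP f.symm y)

theorem isInvertible_symm {α β : StableSurface} (f : α ≃ₘ^∞⟮IP, IP⟯ β) (y : β) :
    (mfderiv IP IP f.symm y).IsInvertible :=
  ⟨f.symm.mfderivToContinuousLinearEquiv (by simp) y, rfl⟩

theorem isInvertible_diffeo {α β : StableSurface} (f : α ≃ₘ^∞⟮IP, IP⟯ β) (x : α) :
    (mfderiv IP IP f x).IsInvertible :=
  ⟨f.mfderivToContinuousLinearEquiv (by simp) x, rfl⟩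

theorem mfderiv_symm_pushEnd {α β : StableSurface} (f : α ≃ₘ^∞⟮IP, IP⟯ β) (τ : EndField α)
    (y : β) (v : TangentSpace IP y) :
    mfderiv IP IP f.symm y (pushEnd f τ y v) = τ (f.symm y) (mfderiv IP IP f.symm y v) := by
  obtain ⟨e, he⟩ := isInvertible_symm f y
  simp only [pushEnd, ContinuousLinearMap.comp_apply, ← he,
    ContinuousLinearMap.inverse_equiv]
  exact e.apply_symm_apply _

theorem mfderiv_symm_injective {α β : StableSurface} (f : α ≃ₘ^∞⟮IP, IP⟯ β) (y : β) :
    Function.Injective (mfderiv IP IP f.symm y) := by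
  obtain ⟨e, he⟩ := isInvertible_symm f y
  rw [← he]
  exact e.injective

theorem pushVF_smooth {α β : StableSurface} (f : α ≃ₘ^∞⟮IP, IP⟯ β)
    {Y : ∀ x : α, TangentSpace IP x} (hY : IsSmoothVF Y) :
    IsSmoothVF (VectorField.mpullback IP IP f.symm Y) :=
  ContMDiff.mpullback_vectorField hY f.symm.contMDiff (isInvertible_symm f) (by simp)

theorem mfderiv_symm_pushVF {α β : StableSurface} (f : α ≃ₘ^∞⟮IP, IP⟯ β)
    (Y : ∀ x : α, TangentSpace IP x) (y : β) :
    mfderiv IP IP f.symm y (VectorField.mpullback IP IP f.symm Y y) = Y (f.symm y) := by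
  obtain ⟨e, he⟩ := isInvertible_symm f y
  simp only [VectorField.mpullback_apply, ← he, ContinuousLinearMap.inverse_equiv]
  exact e.apply_symm_apply _

/-- Every smooth vector field on the target is the push forward of a smooth vector field. -/
theorem exists_pushVF {α β : StableSurface} (f : α ≃ₘ^∞⟮IP, IP⟯ β)
    {Y : ∀ y : β, TangentSpace IP y} (hY : IsSmoothVF Y) :
    ∃ Z : ∀ x : α, TangentSpace IP x, IsSmoothVF Z ∧
      Y = VectorField.mpullback IP IP f.symm Z := by
  refine ⟨VectorField.mpullback IP IP f Y,
    ContMDiff.mpullback_vectorField hY f.contMDiff (isInvertible_diffeo f) (by simp), ?_⟩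
  funext y
  apply mfderiv_symm_injective f y
  rw [mfderiv_symm_pushVF]
  obtain ⟨x, rfl⟩ : ∃ x, f x = y := f.surjective y
  have h1 : ∀ x' : α, x' = x → (VectorField.mpullback IP IP f Y x' : Plane) =
      VectorField.mpullback IP IP f Y x := by
    rintro _ rfl; rfl
  refine Eq.trans ?_ (h1 _ (f.symm_apply_apply x)).symm
  obtain ⟨w, hw⟩ : ∃ w, mfderiv IP IP f x w = Y (f x) :=
    (f.mfderivToContinuousLinearEquiv (by simp) x).surjective _
  obtain ⟨e, he⟩ := isInvertible_diffeo f x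
  rw [VectorField.mpullback_apply, ← hw, ← he, ContinuousLinearMap.inverse_equiv]
  have h2 : (e : TangentSpace IP x →L[ℝ] TangentSpace IP (f x)) w = mfderiv IP IP f x w := by
    rw [he]
  rw [h2]
  refine (mfderiv_symm_comp f x w).trans ?_
  rw [← h2]
  exact (e.symm_apply_apply w).symm

theorem pushVF_bracket {α β : StableSurface} (f : α ≃ₘ^∞⟮IP, IP⟯ β)
    {Y Z : ∀ x : α, TangentSpace IP x} (hY : IsSmoothVF Y) (hZ : IsSmoothVF Z) (y : β) :
    mfderiv IP IP f.symm y (VectorField.mlieBracket IP (VectorField.mpullback IP IP f.symm Y)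
      (VectorField.mpullback IP IP f.symm Z) y) =
    VectorField.mlieBracket IP Y Z (f.symm y) := by
  have hs : minSmoothness ℝ 2 = 2 := minSmoothness_of_isRCLikeNormedField
  have : IsManifold IP (minSmoothness ℝ 2) α := by rw [hs]; infer_instance
  have : IsManifold IP (minSmoothness ℝ 2) β := by rw [hs]; infer_instance
  rw [← VectorField.mpullback_mlieBracket (n := ∞) (hY.mdifferentiable (by simp) _)
    (hZ.mdifferentiable (by simp) _) (f.symm.contMDiff y) (by rw [hs]; exact ENat.LEInfty.out), mfderiv_symm_pushVF]

/-- The push forward of an endomorphism applied to the push forward of a vector field. -/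
theorem pushEnd_pushVF {α β : StableSurface} (f : α ≃ₘ^∞⟮IP, IP⟯ β) (τ : EndField α)
    (Y : ∀ x : α, TangentSpace IP x) :
    (fun y => pushEnd f τ y (VectorField.mpullback IP IP f.symm Y y)) =
      VectorField.mpullback IP IP f.symm (fun x => τ x (Y x)) := by
  funext y
  apply mfderiv_symm_injective f y
  rw [mfderiv_symm_pushEnd, mfderiv_symm_pushVF, mfderiv_symm_pushVF]

theorem pushEnd_smooth {α β : StableSurface} (f : α ≃ₘ^∞⟮IP, IP⟯ β) {τ : EndField α}
    (h : IsSmoothEnd τ) : IsSmoothEnd (pushEnd f τ) := by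
  intro Y hY
  obtain ⟨Z, hZ, rfl⟩ := exists_pushVF f hY
  rw [pushEnd_pushVF]
  exact pushVF_smooth f (h Z hZ)

theorem pushEnd_j {α β : StableSurface} (f : α ⟶ β) : pushEnd (diffeo f) α.j = β.j := by
  funext y
  ext1 v
  apply mfderiv_symm_injective (diffeo f) y
  rw [mfderiv_symm_pushEnd, diffeo_symm_holo]

theorem pushEnd_mem {α β : StableSurface} (f : α ⟶ β) {τ : EndField α} (h : τ ∈ omega01 α) :
    pushEnd (diffeo f) τ ∈ omega01 β := by
  refine ⟨pushEnd_smooth _ h.1, fun y v => ?_⟩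
  apply mfderiv_symm_injective (diffeo f) y
  rw [mfderiv_symm_pushEnd, map_neg, diffeo_symm_holo, diffeo_symm_holo, mfderiv_symm_pushEnd,
    h.2]

theorem pushEnd_add {α β : StableSurface} (f : α ≃ₘ^∞⟮IP, IP⟯ β) (τ σ : EndField α) (y : β)
    (v : TangentSpace IP y) :
    pushEnd f (τ + σ) y v = pushEnd f τ y v + pushEnd f σ y v := by
  apply mfderiv_symm_injective f y
  rw [map_add, mfderiv_symm_pushEnd, mfderiv_symm_pushEnd, mfderiv_symm_pushEnd]
  rfl

theorem pushEnd_smul {α β : StableSurface} (f : α ⟶ β) (c : ℂ) (τ : omega01 α) (y : β)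
    (v : TangentSpace IP y) :
    pushEnd (diffeo f) (c • τ).1 y v =
      c.re • pushEnd (diffeo f) τ.1 y v + c.im • β.j y (pushEnd (diffeo f) τ.1 y v) := by
  apply mfderiv_symm_injective (diffeo f) y
  rw [map_add, map_smul, map_smul, diffeo_symm_holo, mfderiv_symm_pushEnd, mfderiv_symm_pushEnd,
    smul_omega01_apply]

/-- The push forward `Ω^{0,1}(α) → Ω^{0,1}(β)` of a morphism. -/
def pushOmega {α β : StableSurface} (f : α ⟶ β) : omega01 α →ₗ[ℂ] omega01 β where
  toFun τ := ⟨pushEnd (diffeo f) τ.1, pushEnd_mem f τ.2⟩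
  map_add' τ σ := omega01_ext fun y v => pushEnd_add (diffeo f) τ.1 σ.1 y v
  map_smul' c τ := omega01_ext fun y v => pushEnd_smul f c τ y v

theorem pushOmega_dbarRange {α β : StableSurface} (f : α ⟶ β) :
    dbarRange α ≤ (dbarRange β).comap (pushOmega f) := by
  rw [dbarRange, Submodule.span_le]
  rintro τ ⟨X, hX, hX0, hτ⟩
  refine Submodule.subset_span ⟨VectorField.mpullback IP IP (diffeo f).symm X,
    pushVF_smooth _ hX, fun y hy => ?_, fun Y hY y => ?_⟩
  · apply mfderiv_symm_injective (diffeo f) y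
    rw [mfderiv_symm_pushVF, map_zero]
    apply hX0
    rcases hy with hy | ⟨e, he, hye⟩
    · left
      have h2 : diffeo f '' (α.marked : Set α) = β.marked := Hom.map_marked f
      have h3 : y ∈ diffeo f '' (α.marked : Set α) := by rw [h2]; exact hy
      obtain ⟨x, hx, rfl⟩ := h3
      rw [(diffeo f).symm_apply_apply]
      exact hx
    · right
      exact ⟨_, symm_map_mem_nodes f he, Sym2.mem_map.2 ⟨y, hye, rfl⟩⟩
  · obtain ⟨Z, hZ, rfl⟩ := exists_pushVF (diffeo f) hY
    apply mfderiv_symm_injective (diffeo f) y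
    have h1 := pushEnd_pushVF (diffeo f) α.j Z
    rw [pushEnd_j] at h1
    rw [h1, map_smul, map_add, diffeo_symm_holo, pushVF_bracket _ hZ hX,
      pushVF_bracket _ (α.j_smooth _ hZ) hX, ← hτ Z hZ]
    change mfderiv IP IP (diffeo f).symm y (pushEnd (diffeo f) τ.1 y _) = _
    rw [mfderiv_symm_pushEnd, mfderiv_symm_pushVF]

/-- The linear map `H¹(φ) : H¹(α) → H¹(β)`, `[τ] ↦ [φ ∘ τ ∘ φ⁻¹]`, of a morphism `φ`. -/
def H1.map {α β : StableSurface} (f : α ⟶ β) : H1 α →ₗ[ℂ] H1 β :=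
  Submodule.mapQ (dbarRange α) (dbarRange β) (pushOmega f) (pushOmega_dbarRange f)

theorem H1.map_mk {α β : StableSurface} (f : α ⟶ β) (τ : omega01 α) :
    H1.map f (H1.mk τ) = H1.mk (pushOmega f τ) := rfl

theorem H1.mk_surjective {α : StableSurface} (ξ : H1 α) : ∃ τ : omega01 α, H1.mk τ = ξ :=
  Submodule.mkQ_surjective (dbarRange α) ξ

theorem H1.map_id (α : StableSurface) (ξ : H1 α) : H1.map (𝟙 α) ξ = ξ := by
  obtain ⟨τ, rfl⟩ := H1.mk_surjective ξ
  rw [H1.map_mk]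
  congr 1
  refine omega01_ext fun x v => ?_
  apply mfderiv_symm_injective (diffeo (𝟙 α)) x
  refine (mfderiv_symm_pushEnd (diffeo (𝟙 α)) τ.1 x v).trans ?_
  exact (congrArg (τ.1 x) (mfderiv_diffeo_refl x v)).trans (mfderiv_diffeo_refl x _).symm

theorem H1.map_comp {α β γ : StableSurface} (f : α ⟶ β) (g : β ⟶ γ) (ξ : H1 α) :
    H1.map (f ≫ g) ξ = H1.map g (H1.map f ξ) := by
  obtain ⟨τ, rfl⟩ := H1.mk_surjective ξ
  rw [H1.map_mk, H1.map_mk, H1.map_mk]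
  congr 1
  refine omega01_ext fun x v => ?_
  apply mfderiv_symm_injective (diffeo (f ≫ g)) x
  refine (mfderiv_symm_pushEnd (diffeo (f ≫ g)) τ.1 x v).trans ?_
  have h : ∀ w : TangentSpace IP x, mfderiv IP IP (diffeo (f ≫ g)).symm x w =
      mfderiv IP IP (diffeo f).symm ((diffeo g).symm x) (mfderiv IP IP (diffeo g).symm x w) :=
    fun w => mfderiv_diffeo_comp (diffeo g).symm (diffeo f).symm x w
  refine Eq.trans ?_ (h _).symm
  change _ = mfderiv IP IP (diffeo f).symm ((diffeo g).symm x)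
    (mfderiv IP IP (diffeo g).symm x (pushEnd (diffeo g) (pushEnd (diffeo f) τ.1) x v))
  rw [mfderiv_symm_pushEnd, mfderiv_symm_pushEnd]
  exact congrArg (τ.1 ((diffeo f).symm ((diffeo g).symm x))) (h v)

end StableSurface

/-! ### Natural gluing parameters -/

namespace StableSurface

/-- Multiplication of a tangent vector of `(S, j)` by a complex number. -/
def rotate {α : StableSurface} (z : ℂ) (u : TangentBundle IP α) : TangentBundle IP α :=
  ⟨u.proj, z.re • u.snd + z.im • α.j u.proj u.snd⟩

theorem rotate_ne_zero {α : StableSurface} {z : ℂ} (hz : z ≠ 0) {u : TangentBundle IP α}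
    (hu : u.snd ≠ 0) : (rotate z u).snd ≠ 0 := by
  intro h
  have h1 : z.re • u.snd + z.im • α.j u.proj u.snd = 0 := h
  have h2 := congrArg (α.j u.proj) h1
  rw [map_add, map_smul, map_smul, j_sq, map_zero] at h2
  have h3 : (z.re * z.re + z.im * z.im) • u.snd = 0 := by
    have : (z.re * z.re + z.im * z.im) • u.snd =
        z.re • (z.re • u.snd + z.im • α.j u.proj u.snd) -
          z.im • (z.re • α.j u.proj u.snd + z.im • -u.snd) := by module
    rw [this, h1, h2, smul_zero, smul_zero, sub_zero]
  rcases smul_eq_zero.1 h3 with h4 | h4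
  · exact hz (Complex.normSq_eq_zero.1 (by rw [Complex.normSq_apply]; exact h4))
  · exact hu h4

/-- The tangent map of the diffeomorphism underlying a morphism. -/
def tangentPush {α β : StableSurface} (f : α ⟶ β) (u : TangentBundle IP α) : TangentBundle IP β :=
  ⟨diffeo f u.proj, mfderiv IP IP (diffeo f) u.proj u.snd⟩

theorem tangentPush_rotate {α β : StableSurface} (f : α ⟶ β) (z : ℂ) (u : TangentBundle IP α) :
    tangentPush f (rotate z u) = rotate z (tangentPush f u) := by
  have h : mfderiv IP IP (diffeo f) u.proj (z.re • u.snd + z.im • α.j u.proj u.snd) =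
      z.re • mfderiv IP IP (diffeo f) u.proj u.snd +
        z.im • β.j (diffeo f u.proj) (mfderiv IP IP (diffeo f) u.proj u.snd) := by
    rw [map_add, map_smul, map_smul, diffeo_holo]
  exact congrArg (fun v => (⟨diffeo f u.proj, v⟩ : TangentBundle IP β)) h

theorem tangentPush_ne_zero {α β : StableSurface} (f : α ⟶ β) {u : TangentBundle IP α}
    (hu : u.snd ≠ 0) : (tangentPush f u).snd ≠ 0 := by
  intro h
  apply hu
  apply ((diffeo f).mfderivToContinuousLinearEquiv (by simp) u.proj).injective
  rw [map_zero]
  exact h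

/-- A representative of a formal expression `r[x̂, ŷ]` over the nodal pair `e = {x, y}`. The oriented
real lines `x̂` and `ŷ` are given by the nonzero tangent vectors `u` and `w` which span them. -/
structure GluingRep (α : StableSurface) (e : Sym2 α) where
  r : ℝ
  r_nonneg : 0 ≤ r
  r_lt : r < 1 / 2
  u : TangentBundle IP α
  w : TangentBundle IP α
  u_ne : u.snd ≠ 0
  w_ne : w.snd ≠ 0
  above : s(u.proj, w.proj) = e

/-- `r[x̂, ŷ] = r'[x̂', ŷ']`: either `r = r' = 0`, or `r = r'` and the unordered pairs of oriented
lines satisfy `x̂' = θ x̂`, `ŷ' = θ⁻¹ ŷ` for some unit complex number `θ`. -/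
def GluingRep.Rel {α : StableSurface} {e : Sym2 α} (p q : GluingRep α e) : Prop :=
  (p.r = 0 ∧ q.r = 0) ∨ (p.r = q.r ∧ ∃ (θ : Circle) (c d : ℝ), 0 < c ∧ 0 < d ∧
    ((q.u = rotate (c * (θ : ℂ)) p.u ∧ q.w = rotate (d * (θ⁻¹ : Circle)) p.w) ∨
      (q.w = rotate (c * (θ : ℂ)) p.u ∧ q.u = rotate (d * (θ⁻¹ : Circle)) p.w)))

/-- The set of natural gluing parameters associated to the nodal pair `e`. -/
def GluingParam (α : StableSurface) (e : Sym2 α) : Type :=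
  Quot (GluingRep.Rel (α := α) (e := e))

/-- The formal expression `r[x̂, ŷ]`. -/
def GluingParam.mk {α : StableSurface} {e : Sym2 α} (p : GluingRep α e) : GluingParam α e :=
  Quot.mk _ p

/-- The modulus `r` of the gluing parameter `r[x̂, ŷ]`. -/
def GluingParam.modulus {α : StableSurface} {e : Sym2 α} (b : GluingParam α e) : ℝ :=
  Quot.lift GluingRep.r (by
    rintro p q (⟨h1, h2⟩ | ⟨h, -⟩)
    · rw [h1, h2]
    · exact h) b

/-- `r[x̂, ŷ] ↦ r[Tφ x̂, Tφ ŷ]` on representatives. -/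
def GluingRep.push {α β : StableSurface} (f : α ⟶ β) {e : Sym2 α} {e' : Sym2 β}
    (h : Sym2.map (diffeo f) e = e') (p : GluingRep α e) : GluingRep β e' where
  r := p.r
  r_nonneg := p.r_nonneg
  r_lt := p.r_lt
  u := tangentPush f p.u
  w := tangentPush f p.w
  u_ne := tangentPush_ne_zero f p.u_ne
  w_ne := tangentPush_ne_zero f p.w_ne
  above := (congrArg (Sym2.map (diffeo f)) p.above).trans h

/-- `r[x̂, ŷ] ↦ r[Tφ x̂, Tφ ŷ]`. -/
def GluingParam.push {α β : StableSurface} (f : α ⟶ β) {e : Sym2 α} {e' : Sym2 β}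
    (h : Sym2.map (diffeo f) e = e') : GluingParam α e → GluingParam β e' :=
  Quot.map (GluingRep.push f h) (by
    rintro p q (hpq | ⟨h1, θ, c, d, hc, hd, h2⟩)
    · exact Or.inl hpq
    · refine Or.inr ⟨h1, θ, c, d, hc, hd, ?_⟩
      simp only [GluingRep.push, ← tangentPush_rotate]
      rcases h2 with ⟨h2, h3⟩ | ⟨h2, h3⟩
      · exact Or.inl ⟨congrArg _ h2, congrArg _ h3⟩
      · exact Or.inr ⟨congrArg _ h2, congrArg _ h3⟩)

theorem GluingParam.push_id {α : StableSurface} {e : Sym2 α}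
    (h : Sym2.map (diffeo (𝟙 α)) e = e) (b : GluingParam α e) : b.push (𝟙 α) h = b := by
  obtain ⟨p, rfl⟩ := Quot.exists_rep b
  have h1 : ∀ u : TangentBundle IP α, tangentPush (𝟙 α) u = u := fun u =>
    congrArg (fun v => (⟨u.proj, v⟩ : TangentBundle IP α)) (mfderiv_diffeo_refl u.proj u.snd)
  refine congrArg (Quot.mk _) ?_
  obtain ⟨r, h2, h3, u, w, h4, h5, h6⟩ := p
  simp only [GluingRep.push, h1]

theorem GluingParam.push_push {α β γ : StableSurface} (f : α ⟶ β) (g : β ⟶ γ) {e : Sym2 α}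
    {e' : Sym2 β} {e'' : Sym2 γ} (h : Sym2.map (diffeo f) e = e')
    (h' : Sym2.map (diffeo g) e' = e'') (h'' : Sym2.map (diffeo (f ≫ g)) e = e'')
    (b : GluingParam α e) : (b.push f h).push g h' = b.push (f ≫ g) h'' := by
  obtain ⟨p, rfl⟩ := Quot.exists_rep b
  have h1 : ∀ u : TangentBundle IP α, tangentPush g (tangentPush f u) = tangentPush (f ≫ g) u :=
    fun u => congrArg (fun v => (⟨diffeo g (diffeo f u.proj), v⟩ : TangentBundle IP γ))
      (mfderiv_diffeo_comp (diffeo f) (diffeo g) u.proj u.snd).symm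
  refine congrArg (Quot.mk _) ?_
  simp only [GluingRep.push, h1]

/-- A pair of oriented lines over the two points of a nodal pair. -/
structure NodeFrame (α : StableSurface) (e : Sym2 α) where
  u : TangentBundle IP α
  w : TangentBundle IP α
  u_ne : u.snd ≠ 0
  w_ne : w.snd ≠ 0
  above : s(u.proj, w.proj) = e

/-- The gluing parameter `r[x̂, θŷ]` with coordinate `z = rθ`. -/
def NodeFrame.param {α : StableSurface} {e : Sym2 α} (p : NodeFrame α e)
    (z : {z : ℂ // ‖z‖ < 1 / 2}) : GluingParam α e :=
  GluingParam.mk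
    { r := ‖z.1‖
      r_nonneg := norm_nonneg _
      r_lt := z.2
      u := p.u
      w := rotate (if z.1 = 0 then 1 else z.1) p.w
      u_ne := p.u_ne
      w_ne := rotate_ne_zero (by split_ifs with h; exacts [one_ne_zero, h]) p.w_ne
      above := p.above }

/-- The gluing parameter `b` has the coordinate `z`, i.e. `b = r[x̂, θŷ]` and `z = rθ`. -/
def NodeFrame.HasCoord {α : StableSurface} {e : Sym2 α} (p : NodeFrame α e)
    (b : GluingParam α e) (z : ℂ) : Prop :=
  ∃ h : ‖z‖ < 1 / 2, p.param ⟨z, h⟩ = b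

/-- The topology for which the maps `r[x̂, θŷ] ↦ rθ` are homeomorphisms onto the open disk of
radius `1/2`. -/
instance (α : StableSurface) (e : Sym2 α) : TopologicalSpace (GluingParam α e) :=
  ⨆ p : NodeFrame α e, TopologicalSpace.coinduced p.param inferInstance

/-- `𝔹^α`: the natural (total) gluing parameters. -/
abbrev Gluing (α : StableSurface) : Type := ∀ e : α.nodes, GluingParam α e.1

theorem map_map_symm {α β : StableSurface} (f : α ⟶ β) (e : Sym2 β) :
    Sym2.map (diffeo f) (Sym2.map (diffeo f).symm e) = e := by
  rw [Sym2.map_map]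
  have : ((diffeo f) ∘ (diffeo f).symm : β → β) = _root_.id := by
    funext x; simp
  rw [this, Sym2.map_id, _root_.id]

/-- `φ_* : 𝔹^α → 𝔹^β`, `(φ_* 𝔞)^{φ(x), φ(y)} = r[Tφ x̂, Tφ ŷ]` where `𝔞^{x, y} = r[x̂, ŷ]`. -/
def Gluing.push {α β : StableSurface} (f : α ⟶ β) (a : Gluing α) : Gluing β :=
  fun e => (a ⟨Sym2.map (diffeo f).symm e.1, symm_map_mem_nodes f e.2⟩).push f
    (map_map_symm f e.1)

theorem Gluing.push_id {α : StableSurface} (a : Gluing α) : a.push (𝟙 α) = a := by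
  funext e
  have h : ∀ (e' : α.nodes) (h : Sym2.map (diffeo (𝟙 α)) e'.1 = e.1),
      (a e').push (𝟙 α) h = a e := by
    intro e' h
    have h1 : e' = e := by
      apply Subtype.ext
      rw [← h, diffeo_id, Diffeomorph.coe_refl, Sym2.map_id, _root_.id]
    subst h1
    exact GluingParam.push_id _ _
  exact h ⟨_, symm_map_mem_nodes (𝟙 α) e.2⟩ (map_map_symm (𝟙 α) e.1)

theorem Gluing.push_comp {α β γ : StableSurface} (f : α ⟶ β) (g : β ⟶ γ) (a : Gluing α) :
    a.push (f ≫ g) = (a.push f).push g := by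
  funext e
  have h : ∀ (e₁ e₂ : α.nodes) (h : e₁ = e₂) (h₁ : Sym2.map (diffeo (f ≫ g)) e₁.1 = e.1)
      (e' : β.nodes) (h₂ : Sym2.map (diffeo f) e₂.1 = e'.1) (h₃ : Sym2.map (diffeo g) e'.1 = e.1),
      (a e₁).push (f ≫ g) h₁ = ((a e₂).push f h₂).push g h₃ := by
    rintro e₁ _ rfl h₁ e' h₂ h₃
    exact (GluingParam.push_push f g h₂ h₃ h₁ _).symm
  refine h ⟨_, symm_map_mem_nodes (f ≫ g) e.2⟩
    ⟨_, symm_map_mem_nodes f (symm_map_mem_nodes g e.2)⟩ (Subtype.ext ?_)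
    (map_map_symm (f ≫ g) e.1) ⟨_, symm_map_mem_nodes g e.2⟩ (map_map_symm f _)
    (map_map_symm g e.1)
  change Sym2.map (diffeo (f ≫ g)).symm e.1 = Sym2.map (diffeo f).symm (Sym2.map (diffeo g).symm e.1)
  rw [Sym2.map_map]
  rfl

/-- The parameter space `H¹(α) × 𝔹^α`. -/
def Param (α : StableSurface) : Type := H1 α × Gluing α

instance (α : StableSurface) : TopologicalSpace (Param α) :=
  inferInstanceAs (TopologicalSpace (H1 α × Gluing α))

/-- `φ_* : H¹(α) × 𝔹^α → H¹(β) × 𝔹^β`. -/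
def Param.push {α β : StableSurface} (f : α ⟶ β) (q : Param α) : Param β :=
  (H1.map f q.1, q.2.push f)

/-- The action `g ∗ (v, 𝔞) = (g ∗ v, g ∗ 𝔞)` of the automorphism group `G`. -/
instance (α : StableSurface) : MulAction (Aut α) (Param α) where
  smul g q := q.push g.hom
  one_smul q := Prod.ext (H1.map_id α q.1) (Gluing.push_id q.2)
  mul_smul g h q := Prod.ext (H1.map_comp h.hom g.hom q.1) (Gluing.push_comp h.hom g.hom q.2)

/-- Holomorphic coordinates on `H¹(α) × 𝔹^α`. -/
structure ParamChart (α : StableSurface) (n : ℕ) where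
  lin : H1 α ≃ₗ[ℂ] (Fin n → ℂ)
  frame : ∀ e : α.nodes, NodeFrame α e.1

/-- The point `q` has the coordinates `y`. -/
def ParamChart.HasCoord {α : StableSurface} {n : ℕ} (κ : ParamChart α n) (q : Param α)
    (y : (Fin n → ℂ) × (α.nodes → ℂ)) : Prop :=
  κ.lin q.1 = y.1 ∧ ∀ e, (κ.frame e).HasCoord (q.2 e) (y.2 e)

/-! ### Translation groupoids -/

/-- The translation groupoid `G ⋉ O` of a subset `O` of `H¹(α) × 𝔹^α`, where `G` is the automorphism
group of `α`. Its morphisms `q ⟶ g ∗ q` are the pairs `(g, q)`. -/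
def TranslationGroupoid {α : StableSurface} (O : Set (Param α)) : Type := {q : Param α // q ∈ O}

instance {α : StableSurface} (O : Set (Param α)) : TopologicalSpace (TranslationGroupoid O) :=
  inferInstanceAs (TopologicalSpace {q : Param α // q ∈ O})

instance {α : StableSurface} (O : Set (Param α)) : Category (TranslationGroupoid O) where
  Hom q q' := {g : Aut α // g • q.1 = q'.1}
  id q := ⟨1, one_smul _ _⟩
  comp g h := ⟨h.1 * g.1, by rw [mul_smul, g.2, h.2]⟩
  id_comp g := Subtype.ext (mul_one _)
  comp_id g := Subtype.ext (one_mul _)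
  assoc f g h := Subtype.ext (mul_assoc _ _ _)

/-- Smoothness of a map between open subsets of parameter spaces. -/
def IsSmoothOn {α α' : StableSurface} {O : Set (Param α)} {O' : Set (Param α')}
    (f : TranslationGroupoid O → TranslationGroupoid O') (W : Set (TranslationGroupoid O)) : Prop :=
  ∀ (n n' : ℕ) (κ : ParamChart α n) (κ' : ParamChart α' n'),
    ∃ F : (Fin n → ℂ) × (α.nodes → ℂ) → (Fin n' → ℂ) × (α'.nodes → ℂ),
      ContDiffOn ℝ ∞ F {y | ∃ q ∈ W, κ.HasCoord q.1 y} ∧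
      ∀ q ∈ W, ∀ y, κ.HasCoord q.1 y → κ'.HasCoord (f q).1 (F y)

/-- A smooth equivalence between translation groupoids: an equivalence of categories which is smooth
on objects and on morphisms and a local diffeomorphism on objects. (The group is discrete: given
smoothness on objects, smoothness on morphisms `(g, q)` means that the group component
of the image is locally constant.) -/
structure IsSmoothEquivalence {α α' : StableSurface} {O : Set (Param α)} {O' : Set (Param α')}
    (f : TranslationGroupoid O ⥤ TranslationGroupoid O') : Prop where
  isEquivalence : f.IsEquivalence
  smooth_obj : IsSmoothOn f.obj univ
  smooth_mor : ∀ (q₀ q₁ : TranslationGroupoid O) (m : q₀ ⟶ q₁), ∀ᶠ q in 𝓝 q₀,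
    ∀ (q' : TranslationGroupoid O) (m' : q ⟶ q'), m'.1 = m.1 → (f.map m').1 = (f.map m).1
  local_diffeo : ∀ q₀ : TranslationGroupoid O, ∃ W : Set (TranslationGroupoid O),
    IsOpen W ∧ q₀ ∈ W ∧ IsOpen (f.obj '' W) ∧
    ∃ g : TranslationGroupoid O' → TranslationGroupoid O,
      LeftInvOn g f.obj W ∧ IsSmoothOn g (f.obj '' W)

/-! ### Small disk structures and plumbing -/

/-- A gluing profile: a smooth diffeomorphism `(0, 1] → [0, ∞)`. -/
structure GluingProfile where
  toFun : ℝ → ℝ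
  inv : ℝ → ℝ
  mapsTo : MapsTo toFun (Ioc 0 1) (Ici 0)
  inv_mapsTo : MapsTo inv (Ici 0) (Ioc 0 1)
  invOn : InvOn inv toFun (Ioc 0 1) (Ici 0)
  smooth : ContDiffOn ℝ ∞ toFun (Ioc 0 1)
  inv_smooth : ContDiffOn ℝ ∞ inv (Ici 0)

/-- A small disk structure: for each nodal point `x` a compact disk `disk x` with smooth boundary
around `x`. (`disk x` is empty if `x` is not a nodal point.) -/
@[ext]
structure SmallDisks (α : StableSurface) where
  disk : α → Set α
  disk_of_notMem : ∀ x, x ∉ α.nodal → disk x = ∅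
  isDisk : ∀ x ∈ α.nodal, ∃ c ∈ SurfaceCharts.charts (X := α),
    Metric.closedBall (0 : Plane) 1 ⊆ c.target ∧ disk x = c.symm '' Metric.closedBall 0 1 ∧
      x ∈ c.symm '' Metric.ball 0 1
  disjoint : ∀ x ∈ α.nodal, ∀ y ∈ α.nodal, x ≠ y → Disjoint (disk x) (disk y)
  invariant : ∀ g : Aut α, diffeo g.hom '' (⋃ x ∈ α.nodal, disk x) = ⋃ x ∈ α.nodal, disk x
  marked : ∀ x ∈ α.nodal, ∀ y ∈ disk x, y ∉ α.marked

/-- The derivative of a complex valued function. -/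
def derivC {α : StableSurface} (h : α → ℂ) (x : α) (v : TangentSpace IP x) : ℂ :=
  NormedSpace.fromTangentSpace (h x) (mfderiv IP 𝓘(ℝ, ℂ) h x v)

/-- `h` restricts to the biholomorphic map `(D_x, x) → (𝔻, 0)` whose derivative at `x` maps the
oriented line spanned by the tangent vector `u` at `x` to `ℝ`. -/
structure SmallDisks.IsCoord {α : StableSurface} (𝒟 : SmallDisks α) (u : TangentBundle IP α)
    (h : α → ℂ) : Prop where
  bijOn : BijOn h (𝒟.disk u.proj) (Metric.closedBall 0 1)
  continuousOn : ContinuousOn h (𝒟.disk u.proj)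
  smooth : ContMDiffOn IP 𝓘(ℝ, ℂ) ∞ h (interior (𝒟.disk u.proj))
  holo : ∀ x ∈ interior (𝒟.disk u.proj), ∀ v : TangentSpace IP x,
    derivC h x (α.j x v) = Complex.I * derivC h x v
  center : h u.proj = 0
  line : ∃ t : ℝ, 0 < t ∧ derivC h u.proj u.snd = t

/-- The points of `S` which are discarded in the plumbing construction with gluing parameter `a`:
those in `D_x \ A_x`, where `A_x = {e^{-2πR} ≤ |h_x| ≤ 1}` is the concentric annulus of modulus
`R = φ(r)`, for the nodal pairs `{x, y}` with `r[x̂, ŷ] = 𝔞^{x, y} ≠ 0`. -/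
def Discarded (φ : GluingProfile) {α : StableSurface} (𝒟 : SmallDisks α) (a : Gluing α)
    (z : α) : Prop :=
  ∃ (e : α.nodes) (p : GluingRep α e.1) (h : α → ℂ), a e = GluingParam.mk p ∧ p.r ≠ 0 ∧
    𝒟.IsCoord p.u h ∧ z ∈ 𝒟.disk p.u.proj ∧ ‖h z‖ < Real.exp (-2 * Real.pi * φ.toFun p.r)

/-- The points which are kept. -/
def kept (φ : GluingProfile) {α : StableSurface} (𝒟 : SmallDisks α) (a : Gluing α) : Set α :=
  {z | ¬ Discarded φ 𝒟 a z}

/-- The identification of `z ∈ A_x` with `z' ∈ A_y` if `h_x(z) h_y(z') = e^{-2πR}`. -/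
def Identified (φ : GluingProfile) {α : StableSurface} (𝒟 : SmallDisks α) (a : Gluing α)
    (z z' : α) : Prop :=
  ∃ (e : α.nodes) (p : GluingRep α e.1) (h h' : α → ℂ), a e = GluingParam.mk p ∧ p.r ≠ 0 ∧
    𝒟.IsCoord p.u h ∧ 𝒟.IsCoord p.w h' ∧ z ∈ 𝒟.disk p.u.proj ∧ z' ∈ 𝒟.disk p.w.proj ∧
    h z * h' z' = (Real.exp (-2 * Real.pi * φ.toFun p.r) : ℂ)

/-- The set `S_𝔞` underlying the glued surface. -/
def Glued (φ : GluingProfile) {α : StableSurface} (𝒟 : SmallDisks α) (a : Gluing α) : Type :=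
  Quot fun z z' : kept φ 𝒟 a => Identified φ 𝒟 a z z'

/-- The point of `S_𝔞` given by a point of `S` which is kept. -/
def Glued.mk {φ : GluingProfile} {α : StableSurface} {𝒟 : SmallDisks α} {a : Gluing α} (z : α)
    (hz : z ∈ kept φ 𝒟 a) : Glued φ 𝒟 a :=
  Quot.mk _ ⟨z, hz⟩

/-- The glued surface, once its structure `s` is given. -/
def gluedSurface {φ : GluingProfile} {α : StableSurface} {𝒟 : SmallDisks α} {a : Gluing α}
    (s : StableStructure (Glued φ 𝒟 a)) : StableSurface where
  carrier := Glued φ 𝒟 a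
  str := s

/-- The structure `s` on the set `S_𝔞` is the structure of
`(S_𝔞, k_𝔞, M_𝔞, D_𝔞)`, obtained from `(S, k, M, D)` by plumbing. -/
structure IsPlumbing (φ : GluingProfile) {α : StableSurface} (𝒟 : SmallDisks α)
    (k : AlmostComplex α) (a : Gluing α) (s : StableStructure (Glued φ 𝒟 a)) : Prop where
  /-- The natural map to `S_𝔞` is a local diffeomorphism, holomorphic with respect to `k` and the
  almost complex structure of `S_𝔞`, on the interior of the set of kept points. -/
  local_biholo : ∀ z ∈ interior (kept φ 𝒟 a), ∃ Θ : α → gluedSurface s,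
    IsLocalDiffeomorphAt IP IP ∞ Θ z ∧ ∀ᶠ z' in 𝓝 z,
      (∃ h : z' ∈ kept φ 𝒟 a, Θ z' = Glued.mk z' h) ∧
      ∀ v : TangentSpace IP z', mfderiv IP IP Θ z' (k.J z' v) =
        (gluedSurface s).j (Θ z') (mfderiv IP IP Θ z' v)
  /-- The interior of the set of kept points covers `S_𝔞`: the points on the inner boundary of `A_x` are
  identified with points on the outer boundary of `A_y`. -/
  covers : ∀ x : Glued φ 𝒟 a, ∃ z, ∃ h : z ∈ interior (kept φ 𝒟 a),
    x = Glued.mk z (interior_subset h)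
  marked : (s.marked : Set (Glued φ 𝒟 a)) = {p | ∃ x ∈ α.marked, ∃ h, p = Glued.mk x h}
  nodes : (s.nodes : Set (Sym2 (Glued φ 𝒟 a))) =
    {e' | ∃ (e : α.nodes) (x y : α) (hx : x ∈ kept φ 𝒟 a) (hy : y ∈ kept φ 𝒟 a),
      e.1 = s(x, y) ∧ (a e).modulus = 0 ∧ e' = s(Glued.mk x hx, Glued.mk y hy)}

/-- The map `F : S_𝔞 → S'_𝔞'` between glued surfaces is induced by `f : S → S'`. -/
def InducedBy {φ : GluingProfile} {α α' : StableSurface} {𝒟 : SmallDisks α} {𝒟' : SmallDisks α'}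
    {a : Gluing α} {a' : Gluing α'} (f : α → α') (F : Glued φ 𝒟 a → Glued φ 𝒟' a') : Prop :=
  ∀ (z : α) (hz : z ∈ kept φ 𝒟 a), ∃ hz' : f z ∈ kept φ 𝒟' a',
    F (Glued.mk z hz) = Glued.mk (f z) hz'

end StableSurface

open StableSurface

/-! ### The orbit space of the category of stable noded Riemann surfaces -/

/-- The set of isomorphism classes of objects of a category. -/
def OrbitSpace (C : Type*) [Category C] : Type _ := Quot fun a b : C => Nonempty (a ≅ b)

/-- The isomorphism class of an object. -/
def OrbitSpace.mk {C : Type*} [Category C] (a : C) : OrbitSpace C := Quot.mk _ a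

/-- The map between orbit spaces induced by a functor. -/
def OrbitSpace.map {C D : Type*} [Category C] [Category D] (F : C ⥤ D) :
    OrbitSpace C → OrbitSpace D :=
  Quot.map F.obj fun _ _ ⟨i⟩ => ⟨F.mapIso i⟩

/-- The quotient topology on the orbit space of a translation groupoid. -/
instance {α : StableSurface} (O : Set (StableSurface.Param α)) :
    TopologicalSpace (OrbitSpace (StableSurface.TranslationGroupoid O)) :=
  inferInstanceAs (TopologicalSpace (Quot _))

/-- The set of isomorphism classes `|𝓡|` of stable noded Riemann surfaces. The gluing profile is
used in the description of its topology. -/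
def ModuliSpace (_φ : GluingProfile) : Type 1 := OrbitSpace StableSurface

/-- The natural topology on `|𝓡|`. The sets of isomorphism classes of the surfaces
`(S_𝔞, k_𝔞, M_𝔞, D_𝔞)`, where `k` is `C^∞`-close to `j` and agrees with `j` on the disks of a small
disk structure and `|𝔞| < ε`, form a basis of neighborhoods of the class of `(S, j, M, D)`. -/
instance (φ : GluingProfile) : TopologicalSpace (ModuliSpace φ) where
  IsOpen W := ∀ (α : StableSurface) (𝒟 : α.SmallDisks), OrbitSpace.mk α ∈ W →
    ∃ N ∈ 𝓝 α.str.j, ∃ ε : ℝ, 0 < ε ∧ ∀ k ∈ N, (∀ x, ∀ y ∈ 𝒟.disk x, k.J y = α.j y) →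
      ∀ a : α.Gluing, (∀ e, (a e).modulus < ε) →
        ∀ s : StableStructure (StableSurface.Glued φ 𝒟 a),
          StableSurface.IsPlumbing φ 𝒟 k a s →
            OrbitSpace.mk (StableSurface.gluedSurface s) ∈ W
  isOpen_univ _ _ _ := ⟨univ, univ_mem, 1, one_pos, fun _ _ _ _ _ _ _ => trivial⟩
  isOpen_inter W W' h h' α 𝒟 hα := by
    obtain ⟨N, hN, ε, hε, H⟩ := h α 𝒟 hα.1
    obtain ⟨N', hN', ε', hε', H'⟩ := h' α 𝒟 hα.2
    exact ⟨N ∩ N', inter_mem hN hN', min ε ε', lt_min hε hε', fun k hk hkj a ha s hs =>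
      ⟨H k hk.1 hkj a (fun e => (ha e).trans_le (min_le_left _ _)) s hs,
        H' k hk.2 hkj a (fun e => (ha e).trans_le (min_le_right _ _)) s hs⟩⟩
  isOpen_sUnion 𝒲 h α 𝒟 hα := by
    obtain ⟨W, hW, hαW⟩ := hα
    obtain ⟨N, hN, ε, hε, H⟩ := h W hW α 𝒟 hαW
    exact ⟨N, hN, ε, hε, fun k hk hkj a ha s hs => ⟨W, hW, H k hk hkj a ha s hs⟩⟩

namespace StableSurface

/-! ### Good uniformizers -/

/-- Good deformations `V ∋ v ↦ j(v)` of `α`, compatible with the small disk structure `𝒟`.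
(The value of `j` outside `V` is irrelevant, and fixed to be the almost complex structure of
`α`.) -/
structure IsGoodDeformation {α : StableSurface} (𝒟 : SmallDisks α) (V : Set (H1 α))
    (j : H1 α → AlmostComplex α) : Prop where
  isOpen : IsOpen V
  zero_mem : 0 ∈ V
  invariant : ∀ g : Aut α, ∀ v ∈ V, H1.map g.hom v ∈ V
  outside : ∀ v, v ∉ V → j v = α.str.j
  smooth : ∃ (n : ℕ) (e : (Fin n → ℂ) ≃ₗ[ℂ] H1 α), ∀ Y : ∀ x : α, TangentSpace IP x,
    IsSmoothVF Y → ContMDiffOn (𝓘(ℝ, Fin n → ℂ).prod IP) IP.tangent ∞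
      (fun p : (Fin n → ℂ) × α => (⟨p.2, (j (e p.1)).J p.2 (Y p.2)⟩ : TangentBundle IP α))
      ((e ⁻¹' V) ×ˢ univ)
  at_zero : j 0 = α.str.j
  on_disks : ∀ v ∈ V, ∀ x, ∀ y ∈ 𝒟.disk x, (j v).J y = α.j y
  /-- For every `v ∈ V` the Kodaira-Spencer differential
  `[Dj(v)] : H¹(α) → H¹(S, j(v), M, D)`, `δv ↦ [Dj(v)δv]`, is a complex linear isomorphism. -/
  kodairaSpencer : ∀ v ∈ V, ∃ L : H1 α ≃ₗ[ℂ] H1 (α.withJ (j v)), ∀ δv : H1 α,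
    ∃ τ : omega01 (α.withJ (j v)), H1.mk τ = L δv ∧
      ∀ (x : α) (w : TangentSpace IP x),
        HasDerivAt (fun t : ℝ => ((j (v + (t : ℂ) • δv)).J x w : Plane)) (τ.1 x w : Plane) 0
  /-- `g : (S, j(v), M, D) → (S, j(g ∗ v), M, D)` is biholomorphic. -/
  equivariant : ∀ g : Aut α, ∀ v ∈ V, ∀ (x : α) (w : TangentSpace IP x),
    mfderiv IP IP (diffeo g.hom) x ((j v).J x w) =
      (j (H1.map g.hom v)).J (diffeo g.hom x) (mfderiv IP IP (diffeo g.hom) x w)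

/-- A family of stable noded Riemann surfaces
`(v, 𝔞) ↦ α_(v, 𝔞) = (S_𝔞, j(v)_𝔞, M_𝔞, D_𝔞)` obtained from `α` by plumbing and by deforming `j`,
with parameters in a `G`-invariant open neighborhood `O` of `(0, 0)` in `V × 𝔹^α`. -/
structure PlumbingFamily (φ : GluingProfile) (α : StableSurface) where
  /-- the small disk structure -/
  disks : SmallDisks α
  /-- the domain of the good deformation -/
  V : Set (H1 α)
  /-- the good deformation -/
  j : H1 α → AlmostComplex α
  good : IsGoodDeformation disks V j
  O : Set (Param α)
  subset : ∀ q ∈ O, q.1 ∈ V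
  isOpen : IsOpen O
  zero_mem : ∀ a : Gluing α, (∀ e, (a e).modulus = 0) → ((0, a) : H1 α × Gluing α) ∈ O
  invariant : ∀ (g : Aut α), ∀ q ∈ O, g • q ∈ O
  /-- the structure of the noded Riemann surface on the set `S_𝔞` -/
  str : ∀ q : TranslationGroupoid O, StableStructure (Glued φ disks q.1.2)
  isPlumbing : ∀ q, IsPlumbing φ disks (j q.1.1) q.1.2 (str q)
  /-- the biholomorphic map `g_𝔞 : α_(v, 𝔞) → α_(g ∗ v, g ∗ 𝔞)` -/
  mor : ∀ {q q' : TranslationGroupoid O}, (q ⟶ q') → (gluedSurface (str q) ⟶ gluedSurface (str q'))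
  mor_induced : ∀ {q q' : TranslationGroupoid O} (g : q ⟶ q'),
    InducedBy (φ := φ) (𝒟 := disks) (𝒟' := disks) (a := q.1.2) (a' := q'.1.2)
      (diffeo g.1.hom) (diffeo (mor g))

namespace PlumbingFamily

variable {φ : GluingProfile} {α : StableSurface}

/-- The functor `Ψ : G ⋉ O → 𝓡`, `Ψ(v, 𝔞) = α_(v, 𝔞)`, `Ψ(g, (v, 𝔞)) = g_𝔞`. -/
def functor (Ψ : PlumbingFamily φ α) : TranslationGroupoid Ψ.O ⥤ StableSurface where
  obj q := gluedSurface (Ψ.str q)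
  map g := Ψ.mor g
  map_id q := Hom.ext' fun x => by
    obtain ⟨⟨z, hz⟩, rfl⟩ := Quot.exists_rep x
    exact (Ψ.mor_induced (𝟙 q) z hz).choose_spec
  map_comp g h := Hom.ext' fun x => by
    obtain ⟨⟨z, hz⟩, rfl⟩ := Quot.exists_rep x
    obtain ⟨h1, h2⟩ := Ψ.mor_induced g z hz
    obtain ⟨h3, h4⟩ := Ψ.mor_induced h _ h1
    obtain ⟨h5, h6⟩ := Ψ.mor_induced (g ≫ h) z hz
    refine h6.trans (h4.symm.trans ?_)
    exact congrArg (diffeo (Ψ.mor h)) h2.symm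

/-- The map `|Ψ| : G \ O → |𝓡|` between orbit spaces. -/
def orbitMap (Ψ : PlumbingFamily φ α) :
    OrbitSpace (TranslationGroupoid Ψ.O) → ModuliSpace φ :=
  OrbitSpace.map Ψ.functor

/-- `ξ ∈ H¹(α_q)` is the value of the partial Kodaira-Spencer differential at `q = (v, 𝔞)` in the
direction of `δv ∈ H¹(α)` and of `δ`, a direction for those components of the gluing parameter which
do not vanish at `q` (so that the combinatorial type is fixed). Here `z` are the
coordinates of `𝔞` with respect to `p`. To obtain `ξ`, one moves `q` along the curve
`c(t) = (v + t δv, 𝔞(t))`, where `𝔞(t)` has the coordinates `z + t δ`, identifies `α_q` with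
`α_{c(t)}` by a smooth family of diffeomorphisms `Θ_t` preserving the marked and the nodal points,
and takes the class of the derivative at `t = 0` of the pull backs by `Θ_t` of the almost complex
structures of `α_{c(t)}`. -/
def IsPartialKodairaSpencer (Ψ : PlumbingFamily φ α) (q : TranslationGroupoid Ψ.O)
    (p : ∀ e : α.nodes, NodeFrame α e.1) (z : α.nodes → ℂ) (δv : H1 α)
    (δ : {e : α.nodes // z e ≠ 0} → ℂ) (ξ : H1 (Ψ.functor.obj q)) : Prop :=
  ∃ (ε : ℝ) (c : ℝ → TranslationGroupoid Ψ.O)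
    (Θ : ∀ t, (Ψ.functor.obj q) ≃ₘ^∞⟮IP, IP⟯ (Ψ.functor.obj (c t)))
    (τ : omega01 (Ψ.functor.obj q)),
    0 < ε ∧
    (∀ t, |t| < ε → (c t).1.1 = q.1.1 + (t : ℂ) • δv ∧
      ∀ e, (p e).HasCoord ((c t).1.2 e) (if h : z e ≠ 0 then z e + t * δ ⟨e, h⟩ else 0)) ∧
    InducedBy (φ := φ) (𝒟 := Ψ.disks) (𝒟' := Ψ.disks) (a := q.1.2) (a' := (c 0).1.2) id (Θ 0) ∧
    (∀ t, |t| < ε → ∀ x : α, (x ∈ α.marked ∨ ∃ e : α.nodes, x ∈ e.1 ∧ (q.1.2 e).modulus = 0) →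
      ∃ (h : x ∈ kept φ Ψ.disks q.1.2) (h' : x ∈ kept φ Ψ.disks (c t).1.2),
        Θ t (Glued.mk x h : Glued φ Ψ.disks q.1.2) = (Glued.mk x h' : Glued φ Ψ.disks (c t).1.2)) ∧
    (∀ s : Ψ.functor.obj q, ∃ (η : ℝ × Ψ.functor.obj q → α) (W : Set (ℝ × Ψ.functor.obj q)),
      W ∈ 𝓝 ((0, s) : ℝ × Ψ.functor.obj q) ∧ ContMDiffOn (𝓘(ℝ, ℝ).prod IP) IP ∞ η W ∧
      ∀ y ∈ W, ∃ h : η y ∈ interior (kept φ Ψ.disks (c y.1).1.2),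
        Θ y.1 y.2 = (Glued.mk (η y) (interior_subset h) : Glued φ Ψ.disks (c y.1).1.2)) ∧
    (∀ (s : Ψ.functor.obj q) (w : TangentSpace IP s), HasDerivAt
      (fun t : ℝ => (mfderiv IP IP (Θ t).symm (Θ t s)
        ((Ψ.functor.obj (c t)).j (Θ t s) (mfderiv IP IP (Θ t) s w)) : Plane)) (τ.1 s w : Plane) 0) ∧
    H1.mk τ = ξ

end PlumbingFamily

/-- The set `F(α)` of good uniformizers `Ψ : G ⋉ O → 𝓡` associated to `α`. -/
structure GoodUniformizer (φ : GluingProfile) (α : StableSurface) extends PlumbingFamily φ α where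
  full : toPlumbingFamily.functor.Full
  faithful : toPlumbingFamily.functor.Faithful
  /-- `|Ψ|` is a homeomorphism onto an open neighborhood of `|α|`. -/
  isOpenEmbedding : IsOpenEmbedding toPlumbingFamily.orbitMap
  mem_range : OrbitSpace.mk α ∈ range toPlumbingFamily.orbitMap
  /-- The partial Kodaira-Spencer differentials are isomorphisms. -/
  partialKodairaSpencer : ∀ (q : TranslationGroupoid O) (p : ∀ e : α.nodes, NodeFrame α e.1)
    (z : α.nodes → ℂ), (∀ e, (p e).HasCoord (q.1.2 e) (z e)) →
    ∃ L : (H1 α × ({e : α.nodes // z e ≠ 0} → ℂ)) ≃ₗ[ℝ] H1 (toPlumbingFamily.functor.obj q),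
      ∀ δv δ ξ, toPlumbingFamily.IsPartialKodairaSpencer q p z δv δ ξ ↔ L (δv, δ) = ξ
  /-- The properness property. -/
  proper : ∀ q : TranslationGroupoid O, ∃ U : Set (TranslationGroupoid O), IsOpen U ∧ q ∈ U ∧
    ∀ s : ℕ → TranslationGroupoid O, (∀ k, s k ∈ U) →
      (∃ y : ModuliSpace φ, Tendsto
        (fun k => toPlumbingFamily.orbitMap (OrbitSpace.mk (s k))) atTop (𝓝 y)) →
      ∃ q' ∈ closure U, ∃ i : ℕ → ℕ, StrictMono i ∧ Tendsto (fun k => s (i k)) atTop (𝓝 q')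

/-- The choices which define `Ψ'` correspond to the choices which define `Ψ` under the
isomorphism `Φ = (α, φ, α')`: `𝐃' = φ_* 𝐃`, `V' = φ_* V`, `j'(φ_* v) = Tφ ∘ j(v) ∘ Tφ⁻¹`
and `O' = φ_* O`. -/
structure IsTransport {φ : GluingProfile} {α α' : StableSurface} (Φ : α ⟶ α')
    (Ψ : GoodUniformizer φ α) (Ψ' : GoodUniformizer φ α') : Prop where
  disks : ∀ x, Ψ'.disks.disk (diffeo Φ x) = diffeo Φ '' Ψ.disks.disk x
  V : Ψ'.V = H1.map Φ '' Ψ.V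
  j : ∀ v ∈ Ψ.V, ∀ (x : α) (w : TangentSpace IP x),
    (Ψ'.j (H1.map Φ v)).J (diffeo Φ x) (mfderiv IP IP (diffeo Φ) x w) =
      mfderiv IP IP (diffeo Φ) x ((Ψ.j v).J x w)
  O : Ψ'.O = Param.push Φ '' Ψ.O

/-- Functors `F : 𝓡 → SET` which are given on objects by `α ↦ F(α)`, the set of good
uniformizers associated to `α`. -/
@[ext]
structure UniformizerFunctor (φ : GluingProfile) where
  map : ∀ {α α' : StableSurface}, (α ⟶ α') → GoodUniformizer φ α → GoodUniformizer φ α'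
  map_id : ∀ (α : StableSurface) (Ψ : GoodUniformizer φ α), map (𝟙 α) Ψ = Ψ
  map_comp : ∀ {α α' α'' : StableSurface} (Φ : α ⟶ α') (Φ' : α' ⟶ α'') (Ψ : GoodUniformizer φ α),
    map (Φ ≫ Φ') Ψ = map Φ' (map Φ Ψ)

/-- The underlying functor. -/
def UniformizerFunctor.toFunctor {φ : GluingProfile} (F : UniformizerFunctor φ) :
    StableSurface ⥤ Type where
  obj α := GoodUniformizer φ α
  map Φ := TypeCat.ofHom (F.map Φ)
  map_id α := by
    ext Ψ
    exact F.map_id α Ψ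
  map_comp Φ Φ' := by
    ext Ψ
    exact F.map_comp Φ Φ' Ψ

end StableSurface

end NodedRiemann

end

open NodedRiemann NodedRiemann.StableSurface

/-!
All the notions which enter the definition of a good uniformizer (disks, plumbing, good deformations,
the orbit space `|𝓡|`, the partial Kodaira-Spencer differential) are natural under biholomorphic
maps, and every morphism `F : α ⟶ β` is an isomorphism. Hence the choices `𝐃, V, j, O` of a good
uniformizer at `α` can be pushed forward to choices at `β`, and only two points need an argument.

*The choices determine everything else.* The glued surface carries at most one structure for which
the natural map from the kept points of `S` is locally biholomorphic: if two plumbings have choices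
which correspond under `F`, then the map `gluedMap` between them reads `Θ' ∘ F ∘ Θ⁻¹` near every
point, with local biholomorphic maps `Θ`, `Θ'`, so it is an isomorphism (`gluedHom`). For `F = 𝟙`
this is `IsPlumbing.unique`. The morphisms of a family are determined by the maps which induce them.
So the transported uniformizer is unique (`IsTransport.unique`), and uniqueness yields both that
`F ↦ F_*` respects identities and compositions and that no other functor has the same data.

*The transported family is a good uniformizer.* A structure on `S_𝔞` is carried to the glued surface
of the pushed forward choices by the bijection `gluedMap` (`exists_transport`,
`exists_isPlumbing`). For two families with corresponding choices (`FamilyRelated`), the isomorphisms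
`gluedHom` form a natural equivalence `Ψ ⇒ Ψ' ∘ F_*` (`FamilyRelated.natIso`) along an isomorphism
`F_*` of translation groupoids (`transFunctor`). Full faithfulness, the statement on orbit spaces and
properness are invariant under it, and so is the relation defining the partial Kodaira-Spencer
differential (`isPartialKodairaSpencer_push`): the defining families of diffeomorphisms are conjugated
by the components of the equivalence. As `FamilyRelated` is symmetric, one direction of each
equivalence suffices.

In the coordinates of `H¹ × 𝔹`, the map `F_*` is linear on `H¹` and multiplies each gluing
coordinate by a unit complex number (`NodeFrame.exists_hasCoord_mul`), hence it is smooth. A functor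
`f'` which is `F_*` on objects and admits an equivalence `Ψ ⇒ Ψ' ∘ f'` induced by `F` agrees with
`F_*` on morphisms by naturality, because `Ψ'` is faithful.
-/

noncomputable section

namespace NodedRiemann

/-! ### Diffeomorphisms of closed surfaces and endomorphism fields -/

section Charts

variable {X Y : Type} [ClosedSurface X] [ClosedSurface Y]

theorem mem_charts_iff {c : OpenPartialHomeomorph X Plane} :
    c ∈ SurfaceCharts.charts (X := X) ↔
      ContMDiffOn IP IP ∞ c c.source ∧ ContMDiffOn IP IP ∞ c.symm c.target := by
  rw [← IsManifold.mem_maximalAtlas_iff_contMDiffOn]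
  exact ⟨fun h => IsManifold.subset_maximalAtlas h, ClosedSurface.maximal c⟩

/-- The image of a smooth chart under a diffeomorphism. -/
theorem pushChart_mem (f : X ≃ₘ^∞⟮IP, IP⟯ Y)
    {c : OpenPartialHomeomorph X Plane} (hc : c ∈ SurfaceCharts.charts (X := X)) :
    f.symm.toHomeomorph.toOpenPartialHomeomorph.trans c ∈ SurfaceCharts.charts (X := Y) := by
  rw [mem_charts_iff] at hc ⊢
  constructor
  · refine hc.1.comp (s := _) (f.symm.contMDiff.contMDiffOn) ?_
    intro x hx
    simpa using hx
  · refine f.contMDiff.comp_contMDiffOn (hc.2.mono ?_)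
    intro x hx
    simpa using hx

theorem tangentBundle_ext {u w : TangentBundle IP X} (h : u.proj = w.proj)
    (h' : (u.snd : Plane) = w.snd) : u = w := by
  obtain ⟨x, v⟩ := u
  obtain ⟨y, v'⟩ := w
  obtain rfl : x = y := h
  obtain rfl : v = v' := h'
  rfl

theorem tangentMap_symm_tangentMap (f : X ≃ₘ^∞⟮IP, IP⟯ Y) (u : TangentBundle IP X) :
    tangentMap IP IP f.symm (tangentMap IP IP f u) = u := by
  have h := tangentMap_comp_at (I := IP) (I' := IP) (I'' := IP) (f := f) (g := f.symm) u
    (f.symm.mdifferentiable (by simp) _) (f.mdifferentiable (by simp) _)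
  rw [← h, ← Diffeomorph.coe_trans, Diffeomorph.self_trans_symm, Diffeomorph.coe_refl,
    tangentMap_id, id]

theorem mfderiv_symm_mfderiv (f : X ≃ₘ^∞⟮IP, IP⟯ Y) (x : X) (v : TangentSpace IP x) :
    (mfderiv IP IP f.symm (f x) (mfderiv IP IP f x v) : Plane) = v := by
  have h : ∀ u w : TangentBundle IP X, u = w → (u.snd : Plane) = w.snd := by
    rintro u _ rfl; rfl
  exact h _ _ (tangentMap_symm_tangentMap f ⟨x, v⟩)

theorem mfderiv_mfderiv_symm (f : X ≃ₘ^∞⟮IP, IP⟯ Y) (y : Y) (v : TangentSpace IP y) :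
    (mfderiv IP IP f (f.symm y) (mfderiv IP IP f.symm y v) : Plane) = v :=
  mfderiv_symm_mfderiv f.symm y v

theorem mfderiv_diffeo_surjective (f : X ≃ₘ^∞⟮IP, IP⟯ Y) (x : X) :
    Function.Surjective (mfderiv IP IP f x) :=
  (f.mfderivToContinuousLinearEquiv (by simp) x).surjective

/-- The values of an endomorphism field at two equal base points agree in the model space `Plane`, to
which all tangent spaces are definitionally equal. -/
theorem endField_congr (τ : EndField X) {x x' : X} (h : x = x') {v v' : Plane} (hv : v = v') :
    (τ x (show TangentSpace IP x from v) : Plane) = τ x' (show TangentSpace IP x' from v') := by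
  subst h hv; rfl

theorem mfderiv_congr_point (f : X → Y) {x x' : X} (h : x = x') {v v' : Plane} (hv : v = v') :
    (mfderiv IP IP f x (show TangentSpace IP x from v) : Plane) =
      mfderiv IP IP f x' (show TangentSpace IP x' from v') := by
  subst h hv; rfl

/-- The endomorphism fields `τ` and `σ` correspond to each other under `f`, i.e.
`Tf ∘ τ = σ ∘ Tf`. -/
def Related (f : X ≃ₘ^∞⟮IP, IP⟯ Y) (τ : EndField X) (σ : EndField Y) : Prop :=
  ∀ (x : X) (v : TangentSpace IP x), mfderiv IP IP f x (τ x v) = σ (f x) (mfderiv IP IP f x v)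

theorem Related.symm {f : X ≃ₘ^∞⟮IP, IP⟯ Y} {τ : EndField X} {σ : EndField Y}
    (h : Related f τ σ) : Related f.symm σ τ := by
  intro y v
  obtain ⟨x, rfl⟩ : ∃ x, f x = y := f.surjective y
  obtain ⟨w, rfl⟩ := mfderiv_diffeo_surjective f x v
  rw [← h x w]
  refine (mfderiv_symm_mfderiv f x _).trans ?_
  exact endField_congr τ (f.symm_apply_apply x).symm (mfderiv_symm_mfderiv f x w).symm

theorem Related.trans {Z : Type} [ClosedSurface Z] {f : X ≃ₘ^∞⟮IP, IP⟯ Y} {g : Y ≃ₘ^∞⟮IP, IP⟯ Z}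
    {τ : EndField X} {σ : EndField Y} {ρ : EndField Z}
    (h : Related f τ σ) (h' : Related g σ ρ) : Related (f.trans g) τ ρ := by
  intro x v
  have key : mfderiv IP IP (f.trans g) x = (mfderiv IP IP g (f x)).comp (mfderiv IP IP f x) := by
    rw [Diffeomorph.coe_trans]
    exact mfderiv_comp x (g.mdifferentiable (by simp) _) (f.mdifferentiable (by simp) _)
  rw [key]
  change mfderiv IP IP g (f x) (mfderiv IP IP f x (τ x v)) = _
  rw [h, h']
  rfl

/-- An endomorphism field on the target is determined by the one on the source. -/
theorem Related.unique {f : X ≃ₘ^∞⟮IP, IP⟯ Y} {τ : EndField X} {σ σ' : EndField Y}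
    (h : Related f τ σ) (h' : Related f τ σ') : σ = σ' := by
  funext y
  ext1 v
  obtain ⟨x, rfl⟩ : ∃ x, f x = y := f.surjective y
  obtain ⟨w, rfl⟩ := mfderiv_diffeo_surjective f x v
  rw [← h, ← h']

/-- The image of a smooth endomorphism field under a diffeomorphism is smooth. -/
theorem Related.smooth {f : X ≃ₘ^∞⟮IP, IP⟯ Y} {τ : EndField X} {σ : EndField Y}
    (h : Related f τ σ) (hτ : IsSmoothEnd τ) : IsSmoothEnd σ := by
  intro V hV
  have h1 : IsSmoothVF (fun x : X =>
      (show TangentSpace IP x from mfderiv IP IP f.symm (f x) (V (f x)))) := by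
    have h2 : ContMDiff IP IP.tangent ∞ (fun x : X =>
        tangentMap IP IP f.symm (⟨f x, V (f x)⟩ : TangentBundle IP Y)) :=
      (f.symm.contMDiff.contMDiff_tangentMap (by simp)).comp (hV.comp f.contMDiff)
    refine h2.congr fun x => tangentBundle_ext (f.symm_apply_apply x).symm rfl
  -- `h1`: the pull back of `V` is smooth; `σ V` is the push forward of `τ` applied to it.
  have h3 : ContMDiff IP IP.tangent ∞ (fun y : Y => tangentMap IP IP f _) :=
    (f.contMDiff.contMDiff_tangentMap (by simp)).comp ((hτ _ h1).comp f.symm.contMDiff)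
  refine h3.congr fun y => tangentBundle_ext (f.apply_symm_apply y).symm ?_
  refine Eq.trans ?_ (h (f.symm y) _).symm
  refine endField_congr σ (f.apply_symm_apply y).symm ?_
  refine (mfderiv_mfderiv_symm f y (V y)).symm.trans ?_
  refine mfderiv_congr_point f rfl ?_
  have : ∀ y' : Y, y' = y → (mfderiv IP IP f.symm y (V y) : Plane) =
      mfderiv IP IP f.symm y' (V y') := by
    rintro _ rfl; rfl
  exact this _ (f.apply_symm_apply y)

/-- The image `Tf ∘ τ ∘ Tf⁻¹` of an endomorphism field under a diffeomorphism. The factor `Tf` is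
written as the inverse of `T(f⁻¹)`, which is based at `y` rather than at `f (f⁻¹ y)`. -/
def conjEnd (f : X ≃ₘ^∞⟮IP, IP⟯ Y) (τ : EndField X) : EndField Y :=
  fun y => (mfderiv IP IP f.symm y).inverse ∘L (τ (f.symm y)) ∘L (mfderiv IP IP f.symm y)

theorem related_conjEnd (f : X ≃ₘ^∞⟮IP, IP⟯ Y) (τ : EndField X) : Related f τ (conjEnd f τ) := by
  refine Related.symm (f := f.symm) fun y v => ?_
  obtain ⟨e, he⟩ : (mfderiv IP IP f.symm y).IsInvertible :=
    ⟨f.symm.mfderivToContinuousLinearEquiv (by simp) y, rfl⟩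
  simp only [conjEnd, ContinuousLinearMap.comp_apply, ← he, ContinuousLinearMap.inverse_equiv]
  exact e.apply_symm_apply _

/-- The image of an almost complex structure under a diffeomorphism. -/
def AlmostComplex.push (f : X ≃ₘ^∞⟮IP, IP⟯ Y) (k : AlmostComplex X) : AlmostComplex Y where
  J := conjEnd f k.J
  sq y v := by
    obtain ⟨x, rfl⟩ : ∃ x, f x = y := f.surjective y
    obtain ⟨w, rfl⟩ := mfderiv_diffeo_surjective f x v
    rw [← related_conjEnd, ← related_conjEnd, k.sq, map_neg]
  smooth := (related_conjEnd f k.J).smooth k.smooth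

theorem AlmostComplex.related_push (f : X ≃ₘ^∞⟮IP, IP⟯ Y) (k : AlmostComplex X) :
    Related f k.J (k.push f).J := related_conjEnd f k.J

end Charts

/-! ### Transport of structures along bijections -/

section Transport

variable {X Y : Type}

/-- The bijection of `X` with `Y` as a homeomorphism, for the transported topology. -/
def transportHomeo [tX : TopologicalSpace X] (e : X ≃ Y) :
    letI : TopologicalSpace Y := tX.induced e.symm
    Y ≃ₜ X :=
  letI : TopologicalSpace Y := tX.induced e.symm
  e.symm.toHomeomorphOfIsInducing ⟨rfl⟩

/-- The structure of a closed surface on `Y` for which the bijection `e` is a diffeomorphism. -/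
@[reducible] def transportSurface [ClosedSurface X] (e : X ≃ Y) : ClosedSurface Y :=
  letI tY : TopologicalSpace Y := (inferInstance : TopologicalSpace X).induced e.symm
  let H : Y ≃ₜ X := transportHomeo e
  have hHH : H.symm.toOpenPartialHomeomorph.trans H.toOpenPartialHomeomorph =
      OpenPartialHomeomorph.refl X := by
    rw [← Homeomorph.trans_toOpenPartialHomeomorph, Homeomorph.symm_trans_self,
      Homeomorph.refl_toOpenPartialHomeomorph]
  have hHH' : H.toOpenPartialHomeomorph.trans H.symm.toOpenPartialHomeomorph =
      OpenPartialHomeomorph.refl Y := by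
    rw [← Homeomorph.trans_toOpenPartialHomeomorph, Homeomorph.self_trans_symm,
      Homeomorph.refl_toOpenPartialHomeomorph]
  letI sY : SurfaceCharts Y :=
    { charts := {c' | ∃ c ∈ SurfaceCharts.charts (X := X), c' = H.toOpenPartialHomeomorph.trans c}
      covers := fun y => by
        obtain ⟨c, hc, hy⟩ := SurfaceCharts.covers (H y)
        exact ⟨_, ⟨c, hc, rfl⟩, by simpa using hy⟩ }
  -- The chart transitions of `Y` are those of `X`.
  have hchart : ∀ c c' : OpenPartialHomeomorph X Plane,
      (H.toOpenPartialHomeomorph.trans c).symm.trans (H.toOpenPartialHomeomorph.trans c') =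
        c.symm.trans c' := by
    intro c c'
    rw [OpenPartialHomeomorph.trans_symm_eq_symm_trans_symm, OpenPartialHomeomorph.trans_assoc,
      ← OpenPartialHomeomorph.trans_assoc _ _ c', ← Homeomorph.symm_toOpenPartialHomeomorph, hHH,
      OpenPartialHomeomorph.refl_trans]
  have hM : IsManifold IP ∞ Y :=
    { compatible := by
        rintro _ _ ⟨c, hc, rfl⟩ ⟨c', hc', rfl⟩
        rw [hchart]
        exact StructureGroupoid.compatible _ hc hc' }
  { toTopologicalSpace := tY
    toSurfaceCharts := sY
    toT2Space := H.symm.t2Space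
    toCompactSpace := H.symm.compactSpace
    isManifold := hM
    maximal := fun c' hc' => by
      have hc'2 : c' = H.toOpenPartialHomeomorph.trans
          (H.symm.toOpenPartialHomeomorph.trans c') := by
        rw [← OpenPartialHomeomorph.trans_assoc, hHH', OpenPartialHomeomorph.refl_trans]
      refine ⟨_, ClosedSurface.maximal _ ?_, hc'2⟩
      rw [IsManifold.mem_maximalAtlas_iff, mem_maximalAtlas_iff] at hc' ⊢
      intro d hd
      have h := hc' _ (show _ ∈ SurfaceCharts.charts (X := Y) from ⟨d, hd, rfl⟩)
      rw [hc'2, hchart, hchart] at h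
      exact h }

/-- The bijection `e` as a diffeomorphism, for the transported structure. -/
def transportDiffeo [ClosedSurface X] (e : X ≃ Y) :
    letI := transportSurface e
    X ≃ₘ^∞⟮IP, IP⟯ Y :=
  letI := transportSurface e
  -- In corresponding charts, `e` is the identity.
  have hchart : ∀ c ∈ SurfaceCharts.charts (X := X), ∃ c' ∈ SurfaceCharts.charts (X := Y),
      c'.source = e.symm ⁻¹' c.source ∧ c'.target = c.target ∧ (∀ y, c' y = c (e.symm y)) ∧
        ∀ p, c'.symm p = e (c.symm p) := by
    intro c hc
    refine ⟨_, ⟨c, hc, rfl⟩, ?_, ?_, fun y => rfl, fun p => rfl⟩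
    · simp [transportHomeo]
    · simp
  { toEquiv := e
    contMDiff_toFun := by
      intro x
      obtain ⟨c, hc, hx⟩ := SurfaceCharts.covers x
      obtain ⟨c', hc', h1, h2, h3, h4⟩ := hchart c hc
      have hs := ((mem_charts_iff.1 hc').2.comp (mem_charts_iff.1 hc).1
        (fun z hz => by simpa [h2] using c.map_source hz)).contMDiffAt
          (c.open_source.mem_nhds hx)
      refine hs.congr_of_eventuallyEq ?_
      filter_upwards [c.open_source.mem_nhds hx] with z hz
      simp [h4, c.left_inv hz]
    contMDiff_invFun := by
      intro y
      obtain ⟨c, hc, hx⟩ := SurfaceCharts.covers (e.symm y)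
      obtain ⟨c', hc', h1, h2, h3, h4⟩ := hchart c hc
      have hy : y ∈ c'.source := by rw [h1]; exact hx
      have hs := ((mem_charts_iff.1 hc).2.comp (mem_charts_iff.1 hc').1
        (fun z hz => by simpa [h2] using c'.map_source hz)).contMDiffAt
          (c'.open_source.mem_nhds hy)
      refine hs.congr_of_eventuallyEq ?_
      filter_upwards [c'.open_source.mem_nhds hy] with z hz
      rw [h1] at hz
      simp [h3, c.left_inv hz] }

/-- The genus is a homeomorphism invariant, by functoriality of singular homology. -/
theorem genus_congr [TopologicalSpace X] [TopologicalSpace Y] {C : Set X} {C' : Set Y}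
    (h : C ≃ₜ C') : genus C = genus C' := by
  have i := ((AlgebraicTopology.singularHomologyFunctor (ModuleCat.{0} ℚ) 1).obj
    (ModuleCat.of ℚ ℚ)).mapIso (TopCat.isoOfHomeo (X := TopCat.of C) (Y := TopCat.of C') h)
  rw [genus, genus, i.toLinearEquiv.finrank_eq]

theorem image_connectedComponent_homeo [TopologicalSpace X] [TopologicalSpace Y] (h : X ≃ₜ Y)
    (x : X) : h '' connectedComponent x = connectedComponent (h x) := by
  have := h.image_connectedComponentIn (mem_univ x)
  simpa [connectedComponentIn_univ] using this

/-- A structure on `X` is carried to `Y` by a bijection, which becomes an isomorphism. -/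
theorem exists_transport (s : StableStructure X) (e : X ≃ Y) :
    ∃ (s' : StableStructure Y) (F : (⟨X, s⟩ : StableSurface) ⟶ ⟨Y, s'⟩),
      ∀ x, diffeo F x = e x := by
  classical
  let := s.surface
  let := transportSurface e
  let f : X ≃ₘ^∞⟮IP, IP⟯ Y := transportDiffeo e
  have hf : ∀ x, f x = e x := fun x => rfl
  have hmem : ∀ a : Sym2 Y, ∀ b : Sym2 X, a = b.map e → ∀ x, e x ∈ a → x ∈ b := by
    rintro _ b rfl x hx
    obtain ⟨z, hz, hz'⟩ := Sym2.mem_map.1 hx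
    rwa [← e.injective hz']
  let s' : StableStructure Y :=
    { surface := transportSurface e
      j := s.j.push f
      marked := s.marked.image e
      nodes := s.nodes.image (Sym2.map e)
      nodes_not_diag := by
        intro a ha
        obtain ⟨b, hb, rfl⟩ := Finset.mem_image.1 ha
        rw [Sym2.isDiag_map e.injective]
        exact s.nodes_not_diag b hb
      nodes_disjoint := by
        intro a ha a' ha' y hy hy'
        obtain ⟨b, hb, rfl⟩ := Finset.mem_image.1 ha
        obtain ⟨b', hb', rfl⟩ := Finset.mem_image.1 ha'
        obtain ⟨x, rfl⟩ := e.surjective y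
        rw [s.nodes_disjoint b hb b' hb' x (hmem _ _ rfl _ hy) (hmem _ _ rfl _ hy')]
      nodes_marked := by
        intro a ha y hy
        obtain ⟨b, hb, rfl⟩ := Finset.mem_image.1 ha
        obtain ⟨x, rfl⟩ := e.surjective y
        rw [Finset.mem_image]
        rintro ⟨x', hx', h⟩
        rw [e.injective h] at hx'
        exact s.nodes_marked b hb x (hmem _ _ rfl _ hy) hx'
      connected := by
        have := s.connected
        have hc : Continuous (Quot.map (ra := fun x y : X => s(x, y) ∈ s.nodes)
            (rb := fun x y : Y => s(x, y) ∈ s.nodes.image (Sym2.map e)) e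
            (fun x y h => Finset.mem_image.2 ⟨_, h, rfl⟩)) := by
          refine continuous_quot_lift _ (continuous_quot_mk.comp f.continuous)
        refine Function.Surjective.connectedSpace ?_ hc
        rintro ⟨y⟩
        exact ⟨Quot.mk _ (e.symm y), congrArg (Quot.mk _) (e.apply_symm_apply y)⟩
      stable := by
        intro y
        obtain ⟨x, rfl⟩ := e.surjective y
        have h1 : connectedComponent (e x) = e '' connectedComponent x :=
          (image_connectedComponent_homeo f.toHomeomorph x).symm
        have h2 : genus (connectedComponent (e x)) = genus (connectedComponent x) := by
          rw [h1]
          exact (genus_congr (f.toHomeomorph.image (connectedComponent x))).symm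
        rw [h2, h1]
        have h3 : e '' connectedComponent x ∩
            ({y | ∃ a ∈ s.nodes.image (Sym2.map e), y ∈ a} ∪ (s.marked.image e : Set Y)) =
            e '' (connectedComponent x ∩
              ({y | ∃ a ∈ s.nodes, y ∈ a} ∪ (s.marked : Set X))) := by
          rw [image_inter e.injective, image_union, ← Finset.coe_image]
          congr 2
          ext y
          obtain ⟨x, rfl⟩ := e.surjective y
          simp only [mem_ofPred_eq, Finset.mem_image, e.injective.mem_set_image]
          constructor
          · rintro ⟨_, ⟨b, hb, rfl⟩, hx⟩
            exact ⟨b, hb, hmem _ _ rfl _ hx⟩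
          · rintro ⟨b, hb, hx⟩
            exact ⟨_, ⟨b, hb, rfl⟩, Sym2.mem_map.2 ⟨x, hx, rfl⟩⟩
        rw [h3, ncard_image_of_injective _ e.injective]
        exact s.stable x }
  exact ⟨s', { toDiffeo := f
               holo := s.j.related_push f
               map_marked := by
                 change f '' (s.marked : Set X) = (s.marked.image e : Finset Y)
                 rw [Finset.coe_image]; rfl
               map_nodes := by
                 change Sym2.map f '' (s.nodes : Set (Sym2 X)) =
                   (s.nodes.image (Sym2.map e) : Finset (Sym2 Y))
                 rw [Finset.coe_image]; rfl }, hf⟩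

theorem continuous_of_contMDiff [ClosedSurface X] [ClosedSurface Y] {f : X → Y}
    (h : ContMDiff IP IP ∞ f) : Continuous f := h.continuous

/-- Two structures of a closed surface on the same set agree if the identity is smooth in both
directions. This uses that the set of charts is the full set of smooth charts. -/
theorem closedSurface_ext {S S' : ClosedSurface X}
    (h : @ContMDiff ℝ _ Plane _ _ Plane _ IP X S.toTopologicalSpace
      (@instChartedSpaceSurfaceCharts X S.toTopologicalSpace S.toSurfaceCharts) Plane _ _ Plane _ IP
      X S'.toTopologicalSpace
      (@instChartedSpaceSurfaceCharts X S'.toTopologicalSpace S'.toSurfaceCharts) ∞ id)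
    (h' : @ContMDiff ℝ _ Plane _ _ Plane _ IP X S'.toTopologicalSpace
      (@instChartedSpaceSurfaceCharts X S'.toTopologicalSpace S'.toSurfaceCharts) Plane _ _ Plane _
      IP X S.toTopologicalSpace
      (@instChartedSpaceSurfaceCharts X S.toTopologicalSpace S.toSurfaceCharts) ∞ id) :
    S = S' := by
  have h1 := @continuous_of_contMDiff X X S S' _ h
  have h1' := @continuous_of_contMDiff X X S' S _ h'
  have hc := @mem_charts_iff X S
  have hc' := @mem_charts_iff X S'
  obtain @⟨t, ⟨ch, _⟩, _, _, _, _⟩ := S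
  obtain @⟨t', ⟨ch', _⟩, _, _, _, _⟩ := S'
  obtain rfl : t = t' := le_antisymm (continuous_id_iff_le.1 h1) (continuous_id_iff_le.1 h1')
  have hch : ch = ch' := by
    ext c
    have e1 := @hc c
    have e2 := @hc' c
    refine e1.trans (Iff.trans ?_ e2.symm)
    constructor
    · rintro ⟨h2, h3⟩
      exact ⟨h2.comp h'.contMDiffOn fun x hx => hx, h.comp_contMDiffOn h3⟩
    · rintro ⟨h2, h3⟩
      exact ⟨h2.comp h.contMDiffOn fun x hx => hx, h'.comp_contMDiffOn h3⟩
  subst hch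
  rfl

theorem Related.eq_of_forall_eq [ClosedSurface X] {f : X ≃ₘ^∞⟮IP, IP⟯ X} (hf : ∀ x, f x = x)
    {τ σ : EndField X} (h : Related f τ σ) : τ = σ := by
  obtain rfl : f = Diffeomorph.refl IP X ∞ := Diffeomorph.ext hf
  funext x
  ext1 v
  have h2 := h x v
  have h3 : mfderiv IP IP (Diffeomorph.refl IP X ∞) x = ContinuousLinearMap.id ℝ _ := by
    rw [Diffeomorph.coe_refl]
    exact mfderiv_id
  rw [h3] at h2
  exact h2

theorem contMDiff_diffeo {α β : StableSurface} (F : α ⟶ β) : ContMDiff IP IP ∞ (diffeo F) :=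
  (diffeo F).contMDiff

/-- This form avoids the coercion of `(diffeo F).symm`, which cannot be elaborated for surfaces
given by an explicit structure. -/
theorem contMDiff_of_rightInverse {α β : StableSurface} (F : α ⟶ β) (g : β → α)
    (hg : ∀ y, diffeo F (g y) = y) : ContMDiff IP IP ∞ g := by
  have h : g = (diffeo F).symm := funext fun y => by
    conv_rhs => rw [← hg y]
    exact ((diffeo F).symm_apply_apply _).symm
  rw [h]
  exact (diffeo F).symm.contMDiff

theorem related_diffeo {α β : StableSurface} (F : α ⟶ β) : Related (diffeo F) α.j β.j :=
  diffeo_holo F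

theorem diffeo_image_marked {α β : StableSurface} (F : α ⟶ β) :
    diffeo F '' (α.marked : Set α) = β.marked := Hom.map_marked F

theorem diffeo_image_nodes {α β : StableSurface} (F : α ⟶ β) :
    Sym2.map (diffeo F) '' (α.nodes : Set (Sym2 α)) = β.nodes := Hom.map_nodes F

/-- Two structures on the same set agree if the identity is an isomorphism between them. -/
theorem stableStructure_ext {s s' : StableStructure X}
    (F : (⟨X, s⟩ : StableSurface) ⟶ ⟨X, s'⟩) (hF : ∀ x, diffeo F x = x) : s = s' := by
  have hid : (diffeo F : X → X) = id := funext hF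
  have hS : s.surface = s'.surface := by
    have h1 := contMDiff_diffeo F
    have h2 := contMDiff_of_rightInverse F id hF
    rw [hid] at h1
    exact closedSurface_ext h1 h2
  have hm : s.marked = s'.marked := by
    have h : (diffeo F : X → X) '' (s.marked : Set X) = s'.marked := diffeo_image_marked F
    rw [hid, image_id] at h
    exact Finset.coe_injective h
  have hn : s.nodes = s'.nodes := by
    have h : Sym2.map (diffeo F : X → X) '' (s.nodes : Set (Sym2 X)) = s'.nodes :=
      diffeo_image_nodes F
    rw [hid, Sym2.map_id, image_id] at h
    exact Finset.coe_injective h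
  have hh := related_diffeo F
  generalize diffeo F = f at hF hh
  obtain ⟨S, ⟨J, _, _⟩, m, n, _, _, _, _, _⟩ := s
  obtain ⟨S', ⟨J', _, _⟩, m', n', _, _, _, _, _⟩ := s'
  obtain rfl : S = S' := hS
  obtain rfl : m = m' := hm
  obtain rfl : n = n' := hn
  obtain rfl : J = J' := @Related.eq_of_forall_eq X S f hF J J' hh
  rfl

end Transport

end NodedRiemann

namespace NodedRiemann.StableSurface

variable {α β γ : StableSurface}

/-! ### Inverse morphisms, marked points and nodal pairs -/

/-- The inverse of a morphism: all morphisms are invertible. -/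
def invHom (F : α ⟶ β) : β ⟶ α where
  toDiffeo := (diffeo F).symm
  holo := diffeo_symm_holo F
  map_marked := by
    rw [Diffeomorph.symm_image_eq_preimage, ← diffeo_image_marked F]
    exact preimage_image_eq _ (diffeo F).injective
  map_nodes := by
    rw [← diffeo_image_nodes F, image_image]
    conv_rhs => rw [← image_id (α.nodes : Set (Sym2 α))]
    refine image_congr fun e _ => ?_
    rw [Sym2.map_map]
    have : ((diffeo F).symm ∘ (diffeo F) : α → α) = _root_.id := by
      funext x; simp
    rw [this, Sym2.map_id]

theorem invHom_diffeo (F : α ⟶ β) (x : α) : diffeo (invHom F) (diffeo F x) = x :=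
  (diffeo F).symm_apply_apply x

theorem diffeo_invHom_apply (F : α ⟶ β) (y : β) : diffeo F (diffeo (invHom F) y) = y :=
  (diffeo F).apply_symm_apply y

theorem diffeo_injective (F : α ⟶ β) : Function.Injective (diffeo F) := (diffeo F).injective

theorem exists_diffeo_eq (F : α ⟶ β) (y : β) : ∃ x, diffeo F x = y := (diffeo F).surjective y

theorem comp_invHom (F : α ⟶ β) : F ≫ invHom F = 𝟙 α := Hom.ext' fun x => invHom_diffeo F x

theorem invHom_comp (F : α ⟶ β) : invHom F ≫ F = 𝟙 β := Hom.ext' fun x => diffeo_invHom_apply F x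

theorem diffeo_comp_apply (F : α ⟶ β) (G : β ⟶ γ) (x : α) :
    diffeo (F ≫ G) x = diffeo G (diffeo F x) := rfl

/-- A morphism as an isomorphism. -/
def isoOfHom (F : α ⟶ β) : α ≅ β where
  hom := F
  inv := invHom F
  hom_inv_id := comp_invHom F
  inv_hom_id := invHom_comp F

theorem map_mem_marked_iff (F : α ⟶ β) {x : α} : diffeo F x ∈ β.marked ↔ x ∈ α.marked := by
  rw [← Finset.mem_coe, ← diffeo_image_marked F, (diffeo_injective F).mem_set_image,
    Finset.mem_coe]

theorem exists_node_map (F : α ⟶ β) (e' : β.nodes) :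
    ∃ e : α.nodes, Sym2.map (diffeo F) e.1 = e'.1 :=
  ⟨⟨_, symm_map_mem_nodes F e'.2⟩, map_map_symm F e'.1⟩

theorem mem_map_node (F : α ⟶ β) {e : Sym2 α} {x : α} :
    diffeo F x ∈ Sym2.map (diffeo F) e ↔ x ∈ e := by
  rw [Sym2.mem_map]
  constructor
  · rintro ⟨y, hy, h⟩
    rwa [← (diffeo F).injective h]
  · exact fun h => ⟨x, h, rfl⟩

theorem map_mem_nodal_iff (F : α ⟶ β) {x : α} : diffeo F x ∈ β.nodal ↔ x ∈ α.nodal := by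
  constructor
  · rintro ⟨e', he', hx⟩
    obtain ⟨e, he⟩ := exists_node_map F ⟨e', he'⟩
    refine ⟨e, e.2, ?_⟩
    rw [← mem_map_node F, he]
    exact hx
  · rintro ⟨e, he, hx⟩
    exact ⟨_, map_mem_nodes F he, (mem_map_node F).2 hx⟩

theorem map_invHom_map (F : α ⟶ β) (e : Sym2 α) :
    Sym2.map (diffeo (invHom F)) (Sym2.map (diffeo F) e) = e := by
  rw [Sym2.map_map]
  have : (diffeo (invHom F) ∘ diffeo F : α → α) = _root_.id := funext fun x => invHom_diffeo F x
  rw [this, Sym2.map_id, _root_.id]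

theorem map_eq_symm (F : α ⟶ β) {e : Sym2 α} {e' : Sym2 β} (h : Sym2.map (diffeo F) e = e') :
    Sym2.map (diffeo (invHom F)) e' = e := by
  rw [← h, map_invHom_map]

/-! ### Functoriality of parameters and tangent maps -/

/-- The component of `F_* 𝔞` at `e'`, for any `e` lying over it, not only for the representative
`F⁻¹(e')` of the definition. -/
theorem Gluing.push_apply (F : α ⟶ β) (a : Gluing α) (e : α.nodes) (e' : β.nodes)
    (h : Sym2.map (diffeo F) e.1 = e'.1) : a.push F e' = (a e).push F h := by
  have key : ∀ (e₁ : α.nodes) (h₁ : Sym2.map (diffeo F) e₁.1 = e'.1),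
      (a e₁).push F h₁ = (a e).push F h := by
    intro e₁ h₁
    obtain rfl : e₁ = e := Subtype.ext (by rw [← map_eq_symm F h₁, map_eq_symm F h])
    rfl
  exact key ⟨_, symm_map_mem_nodes F e'.2⟩ (map_map_symm F e'.1)

theorem GluingParam.modulus_push (F : α ⟶ β) {e : Sym2 α} {e' : Sym2 β}
    (h : Sym2.map (diffeo F) e = e') (b : GluingParam α e) : (b.push F h).modulus = b.modulus := by
  obtain ⟨p, rfl⟩ := Quot.exists_rep b
  rfl

theorem Gluing.push_invHom_push (F : α ⟶ β) (a : Gluing α) :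
    (a.push F).push (invHom F) = a := by
  rw [← Gluing.push_comp, comp_invHom, Gluing.push_id]

theorem Gluing.push_push_invHom (F : α ⟶ β) (a : Gluing β) :
    (a.push (invHom F)).push F = a := by
  rw [← Gluing.push_comp, invHom_comp, Gluing.push_id]

theorem Param.push_comp (F : α ⟶ β) (G : β ⟶ γ) (q : Param α) :
    q.push (F ≫ G) = (q.push F).push G :=
  Prod.ext (H1.map_comp F G q.1) (Gluing.push_comp F G q.2)

theorem Param.push_id (q : Param α) : q.push (𝟙 α) = q :=
  Prod.ext (H1.map_id α q.1) (Gluing.push_id q.2)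

theorem Param.push_invHom_push (F : α ⟶ β) (q : Param α) : (q.push F).push (invHom F) = q := by
  rw [← Param.push_comp, comp_invHom, Param.push_id]

theorem Param.push_push_invHom (F : α ⟶ β) (q : Param β) : (q.push (invHom F)).push F = q := by
  rw [← Param.push_comp, invHom_comp, Param.push_id]

theorem H1.map_invHom_map (F : α ⟶ β) (v : H1 α) : H1.map (invHom F) (H1.map F v) = v := by
  rw [← H1.map_comp, comp_invHom, H1.map_id]

theorem H1.map_map_invHom (F : α ⟶ β) (v : H1 β) : H1.map F (H1.map (invHom F) v) = v := by
  rw [← H1.map_comp, invHom_comp, H1.map_id]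

theorem tangentPush_comp (F : α ⟶ β) (G : β ⟶ γ) (u : TangentBundle IP α) :
    tangentPush (F ≫ G) u = tangentPush G (tangentPush F u) :=
  congrArg (fun v => (⟨diffeo G (diffeo F u.proj), v⟩ : TangentBundle IP γ))
      (mfderiv_diffeo_comp (diffeo F) (diffeo G) u.proj u.snd)

theorem tangentPush_id (u : TangentBundle IP α) : tangentPush (𝟙 α) u = u :=
  congrArg (fun v => (⟨u.proj, v⟩ : TangentBundle IP α)) (mfderiv_diffeo_refl u.proj u.snd)

theorem tangentPush_invHom_tangentPush (F : α ⟶ β) (u : TangentBundle IP α) :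
    tangentPush (invHom F) (tangentPush F u) = u := by
  rw [← tangentPush_comp, comp_invHom, tangentPush_id]

/-! ### Small disk structures -/

/-- The small disk structures `𝒟` and `𝒟'` correspond to each other under `F`:
`D'_{F(x)} = F(D_x)`. -/
def SmallDisks.Related (F : α ⟶ β) (𝒟 : SmallDisks α) (𝒟' : SmallDisks β) : Prop :=
  ∀ x, 𝒟'.disk (diffeo F x) = diffeo F '' 𝒟.disk x

theorem SmallDisks.Related.symm {F : α ⟶ β} {𝒟 : SmallDisks α} {𝒟' : SmallDisks β}
    (h : 𝒟.Related F 𝒟') : 𝒟'.Related (invHom F) 𝒟 := by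
  intro y
  obtain ⟨x, rfl⟩ : _ := exists_diffeo_eq F y
  rw [invHom_diffeo, h]
  exact ((diffeo F).symm_image_image _).symm

theorem SmallDisks.Related.mem_iff {F : α ⟶ β} {𝒟 : SmallDisks α} {𝒟' : SmallDisks β}
    (h : 𝒟.Related F 𝒟') {x z : α} : diffeo F z ∈ 𝒟'.disk (diffeo F x) ↔ z ∈ 𝒟.disk x := by
  rw [h, (diffeo_injective F).mem_set_image]

theorem SmallDisks.Related.unique {F : α ⟶ β} {𝒟 : SmallDisks α} {𝒟' 𝒟'' : SmallDisks β}
    (h : 𝒟.Related F 𝒟') (h' : 𝒟.Related F 𝒟'') : 𝒟' = 𝒟'' := by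
  apply SmallDisks.ext
  funext y
  obtain ⟨x, rfl⟩ : _ := exists_diffeo_eq F y
  rw [h, h']

/-- The image of a small disk structure under a morphism. -/
def SmallDisks.push (F : α ⟶ β) (𝒟 : SmallDisks α) : SmallDisks β where
  disk y := diffeo F '' 𝒟.disk (diffeo (invHom F) y)
  disk_of_notMem y hy := by
    rw [𝒟.disk_of_notMem, image_empty]
    rwa [map_mem_nodal_iff]
  isDisk y hy := by
    obtain ⟨c, hc, h1, h2, h3⟩ := 𝒟.isDisk _ ((map_mem_nodal_iff (invHom F)).2 hy)
    refine ⟨_, pushChart_mem (diffeo F) hc, by simpa using h1, ?_, ?_⟩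
    · rw [h2, image_image]; rfl
    · obtain ⟨p, hp, h⟩ := h3
      refine ⟨p, hp, ?_⟩
      rw [← diffeo_invHom_apply F y, ← h]
      rfl
  disjoint x hx y hy hxy := by
    refine (disjoint_image_iff (diffeo F).injective).2 (𝒟.disjoint _ ?_ _ ?_ ?_)
    · rwa [map_mem_nodal_iff]
    · rwa [map_mem_nodal_iff]
    · exact fun h => hxy ((diffeo (invHom F)).injective h)
  invariant g := by
    have h1 : ⋃ x ∈ β.nodal, diffeo F '' 𝒟.disk (diffeo (invHom F) x) =
        diffeo F '' ⋃ x ∈ α.nodal, 𝒟.disk x := by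
      rw [image_iUnion₂]
      ext z
      simp only [mem_iUnion]
      constructor
      · rintro ⟨y, hy, hz⟩
        exact ⟨_, (map_mem_nodal_iff (invHom F)).2 hy, hz⟩
      · rintro ⟨x, hx, hz⟩
        refine ⟨diffeo F x, (map_mem_nodal_iff F).2 hx, ?_⟩
        rwa [invHom_diffeo]
    have h2 := 𝒟.invariant ((isoOfHom F).conjAut.symm g)
    rw [h1]
    conv_rhs => rw [← h2]
    rw [image_image, image_image]
    refine image_congr fun x _ => ?_
    have h3 : diffeo (((isoOfHom F).conjAut.symm g).hom ≫ F) x = diffeo (F ≫ g.hom) x := by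
      congr 2
      change (F ≫ g.hom ≫ invHom F) ≫ F = F ≫ g.hom
      rw [Category.assoc, Category.assoc, invHom_comp, Category.comp_id]
    exact h3.symm
  marked y hy z hz := by
    obtain ⟨x, hx, rfl⟩ := hz
    rw [map_mem_marked_iff]
    exact 𝒟.marked _ ((map_mem_nodal_iff (invHom F)).2 hy) _ hx

theorem SmallDisks.related_push (F : α ⟶ β) (𝒟 : SmallDisks α) : 𝒟.Related F (𝒟.push F) := by
  intro x
  change diffeo F '' 𝒟.disk (diffeo (invHom F) (diffeo F x)) = _
  rw [invHom_diffeo]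

/-- The chain rule needs no differentiability of `h`: if `h` is not differentiable at `x` then
`h ∘ F⁻¹` is not differentiable at `F x`, and both derivatives are zero by convention. -/
theorem derivC_comp_symm (F : α ⟶ β) (h : α → ℂ) (x : α) (v : TangentSpace IP x) :
    derivC (h ∘ diffeo (invHom F)) (diffeo F x) (mfderiv IP IP (diffeo F) x v) = derivC h x v := by
  have hc : h = (h ∘ diffeo (invHom F)) ∘ diffeo F := by
    funext x
    change h x = h (diffeo (invHom F) (diffeo F x))
    rw [invHom_diffeo]
  have hF : MDifferentiableAt IP IP (diffeo F) x := (diffeo F).mdifferentiable (by simp) x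
  have key : ∀ g : β → ℂ, derivC g (diffeo F x) (mfderiv IP IP (diffeo F) x v) =
      derivC (g ∘ diffeo F) x v := by
    intro g
    by_cases hg : MDifferentiableAt IP 𝓘(ℝ, ℂ) g (diffeo F x)
    · have h1 := mfderiv_comp x hg hF
      exact (congrArg (fun L => NormedSpace.fromTangentSpace (g (diffeo F x)) (L v)) h1).symm
    · have hg' : ¬ MDifferentiableAt IP 𝓘(ℝ, ℂ) (g ∘ diffeo F) x := fun h' => hg <| by
        have h2 : g = (g ∘ diffeo F) ∘ diffeo (invHom F) := by
          funext y
          change g y = g (diffeo F (diffeo (invHom F) y))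
          rw [diffeo_invHom_apply]
        rw [h2]
        refine MDifferentiableAt.comp _ ?_ ((diffeo (invHom F)).mdifferentiable (by simp) _)
        rwa [invHom_diffeo]
      simp only [derivC, mfderiv_zero_of_not_mdifferentiableAt hg,
        mfderiv_zero_of_not_mdifferentiableAt hg']
      exact (map_zero _).trans (map_zero _).symm
  rw [key, ← hc]

/-- If `h` is the holomorphic coordinate on `D_x` adapted to `u`, then `h ∘ F⁻¹` is the one on
`F(D_x)` adapted to `TF u`. -/
theorem SmallDisks.Related.isCoord {F : α ⟶ β} {𝒟 : SmallDisks α} {𝒟' : SmallDisks β}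
    (hD : 𝒟.Related F 𝒟') {u : TangentBundle IP α} {h : α → ℂ} (H : 𝒟.IsCoord u h) :
    𝒟'.IsCoord (tangentPush F u) (h ∘ diffeo (invHom F)) := by
  have h1 : 𝒟'.disk (tangentPush F u).proj = diffeo (invHom F) ⁻¹' 𝒟.disk u.proj :=
    (hD u.proj).trans ((diffeo F).image_eq_preimage_symm _)
  have h2 : interior (𝒟'.disk (tangentPush F u).proj) =
      diffeo (invHom F) ⁻¹' interior (𝒟.disk u.proj) := by
    rw [h1]
    exact ((diffeo (invHom F)).toHomeomorph.preimage_interior _).symm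
  refine ⟨?_, ?_, ?_, ?_, ?_, ?_⟩
  · rw [show 𝒟'.disk (tangentPush F u).proj = diffeo F '' 𝒟.disk u.proj from hD u.proj]
    refine (bijOn_comp_iff ((diffeo_injective F).injOn) (g := h ∘ diffeo (invHom F))).1 ?_
    refine H.bijOn.congr fun x _ => ?_
    change h x = h (diffeo (invHom F) (diffeo F x))
    rw [invHom_diffeo]
  · rw [h1]
    exact H.continuousOn.comp (diffeo (invHom F)).continuous.continuousOn fun x hx => hx
  · rw [h2]
    exact H.smooth.comp (diffeo (invHom F)).contMDiff.contMDiffOn fun x hx => hx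
  · intro y hy w
    rw [h2] at hy
    obtain ⟨x, rfl⟩ : _ := exists_diffeo_eq F y
    obtain ⟨v, rfl⟩ := mfderiv_diffeo_surjective (diffeo F) x w
    rw [← diffeo_holo, derivC_comp_symm, derivC_comp_symm]
    refine H.holo x ?_ v
    rwa [mem_preimage, invHom_diffeo] at hy
  · change h (diffeo (invHom F) (diffeo F u.proj)) = 0
    rw [invHom_diffeo, H.center]
  · obtain ⟨t, ht, h3⟩ := H.line
    exact ⟨t, ht, (derivC_comp_symm F h u.proj u.snd).trans h3⟩

/-! ### Naturality of the plumbing construction -/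

variable {φ : GluingProfile}

theorem discarded_push {F : α ⟶ β} {𝒟 : SmallDisks α} {𝒟' : SmallDisks β} (hD : 𝒟.Related F 𝒟')
    {a : Gluing α} {z : α} (h : Discarded φ 𝒟 a z) :
    Discarded φ 𝒟' (a.push F) (diffeo F z) := by
  obtain ⟨e, p, h, h1, h2, h3, h4, h5⟩ := h
  refine ⟨⟨_, map_mem_nodes F e.2⟩, p.push F rfl, _, ?_, h2, hD.isCoord h3, hD.mem_iff.2 h4, ?_⟩
  · rw [Gluing.push_apply F a e _ rfl, h1]
    rfl
  · change ‖h (diffeo (invHom F) (diffeo F z))‖ < _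
    rw [invHom_diffeo]
    exact h5

theorem identified_push {F : α ⟶ β} {𝒟 : SmallDisks α} {𝒟' : SmallDisks β} (hD : 𝒟.Related F 𝒟')
    {a : Gluing α} {z z' : α} (h : Identified φ 𝒟 a z z') :
    Identified φ 𝒟' (a.push F) (diffeo F z) (diffeo F z') := by
  obtain ⟨e, p, h, h', h1, h2, h3, h3', h4, h4', h5⟩ := h
  refine ⟨⟨_, map_mem_nodes F e.2⟩, p.push F rfl, _, _, ?_, h2, hD.isCoord h3, hD.isCoord h3',
    hD.mem_iff.2 h4, hD.mem_iff.2 h4', ?_⟩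
  · rw [Gluing.push_apply F a e _ rfl, h1]
    rfl
  · change h (diffeo (invHom F) (diffeo F z)) * h' (diffeo (invHom F) (diffeo F z')) = _
    rw [invHom_diffeo, invHom_diffeo]
    exact h5

/-- The choices defining two plumbings correspond to each other under `F`. -/
structure PlumbingRelated (F : α ⟶ β) (𝒟 : SmallDisks α) (𝒟' : SmallDisks β) (a : Gluing α)
    (a' : Gluing β) : Prop where
  disks : 𝒟.Related F 𝒟'
  gluing : a' = a.push F

section

variable {F : α ⟶ β} {𝒟 : SmallDisks α} {𝒟' : SmallDisks β} {a : Gluing α} {a' : Gluing β}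

theorem PlumbingRelated.symm (h : PlumbingRelated F 𝒟 𝒟' a a') :
    PlumbingRelated (invHom F) 𝒟' 𝒟 a' a :=
  ⟨h.disks.symm, by rw [h.gluing, Gluing.push_invHom_push]⟩

/-- The push forward of discarded points is discarded; the converse is the same statement for
`F⁻¹`. -/
theorem PlumbingRelated.mem_kept_iff (h : PlumbingRelated F 𝒟 𝒟' a a') {z : α} :
    diffeo F z ∈ kept φ 𝒟' a' ↔ z ∈ kept φ 𝒟 a := by
  refine not_congr ⟨fun h1 => ?_, fun h1 => ?_⟩
  · have h2 := discarded_push h.symm.disks h1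
    rwa [← h.symm.gluing, invHom_diffeo] at h2
  · rw [h.gluing]
    exact discarded_push h.disks h1

theorem PlumbingRelated.mem_interior_kept_iff (h : PlumbingRelated F 𝒟 𝒟' a a') {z : α} :
    diffeo F z ∈ interior (kept φ 𝒟' a') ↔ z ∈ interior (kept φ 𝒟 a) := by
  have h1 : kept φ 𝒟 a = (diffeo F).toHomeomorph ⁻¹' kept φ 𝒟' a' := by
    ext z
    exact h.mem_kept_iff.symm
  rw [h1, ← Homeomorph.preimage_interior]
  rfl

/-- The map `S_𝔞 → S'_𝔞'` between glued surfaces induced by `F`. -/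
def gluedMap (h : PlumbingRelated F 𝒟 𝒟' a a') : Glued φ 𝒟 a → Glued φ 𝒟' a' :=
  Quot.map (fun z => ⟨diffeo F z.1, h.mem_kept_iff.2 z.2⟩) fun _ _ hz => by
    have := identified_push h.disks hz
    rwa [← h.gluing] at this

theorem gluedMap_mk (h : PlumbingRelated F 𝒟 𝒟' a a') (z : α) (hz : z ∈ kept φ 𝒟 a) :
    gluedMap h (Glued.mk z hz) = Glued.mk (diffeo F z) (h.mem_kept_iff.2 hz) := rfl

theorem Glued.exists_mk (x : Glued φ 𝒟 a) : ∃ z, ∃ hz, Glued.mk z hz = x := by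
  obtain ⟨⟨z, hz⟩, rfl⟩ := Quot.exists_rep x
  exact ⟨z, hz, rfl⟩

theorem glued_mk_congr {𝒟 : SmallDisks α} {a : Gluing α} {z z' : α} {hz : z ∈ kept φ 𝒟 a}
    {hz' : z' ∈ kept φ 𝒟 a} (h : z = z') : (Glued.mk z hz : Glued φ 𝒟 a) = Glued.mk z' hz' := by
  subst h; rfl

theorem gluedMap_symm_gluedMap (h : PlumbingRelated F 𝒟 𝒟' a a') (x : Glued φ 𝒟 a) :
    gluedMap h.symm (gluedMap h x) = x := by
  obtain ⟨z, hz, rfl⟩ := x.exists_mk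
  rw [gluedMap_mk, gluedMap_mk]
  exact glued_mk_congr (invHom_diffeo F z)

theorem gluedMap_gluedMap_symm (h : PlumbingRelated F 𝒟 𝒟' a a') (x : Glued φ 𝒟' a') :
    gluedMap h (gluedMap h.symm x) = x := by
  obtain ⟨z, hz, rfl⟩ := x.exists_mk
  rw [gluedMap_mk, gluedMap_mk]
  exact glued_mk_congr (diffeo_invHom_apply F z)

/-- The bijection between glued surfaces induced by `F`. -/
def gluedEquiv (h : PlumbingRelated F 𝒟 𝒟' a a') : Glued φ 𝒟 a ≃ Glued φ 𝒟' a' where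
  toFun := gluedMap h
  invFun := gluedMap h.symm
  left_inv := gluedMap_symm_gluedMap h
  right_inv := gluedMap_gluedMap_symm h

theorem inducedBy_gluedMap (h : PlumbingRelated F 𝒟 𝒟' a a') :
    InducedBy (φ := φ) (𝒟 := 𝒟) (𝒟' := 𝒟') (a := a) (a' := a') (diffeo F) (gluedMap h) :=
  fun _ hz => ⟨h.mem_kept_iff.2 hz, rfl⟩

theorem InducedBy.unique {f : α → β} {E E' : Glued φ 𝒟 a → Glued φ 𝒟' a'}
    (h : InducedBy f E) (h' : InducedBy f E') : E = E' := by
  funext x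
  obtain ⟨z, hz, rfl⟩ := x.exists_mk
  obtain ⟨h1, h2⟩ := h z hz
  obtain ⟨h3, h4⟩ := h' z hz
  rw [h2, h4]

theorem gluedMap_image_marked (h : PlumbingRelated F 𝒟 𝒟' a a') :
    gluedMap (φ := φ) h '' {p | ∃ x ∈ α.marked, ∃ h, p = Glued.mk x h} =
      {p | ∃ x ∈ β.marked, ∃ h, p = Glued.mk x h} := by
  ext p
  constructor
  · rintro ⟨_, ⟨x, hx, hk, rfl⟩, rfl⟩
    exact ⟨diffeo F x, (map_mem_marked_iff F).2 hx, h.mem_kept_iff.2 hk, rfl⟩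
  · rintro ⟨y, hy, hk, rfl⟩
    obtain ⟨x, rfl⟩ := exists_diffeo_eq F y
    exact ⟨_, ⟨x, (map_mem_marked_iff F).1 hy, h.mem_kept_iff.1 hk, rfl⟩, rfl⟩

theorem PlumbingRelated.modulus_eq (h : PlumbingRelated F 𝒟 𝒟' a a') (e : α.nodes) (e' : β.nodes)
    (he : Sym2.map (diffeo F) e.1 = e'.1) : (a' e').modulus = (a e).modulus := by
  rw [h.gluing, Gluing.push_apply F a e e' he, GluingParam.modulus_push]

theorem gluedMap_image_nodes (h : PlumbingRelated F 𝒟 𝒟' a a') :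
    Sym2.map (gluedMap (φ := φ) h) ''
      {e' | ∃ (e : α.nodes) (x y : α) (hx : x ∈ kept φ 𝒟 a) (hy : y ∈ kept φ 𝒟 a),
        e.1 = s(x, y) ∧ (a e).modulus = 0 ∧ e' = s(Glued.mk x hx, Glued.mk y hy)} =
      {e' | ∃ (e : β.nodes) (x y : β) (hx : x ∈ kept φ 𝒟' a') (hy : y ∈ kept φ 𝒟' a'),
        e.1 = s(x, y) ∧ (a' e).modulus = 0 ∧ e' = s(Glued.mk x hx, Glued.mk y hy)} := by
  ext p
  constructor
  · rintro ⟨_, ⟨e, x, y, hx, hy, he, hm, rfl⟩, rfl⟩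
    refine ⟨⟨_, map_mem_nodes F e.2⟩, diffeo F x, diffeo F y, h.mem_kept_iff.2 hx,
      h.mem_kept_iff.2 hy, ?_, ?_, rfl⟩
    · change Sym2.map (diffeo F) e.1 = _
      rw [he]; rfl
    · rw [h.modulus_eq e _ rfl, hm]
  · rintro ⟨e', x', y', hx, hy, he, hm, rfl⟩
    obtain ⟨x, rfl⟩ := exists_diffeo_eq F x'
    obtain ⟨y, rfl⟩ := exists_diffeo_eq F y'
    obtain ⟨e, he'⟩ := exists_node_map F e'
    refine ⟨_, ⟨e, x, y, h.mem_kept_iff.1 hx, h.mem_kept_iff.1 hy, ?_, ?_, rfl⟩, rfl⟩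
    · rw [← map_eq_symm F he', he, Sym2.map_mk]
      rw [invHom_diffeo, invHom_diffeo]
    · rw [← h.modulus_eq e e' he', hm]

variable {k : AlmostComplex α} {k' : AlmostComplex β} {s : StableStructure (Glued φ 𝒟 a)}
  {s' : StableStructure (Glued φ 𝒟' a')}

/-- Near every point of the glued surfaces, `gluedMap` is `Θ' ∘ F ∘ Θ⁻¹` for local biholomorphic
maps `Θ` and `Θ'`. -/
theorem exists_local_gluedMap (h : PlumbingRelated F 𝒟 𝒟' a a') (hs : IsPlumbing φ 𝒟 k a s)
    (hs' : IsPlumbing φ 𝒟' k' a' s') (x : gluedSurface s) :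
    ∃ (z : α) (Θ : α → gluedSurface s) (Θ' : β → gluedSurface s'), Θ z = x ∧
      IsLocalDiffeomorphAt IP IP ∞ Θ z ∧ IsLocalDiffeomorphAt IP IP ∞ Θ' (diffeo F z) ∧
      (∀ᶠ z' in 𝓝 z, (gluedMap h (Θ z') : gluedSurface s') = Θ' (diffeo F z')) ∧
      (∀ v : TangentSpace IP z, mfderiv IP IP Θ z (k.J z v) =
        (gluedSurface s).j (Θ z) (mfderiv IP IP Θ z v)) ∧
      ∀ v : TangentSpace IP (diffeo F z), mfderiv IP IP Θ' (diffeo F z) (k'.J (diffeo F z) v) =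
        (gluedSurface s').j (Θ' (diffeo F z)) (mfderiv IP IP Θ' (diffeo F z) v) := by
  obtain ⟨z, hz, hx⟩ := hs.covers x
  obtain ⟨Θ, h1, h2⟩ := hs.local_biholo z hz
  obtain ⟨Θ', h1', h2'⟩ := hs'.local_biholo (diffeo F z) (h.mem_interior_kept_iff.2 hz)
  obtain ⟨⟨h3, h4⟩, h5⟩ := h2.self_of_nhds
  refine ⟨z, Θ, Θ', h4.trans hx.symm, h1, h1', ?_, h5, (h2'.self_of_nhds).2⟩
  filter_upwards [h2, (diffeo F).continuous.continuousAt.eventually h2'] with z' hz' hz''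
  obtain ⟨⟨h6, h7⟩, -⟩ := hz'
  obtain ⟨⟨h8, h9⟩, -⟩ := hz''
  rw [h7, h9]
  rfl

/-- `gluedMap` as a map between noded Riemann surfaces, on whose types the smooth structures are
found. -/
def gluedSurfaceMap (h : PlumbingRelated F 𝒟 𝒟' a a') (s : StableStructure (Glued φ 𝒟 a))
    (s' : StableStructure (Glued φ 𝒟' a')) : gluedSurface s → gluedSurface s' :=
  gluedMap h

theorem contMDiff_gluedMap (h : PlumbingRelated F 𝒟 𝒟' a a') (hs : IsPlumbing φ 𝒟 k a s)
    (hs' : IsPlumbing φ 𝒟' k' a' s') :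
    ContMDiff IP IP ∞ (gluedSurfaceMap h s s') := by
  intro x
  obtain ⟨z, Θ, Θ', rfl, h1, h2, h3, -⟩ := exists_local_gluedMap h hs hs' x
  have h4 : h1.localInverse (Θ z) = z := h1.localInverse_left_inv h1.localInverse_mem_target
  have h5 : ContMDiffAt IP IP ∞ (Θ' ∘ diffeo F ∘ h1.localInverse) (Θ z) := by
    refine ContMDiffAt.comp _ (I' := IP) ?_ 
      (ContMDiffAt.comp _ (I' := IP) ?_ h1.localInverse_contMDiffAt)
    · simp only [Function.comp, h4]
      exact h2.contMDiffAt
    · exact (diffeo F).contMDiff _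
  refine h5.congr_of_eventuallyEq ?_
  have h6 : Tendsto h1.localInverse (𝓝 (Θ z)) (𝓝 z) := by
    have := h1.localInverse_contMDiffAt.continuousAt
    rwa [ContinuousAt, h4] at this
  filter_upwards [h6.eventually h3, h1.localInverse_eventuallyEq_right] with y hy hy'
  have h7 : Θ (h1.localInverse y) = y := hy'
  rw [h7] at hy
  exact hy

/-- The isomorphism of glued surfaces induced by an isomorphism between the data of two
plumbings. -/
def gluedHom (h : PlumbingRelated F 𝒟 𝒟' a a') (hs : IsPlumbing φ 𝒟 k a s)
    (hs' : IsPlumbing φ 𝒟' k' a' s') (hk : Related (diffeo F) k.J k'.J) :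
    gluedSurface s ⟶ gluedSurface s' :=
  let f : (gluedSurface s) ≃ₘ^∞⟮IP, IP⟯ (gluedSurface s') :=
    { toEquiv := gluedEquiv h
      contMDiff_toFun := contMDiff_gluedMap h hs hs'
      contMDiff_invFun := contMDiff_gluedMap h.symm hs' hs }
  Hom.mk f
    (by
      intro x
      obtain ⟨z, Θ, Θ', rfl, h1, h2, h3, h4, h5⟩ := exists_local_gluedMap h hs hs' x
      have hf : MDifferentiableAt IP IP f (Θ z) := f.mdifferentiable (by simp) _
      have hΘ := h1.mdifferentiableAt (by simp)
      have e1 : f ∘ Θ =ᶠ[𝓝 z] Θ' ∘ diffeo F := h3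
      have e2 : (mfderiv IP IP f (Θ z)).comp (mfderiv IP IP Θ z) =
          (mfderiv IP IP Θ' (diffeo F z)).comp (mfderiv IP IP (diffeo F) z) := by
        have e3 := e1.mfderiv_eq (I := IP) (I' := IP)
        rw [mfderiv_comp z hf hΘ, mfderiv_comp z (h2.mdifferentiableAt (by simp))
          ((diffeo F).mdifferentiable (by simp) z)] at e3
        exact e3
      have e3 : ∀ v : TangentSpace IP z, mfderiv IP IP f (Θ z) (mfderiv IP IP Θ z v) =
          mfderiv IP IP Θ' (diffeo F z) (mfderiv IP IP (diffeo F) z v) :=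
        fun v => congrArg (fun L => L v) e2
      intro w
      obtain ⟨v, rfl⟩ : ∃ v, mfderiv IP IP Θ z v = w :=
        (h1.mfderivToContinuousLinearEquiv (by simp)).surjective w
      rw [← h4, e3, e3, hk, h5]
      exact endField_congr _ e1.self_of_nhds.symm rfl)
    (by
      change gluedMap h '' (s.marked : Set (Glued φ 𝒟 a)) = (s'.marked : Set (Glued φ 𝒟' a'))
      rw [hs.marked, hs'.marked, gluedMap_image_marked])
    (by
      change Sym2.map (gluedMap h) '' (s.nodes : Set (Sym2 (Glued φ 𝒟 a))) =
        (s'.nodes : Set (Sym2 (Glued φ 𝒟' a')))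
      rw [hs.nodes, hs'.nodes, gluedMap_image_nodes])

/-- If the glued surface for `𝒟`, `k`, `𝔞` exists then so does the one for the push forward of these
choices: its structure is transported along `gluedMap`. -/
theorem exists_isPlumbing (h : PlumbingRelated F 𝒟 𝒟' a a') (hs : IsPlumbing φ 𝒟 k a s)
    (hk : Related (diffeo F) k.J k'.J) :
    ∃ s' : StableStructure (Glued φ 𝒟' a'), IsPlumbing φ 𝒟' k' a' s' := by
  obtain ⟨s', G, hG⟩ := exists_transport s (gluedEquiv h)
  let G' : gluedSurface s ⟶ gluedSurface s' := G
  have hG' : ∀ x : Glued φ 𝒟 a, diffeo G' x = gluedMap h x := hG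
  refine ⟨s', ⟨?_, ?_, ?_, ?_⟩⟩
  · intro z' hz'
    obtain ⟨z, rfl⟩ := exists_diffeo_eq F z'
    obtain ⟨Θ, h1, h2⟩ := hs.local_biholo z (h.mem_interior_kept_iff.1 hz')
    have hloc : ∀ᶠ z' in 𝓝 z, IsLocalDiffeomorphAt IP IP ∞ Θ z' := by
      obtain ⟨Ψ, hΨ, hΨ'⟩ := h1
      filter_upwards [Ψ.open_source.mem_nhds hΨ] with z' hz'
      exact ⟨Ψ, hz', hΨ'⟩
    have hcomp : ∀ z' : β, IsLocalDiffeomorphAt IP IP ∞ Θ (diffeo (invHom F) z') →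
        IsLocalDiffeomorphAt IP IP ∞ (diffeo G' ∘ Θ ∘ diffeo (invHom F)) z' := fun z' hz' =>
      IsLocalDiffeomorphAt.comp (K := IP)
        (hf := IsLocalDiffeomorphAt.comp (K := IP)
          (hf := (diffeo (invHom F)).isLocalDiffeomorph z') (hg := hz'))
        (hg := (diffeo G').isLocalDiffeomorph _)
    have hlim : Tendsto (diffeo (invHom F)) (𝓝 (diffeo F z)) (𝓝 z) := by
      have := (diffeo (invHom F)).continuous.tendsto (diffeo F z)
      rwa [invHom_diffeo] at this
    refine ⟨diffeo G' ∘ Θ ∘ diffeo (invHom F), hcomp _ ?_, ?_⟩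
    · rwa [invHom_diffeo]
    · filter_upwards [hlim.eventually hloc, hlim.eventually h2] with y hy hy'
      obtain ⟨z', rfl⟩ := exists_diffeo_eq F y
      have hd := (hcomp _ hy).mdifferentiableAt (by simp)
      rw [invHom_diffeo] at hy hy'
      obtain ⟨⟨h3, h4⟩, h5⟩ := hy'
      refine ⟨⟨h.mem_kept_iff.2 h3, ?_⟩, fun w => ?_⟩
      · change diffeo G' (Θ (diffeo (invHom F) (diffeo F z'))) = _
        rw [invHom_diffeo, h4]
        exact hG' _
      · obtain ⟨v, rfl⟩ := mfderiv_diffeo_surjective (diffeo F) z' w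
        -- Write `Θ'` for the new local map: `TΘ' ∘ TF = TG' ∘ TΘ`, and `TF`, `TΘ`, `TG'` are complex
        -- linear.
        have e1 : (diffeo G' ∘ Θ ∘ diffeo (invHom F)) ∘ diffeo F = diffeo G' ∘ Θ := by
          funext x
          change diffeo G' (Θ (diffeo (invHom F) (diffeo F x))) = _
          rw [invHom_diffeo]; rfl
        have e2 := mfderiv_comp z' (I := IP) (I' := IP) (I'' := IP) hd
          ((diffeo F).mdifferentiable (by simp) z')
        rw [e1, mfderiv_comp z' (I' := IP) ((diffeo G').mdifferentiable (by simp) _)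
          (hy.mdifferentiableAt (by simp))] at e2
        have e3 : ∀ v : TangentSpace IP z', mfderiv IP IP (diffeo G') (Θ z')
            (mfderiv IP IP Θ z' v) = mfderiv IP IP (diffeo G' ∘ Θ ∘ diffeo (invHom F)) (diffeo F z')
              (mfderiv IP IP (diffeo F) z' v) := fun v => congrArg (fun L => L v) e2
        rw [← hk, ← e3, ← e3, h5, diffeo_holo]
        refine endField_congr _ (congrArg (fun x => diffeo G' (Θ x)) ?_) rfl
        exact (invHom_diffeo F z').symm
  · intro x'
    obtain ⟨x, rfl⟩ := (gluedEquiv h).surjective x'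
    obtain ⟨z, hz, rfl⟩ := hs.covers x
    exact ⟨diffeo F z, h.mem_interior_kept_iff.2 hz, rfl⟩
  · have h1 : gluedMap h '' (s.marked : Set (Glued φ 𝒟 a)) =
        (s'.marked : Set (Glued φ 𝒟' a')) := by
      rw [← show (diffeo G' : Glued φ 𝒟 a → Glued φ 𝒟' a') = gluedMap h from funext hG']
      exact diffeo_image_marked G'
    rw [← h1, hs.marked, gluedMap_image_marked]
  · have h1 : Sym2.map (gluedMap h) '' (s.nodes : Set (Sym2 (Glued φ 𝒟 a))) =
        (s'.nodes : Set (Sym2 (Glued φ 𝒟' a'))) := by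
      rw [← show (diffeo G' : Glued φ 𝒟 a → Glued φ 𝒟' a') = gluedMap h from funext hG']
      exact diffeo_image_nodes G'
    rw [← h1, hs.nodes, gluedMap_image_nodes]

/-- There is at most one plumbing for given data. -/
theorem IsPlumbing.unique {s s' : StableStructure (Glued φ 𝒟 a)} (hs : IsPlumbing φ 𝒟 k a s)
    (hs' : IsPlumbing φ 𝒟 k a s') : s = s' := by
  have h : PlumbingRelated (𝟙 α) 𝒟 𝒟 a a :=
    ⟨fun x => (image_id _).symm, (Gluing.push_id a).symm⟩
  refine stableStructure_ext (gluedHom h hs hs' (fun x v => ?_)) fun x => ?_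
  · exact (mfderiv_diffeo_refl x _).trans
      (congrArg (k.J x) (mfderiv_diffeo_refl x v)).symm
  · obtain ⟨z, hz, rfl⟩ := x.exists_mk
    rfl

end

/-! ### Push forward of parameters and the topology -/

/-- The image `(TF x̂, TF ŷ)` of a pair of oriented lines under a morphism. -/
def NodeFrame.push (F : α ⟶ β) {e : Sym2 α} {e' : Sym2 β} (h : Sym2.map (diffeo F) e = e')
    (p : NodeFrame α e) : NodeFrame β e' where
  u := tangentPush F p.u
  w := tangentPush F p.w
  u_ne := tangentPush_ne_zero F p.u_ne
  w_ne := tangentPush_ne_zero F p.w_ne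
  above := (congrArg (Sym2.map (diffeo F)) p.above).trans h

theorem NodeFrame.param_push (F : α ⟶ β) {e : Sym2 α} {e' : Sym2 β}
    (h : Sym2.map (diffeo F) e = e') (p : NodeFrame α e) (z : {z : ℂ // ‖z‖ < 1 / 2}) :
    (p.push F h).param z = (p.param z).push F h := by
  refine congrArg (Quot.mk _) ?_
  simp only [GluingRep.push, tangentPush_rotate]
  rfl

theorem NodeFrame.HasCoord.push (F : α ⟶ β) {e : Sym2 α} {e' : Sym2 β}
    (h : Sym2.map (diffeo F) e = e') {p : NodeFrame α e} {b : GluingParam α e} {z : ℂ}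
    (hz : p.HasCoord b z) : (p.push F h).HasCoord (b.push F h) z := by
  obtain ⟨h1, rfl⟩ := hz
  exact ⟨h1, p.param_push F h _⟩

theorem NodeFrame.push_invHom_push (F : α ⟶ β) {e : Sym2 α} {e' : Sym2 β}
    (h : Sym2.map (diffeo F) e = e') (h' : Sym2.map (diffeo (invHom F)) e' = e)
    (p : NodeFrame α e) : (p.push F h).push (invHom F) h' = p := by
  obtain ⟨u, w, _, _, _⟩ := p
  simp only [NodeFrame.push, tangentPush_invHom_tangentPush]

theorem NodeFrame.continuous_param {e : Sym2 α} (p : NodeFrame α e) : Continuous p.param :=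
  continuous_iSup_rng (i := p) continuous_coinduced_rng

theorem GluingParam.continuous_push (F : α ⟶ β) {e : Sym2 α} {e' : Sym2 β}
    (h : Sym2.map (diffeo F) e = e') : Continuous (GluingParam.push F h) := by
  refine continuous_iSup_dom.2 fun p => continuous_coinduced_dom.2 ?_
  refine (p.push F h).continuous_param.congr fun z => p.param_push F h z

theorem Gluing.continuous_push (F : α ⟶ β) : Continuous (Gluing.push F) :=
  continuous_pi fun _ => (GluingParam.continuous_push F _).comp (continuous_apply _)

theorem H1.continuous_map (F : α ⟶ β) : Continuous (H1.map F) := by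
  have : IsModuleTopology ℂ (H1 α) := ⟨rfl⟩
  have : IsModuleTopology ℂ (H1 β) := ⟨rfl⟩
  have : ContinuousAdd (H1 β) := IsModuleTopology.toContinuousAdd ℂ _
  have : ContinuousSMul ℂ (H1 β) := IsModuleTopology.toContinuousSMul ℂ _
  exact IsModuleTopology.continuous_of_linearMap _

theorem Param.continuous_push (F : α ⟶ β) : Continuous (Param.push F) :=
  ((H1.continuous_map F).comp continuous_fst).prodMk
    ((Gluing.continuous_push F).comp continuous_snd)

/-- The isomorphism `H¹(F)` of an isomorphism `F`. -/
def H1.equiv (F : α ⟶ β) : H1 α ≃ₗ[ℂ] H1 β :=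
  { H1.map F with
    invFun := H1.map (invHom F)
    left_inv := H1.map_invHom_map F
    right_inv := H1.map_map_invHom F }

/-! ### Translation groupoids -/

theorem isoOfHom_hom (F : α ≅ β) : isoOfHom F.hom = F := Iso.ext rfl

/-- `F_*` is equivariant along the isomorphism `g ↦ F g F⁻¹` of automorphism groups. -/
theorem conjAut_smul_push (F : α ⟶ β) (g : Aut α) (q : Param α) :
    (isoOfHom F).conjAut g • q.push F = (g • q).push F := by
  change (q.push F).push (invHom F ≫ g.hom ≫ F) = (q.push g.hom).push F
  rw [← Param.push_comp, ← Param.push_comp, ← Category.assoc, comp_invHom, Category.id_comp]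

/-- The functor `F_*` between translation groupoids, `q ↦ F_* q` and `(g, q) ↦ (F g F⁻¹, F_* q)`. -/
def transFunctor (F : α ⟶ β) {O : Set (Param α)} {O' : Set (Param β)}
    (hO : ∀ q, q.push F ∈ O' ↔ q ∈ O) : TranslationGroupoid O ⥤ TranslationGroupoid O' where
  obj q := ⟨q.1.push F, (hO q.1).2 q.2⟩
  map g := ⟨(isoOfHom F).conjAut g.1, by rw [conjAut_smul_push, g.2]⟩
  map_id _ := Subtype.ext (map_one _)
  map_comp g h := Subtype.ext (map_mul (isoOfHom F).conjAut h.1 g.1)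

theorem param_iff_symm {F : α ⟶ β} {O : Set (Param α)} {O' : Set (Param β)}
    (hO : ∀ q, q.push F ∈ O' ↔ q ∈ O) (q : Param β) : q.push (invHom F) ∈ O ↔ q ∈ O' := by
  rw [← hO, Param.push_push_invHom]

/-- The homeomorphism underlying `transFunctor`. -/
def transHomeo (F : α ⟶ β) {O : Set (Param α)} {O' : Set (Param β)}
    (hO : ∀ q, q.push F ∈ O' ↔ q ∈ O) : TranslationGroupoid O ≃ₜ TranslationGroupoid O' where
  toFun := (transFunctor F hO).obj
  invFun := (transFunctor (invHom F) (param_iff_symm hO)).obj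
  left_inv q := Subtype.ext (Param.push_invHom_push F q.1)
  right_inv q := Subtype.ext (Param.push_push_invHom F q.1)
  continuous_toFun :=
    Continuous.subtype_mk ((Param.continuous_push F).comp continuous_subtype_val) _
  continuous_invFun :=
    Continuous.subtype_mk ((Param.continuous_push (invHom F)).comp continuous_subtype_val) _

theorem transFunctor_isEquivalence (F : α ⟶ β) {O : Set (Param α)} {O' : Set (Param β)}
    (hO : ∀ q, q.push F ∈ O' ↔ q ∈ O) : (transFunctor F hO).IsEquivalence where
  faithful := ⟨fun h => Subtype.ext ((isoOfHom F).conjAut.injective (congrArg Subtype.val h))⟩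
  full := ⟨fun {q q'} g => by
    obtain ⟨g, hg⟩ := g
    obtain ⟨g, rfl⟩ := (isoOfHom F).conjAut.surjective g
    refine ⟨⟨g, ?_⟩, rfl⟩
    have h1 : (isoOfHom F).conjAut g • q.1.push F = q'.1.push F := hg
    rw [conjAut_smul_push] at h1
    have h2 := congrArg (Param.push (invHom F)) h1
    rwa [Param.push_invHom_push, Param.push_invHom_push] at h2⟩
  essSurj := ⟨fun q => by
    obtain ⟨q, rfl⟩ := (transHomeo F hO).surjective q
    exact ⟨q, ⟨Iso.refl _⟩⟩⟩

/-! ### Good deformations -/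

/-- A morphism of `α` to `β` is also a morphism for deformed almost complex structures `k` and `k'`
which correspond to each other. -/
def withJHom (F : α ⟶ β) {k : AlmostComplex α} {k' : AlmostComplex β}
    (h : Related (diffeo F) k.J k'.J) : α.withJ k ⟶ β.withJ k' :=
  let f : α ≃ₘ^∞⟮IP, IP⟯ β := diffeo F
  Hom.mk (α := α.withJ k) (β := β.withJ k') f h (diffeo_image_marked F) (diffeo_image_nodes F)

theorem hasDerivAt_clm_comp (L : Plane →L[ℝ] Plane) {f : ℝ → Plane} {f' : Plane} {t : ℝ}
    (h : HasDerivAt f f' t) : HasDerivAt (fun t => L (f t)) (L f') t :=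
  L.hasFDerivAt.comp_hasDerivAt t h

theorem related_pushOmega (F : α ⟶ β) (τ : omega01 α) :
    Related (diffeo F) τ.1 (pushOmega F τ).1 :=
  related_conjEnd (diffeo F) τ.1

theorem almostComplex_ext_related {F : α ⟶ β} {k : AlmostComplex α} {k' k'' : AlmostComplex β}
    (h : Related (diffeo F) k.J k'.J) (h' : Related (diffeo F) k.J k''.J) : k' = k'' :=
  AlmostComplex.ext (h.unique h')

/-- The push forward `F_* v ↦ TF ∘ j(v) ∘ TF⁻¹` of a good deformation is a good deformation. -/
theorem IsGoodDeformation.push (F : α ⟶ β) {𝒟 : SmallDisks α} {V : Set (H1 α)}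
    {j : H1 α → AlmostComplex α} (h : IsGoodDeformation 𝒟 V j) :
    IsGoodDeformation (𝒟.push F) (H1.map (invHom F) ⁻¹' V)
      (fun v => (j (H1.map (invHom F) v)).push (diffeo F)) where
  isOpen := h.isOpen.preimage (H1.continuous_map _)
  zero_mem := by
    rw [mem_preimage, map_zero]
    exact h.zero_mem
  invariant g v hv := by
    have h1 := h.invariant ((isoOfHom F).conjAut.symm g) _ hv
    have h2 : H1.map (F ≫ g.hom ≫ invHom F) (H1.map (invHom F) v) ∈ V := h1
    rw [H1.map_comp, H1.map_comp, H1.map_map_invHom] at h2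
    exact h2
  outside v hv := by
    refine almostComplex_ext_related (F := F) (AlmostComplex.related_push _ _) ?_
    rw [h.outside _ hv]
    exact related_diffeo F
  smooth := by
    obtain ⟨n, e, he⟩ := h.smooth
    refine ⟨n, e.trans (H1.equiv F), fun Y hY => ?_⟩
    obtain ⟨Z, hZ, hYZ⟩ := exists_pushVF (diffeo F) hY
    have h1 : ContMDiff (𝓘(ℝ, Fin n → ℂ).prod IP) (𝓘(ℝ, Fin n → ℂ).prod IP) ∞
        (fun p : (Fin n → ℂ) × β => (p.1, diffeo (invHom F) p.2)) :=
      contMDiff_fst.prodMk ((diffeo (invHom F)).contMDiff.comp contMDiff_snd)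
    have h2 := ((diffeo F).contMDiff.contMDiff_tangentMap (by simp)).comp_contMDiffOn
      ((he Z hZ).comp h1.contMDiffOn (s := (e.trans (H1.equiv F) ⁻¹' (H1.map (invHom F) ⁻¹' V)) ×ˢ
        univ) fun p hp => ?_)
    · refine h2.congr fun p hp => ?_
      refine tangentBundle_ext (diffeo_invHom_apply F p.2).symm ?_
      obtain ⟨v, y⟩ := p
      obtain ⟨x, rfl⟩ := exists_diffeo_eq F y
      have h3 : H1.map (invHom F) (e.trans (H1.equiv F) v) = e v := H1.map_invHom_map F (e v)
      have h4 : mfderiv IP IP (diffeo F) x (Z x) = Y (diffeo F x) := by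
        apply mfderiv_symm_injective (diffeo F)
        rw [hYZ, mfderiv_symm_pushVF]
        refine (mfderiv_symm_mfderiv (diffeo F) x (Z x)).trans ?_
        have : ∀ x' : α, x = x' → (Z x : Plane) = Z x' := by rintro _ rfl; rfl
        exact this _ (invHom_diffeo F x).symm
      have h5 := AlmostComplex.related_push (diffeo F)
        (j (H1.map (invHom F) (e.trans (H1.equiv F) v))) x (Z x)
      rw [h4] at h5
      refine h5.symm.trans ?_
      rw [h3]
      have : ∀ x' : α, x = x' → (mfderiv IP IP (diffeo F) x ((j (e v)).J x (Z x)) : Plane) =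
        mfderiv IP IP (diffeo F) x' ((j (e v)).J x' (Z x')) := by rintro _ rfl; rfl
      exact this _ (invHom_diffeo F x).symm
    · refine ⟨?_, trivial⟩
      have h3 : H1.map (invHom F) (e.trans (H1.equiv F) p.1) = e p.1 := H1.map_invHom_map F (e p.1)
      have h4 := hp.1
      rw [mem_preimage, mem_preimage, h3] at h4
      exact h4
  at_zero := by
    refine almostComplex_ext_related (F := F) (AlmostComplex.related_push _ _) ?_
    rw [map_zero, h.at_zero]
    exact related_diffeo F
  on_disks v hv y z hz := by
    obtain ⟨x, hx, rfl⟩ := hz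
    ext1 w
    obtain ⟨w, rfl⟩ := mfderiv_diffeo_surjective (diffeo F) x w
    rw [← AlmostComplex.related_push, h.on_disks _ hv _ x hx, diffeo_holo]
  kodairaSpencer v hv := by
    obtain ⟨L, hL⟩ := h.kodairaSpencer _ hv
    let F' := withJHom F (AlmostComplex.related_push (diffeo F) (j (H1.map (invHom F) v)))
    -- The Kodaira-Spencer differential is conjugated by `F`.
    refine ⟨((H1.equiv F).symm.trans L).trans (H1.equiv F'), fun δv => ?_⟩
    obtain ⟨τ, h1, h2⟩ := hL (H1.map (invHom F) δv)
    refine ⟨pushOmega F' τ, ?_, fun y w => ?_⟩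
    · rw [← H1.map_mk, h1]; rfl
    · obtain ⟨x, rfl⟩ := exists_diffeo_eq F y
      obtain ⟨w, rfl⟩ := mfderiv_diffeo_surjective (diffeo F) x w
      have h3 := hasDerivAt_clm_comp (mfderiv IP IP (diffeo F) x) (h2 x w)
      have h4 := related_pushOmega F' τ x w
      rw [show ((pushOmega F' τ).1 (diffeo F x) (mfderiv IP IP (diffeo F) x w) : Plane) = _ from
        h4.symm]
      refine h3.congr_deriv rfl |>.congr_of_eventuallyEq (Eventually.of_forall fun t => ?_)
      refine (AlmostComplex.related_push (diffeo F) _ x w).symm.trans ?_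
      rw [map_add, map_smul]
      rfl
  equivariant g v hv y w := by
    obtain ⟨x, rfl⟩ := exists_diffeo_eq F y
    obtain ⟨w, rfl⟩ := mfderiv_diffeo_surjective (diffeo F) x w
    have h1 : Related (diffeo (F ≫ g.hom ≫ invHom F)) (j (H1.map (invHom F) v)).J
      (j (H1.map (F ≫ g.hom ≫ invHom F) (H1.map (invHom F) v))).J :=
        h.equivariant ((isoOfHom F).conjAut.symm g) _ hv
    rw [H1.map_comp, H1.map_comp, H1.map_map_invHom] at h1
    have h2 := (AlmostComplex.related_push (diffeo F) (j (H1.map (invHom F) v))).symm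
    have h3 := h1.trans (AlmostComplex.related_push (diffeo F) _)
    have h4 := h2.trans h3
    have h5 : (diffeo F).symm.trans ((diffeo (F ≫ g.hom ≫ invHom F)).trans (diffeo F)) =
        diffeo g.hom := by
      ext y
      change diffeo F (diffeo (invHom F) (diffeo g.hom (diffeo F (diffeo (invHom F) y)))) = _
      rw [diffeo_invHom_apply, diffeo_invHom_apply]
    rw [h5] at h4
    exact h4 _ _

/-! ### Corresponding plumbing families -/

/-- The choices which define the families `Ψ` and `Ψ'` correspond to each other under `F`. -/
structure FamilyRelated (F : α ⟶ β) (Ψ : PlumbingFamily φ α) (Ψ' : PlumbingFamily φ β) :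
    Prop where
  disks : Ψ.disks.Related F Ψ'.disks
  V : ∀ v, H1.map F v ∈ Ψ'.V ↔ v ∈ Ψ.V
  j : ∀ v ∈ Ψ.V, Related (diffeo F) (Ψ.j v).J (Ψ'.j (H1.map F v)).J
  O : ∀ q, q.push F ∈ Ψ'.O ↔ q ∈ Ψ.O

section

variable {F : α ⟶ β} {Ψ : PlumbingFamily φ α} {Ψ' : PlumbingFamily φ β}

theorem FamilyRelated.symm (h : FamilyRelated F Ψ Ψ') : FamilyRelated (invHom F) Ψ' Ψ where
  disks := h.disks.symm
  V v := by rw [← h.V, H1.map_map_invHom]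
  j v hv := by
    have h1 := h.j (H1.map (invHom F) v) (by rwa [← h.V, H1.map_map_invHom])
    rw [H1.map_map_invHom] at h1
    exact h1.symm
  O := param_iff_symm h.O

theorem FamilyRelated.plumbingRelated (h : FamilyRelated F Ψ Ψ') {q : TranslationGroupoid Ψ.O}
    {q' : TranslationGroupoid Ψ'.O} (hq : q'.1 = q.1.push F) :
    PlumbingRelated F Ψ.disks Ψ'.disks q.1.2 q'.1.2 :=
  ⟨h.disks, congrArg Prod.snd hq⟩

/-- The isomorphism `α_q ⟶ β_{F_* q}` induced by `F`. -/
def FamilyRelated.hom (h : FamilyRelated F Ψ Ψ') {q : TranslationGroupoid Ψ.O}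
    {q' : TranslationGroupoid Ψ'.O} (hq : q'.1 = q.1.push F) :
    Ψ.functor.obj q ⟶ Ψ'.functor.obj q' :=
  gluedHom (h.plumbingRelated hq) (Ψ.isPlumbing q) (Ψ'.isPlumbing q') (by
    have h1 : q'.1.1 = H1.map F q.1.1 := congrArg Prod.fst hq
    rw [h1]
    exact h.j _ (Ψ.subset _ q.2))

theorem FamilyRelated.hom_mk (h : FamilyRelated F Ψ Ψ') {q : TranslationGroupoid Ψ.O}
    {q' : TranslationGroupoid Ψ'.O} (hq : q'.1 = q.1.push F) (z : α)
    (hz : z ∈ kept φ Ψ.disks q.1.2) :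
    diffeo (h.hom hq) (Glued.mk z hz : Glued φ Ψ.disks q.1.2) =
      (Glued.mk (diffeo F z) ((h.plumbingRelated hq).mem_kept_iff.2 hz) :
        Glued φ Ψ'.disks q'.1.2) := rfl

theorem FamilyRelated.hom_symm_comp_hom (h : FamilyRelated F Ψ Ψ') {q : TranslationGroupoid Ψ.O}
    {q' : TranslationGroupoid Ψ'.O} (hq : q'.1 = q.1.push F) (hq' : q.1 = q'.1.push (invHom F)) :
    h.symm.hom hq' ≫ h.hom hq = 𝟙 _ :=
  Hom.ext' fun x => gluedMap_gluedMap_symm (h.plumbingRelated hq) x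

/-- The natural equivalence `Ψ ⇒ Ψ' ∘ F_*` whose components are induced by `F`. -/
def FamilyRelated.natIso (h : FamilyRelated F Ψ Ψ') :
    Ψ.functor ≅ transFunctor F h.O ⋙ Ψ'.functor :=
  NatIso.ofComponents (fun q => isoOfHom (h.hom (q' := (transFunctor F h.O).obj q) rfl))
    (by
      intro q q' g
      refine Hom.ext' fun x => ?_
      obtain ⟨z, hz, rfl⟩ := Glued.exists_mk x
      obtain ⟨h1, h2⟩ := Ψ.mor_induced g z hz
      obtain ⟨h3, h4⟩ := Ψ'.mor_induced ((transFunctor F h.O).map g) (diffeo F z)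
        ((h.plumbingRelated (q' := (transFunctor F h.O).obj q) rfl).mem_kept_iff.2 hz)
      change diffeo (h.hom (q' := (transFunctor F h.O).obj q') rfl) (diffeo (Ψ.mor g) _) =
        diffeo (Ψ'.mor ((transFunctor F h.O).map g)) (Glued.mk (diffeo F z) _ : Glued φ _ _)
      rw [h2, h4]
      refine (h.hom_mk (q' := (transFunctor F h.O).obj q') rfl _ h1).trans (glued_mk_congr ?_)
      change _ = diffeo F (diffeo g.1.hom (diffeo (invHom F) (diffeo F z)))
      rw [invHom_diffeo])

/-- The homeomorphism of orbit spaces induced by `F`. -/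
def orbitHomeo (F : α ⟶ β) {O : Set (Param α)} {O' : Set (Param β)}
    (hO : ∀ q, q.push F ∈ O' ↔ q ∈ O) :
    OrbitSpace (TranslationGroupoid O) ≃ₜ OrbitSpace (TranslationGroupoid O') where
  toFun := OrbitSpace.map (transFunctor F hO)
  invFun := OrbitSpace.map (transFunctor (invHom F) (param_iff_symm hO))
  left_inv x := by
    obtain ⟨q, rfl⟩ := Quot.exists_rep x
    exact congrArg (Quot.mk _) ((transHomeo F hO).left_inv q)
  right_inv x := by
    obtain ⟨q, rfl⟩ := Quot.exists_rep x
    exact congrArg (Quot.mk _) ((transHomeo F hO).right_inv q)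
  continuous_toFun := continuous_quot_lift _ (continuous_quot_mk.comp (transHomeo F hO).continuous)
  continuous_invFun :=
    continuous_quot_lift _ (continuous_quot_mk.comp (transHomeo F hO).symm.continuous)

theorem FamilyRelated.orbitMap_mk (h : FamilyRelated F Ψ Ψ') (q : TranslationGroupoid Ψ.O) :
    Ψ'.orbitMap (OrbitSpace.mk ((transFunctor F h.O).obj q)) = Ψ.orbitMap (OrbitSpace.mk q) :=
  (Quot.sound ⟨h.natIso.app q⟩).symm

theorem FamilyRelated.orbitMap_comp (h : FamilyRelated F Ψ Ψ') :
    Ψ'.orbitMap ∘ orbitHomeo F h.O = Ψ.orbitMap := by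
  funext x
  obtain ⟨q, rfl⟩ := Quot.exists_rep x
  exact h.orbitMap_mk q

/-! ### The partial Kodaira-Spencer differential -/

/-- The pull back of `σ` by `f`, written with the derivatives of `f` and of its inverse at `f s`. -/
theorem conjEnd_symm_apply {X Y : Type} [ClosedSurface X] [ClosedSurface Y]
    (f : X ≃ₘ^∞⟮IP, IP⟯ Y) (σ : EndField Y) (s : X) (w : TangentSpace IP s) :
    (mfderiv IP IP f.symm (f s) (σ (f s) (mfderiv IP IP f s w)) : Plane) =
      conjEnd f.symm σ s w :=
  (related_conjEnd f.symm σ (f s) (mfderiv IP IP f s w)).trans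
    (endField_congr _ (f.symm_apply_apply s) (mfderiv_symm_mfderiv f s w))

/-- The relation defining the partial Kodaira-Spencer differential is preserved by `F`. A curve `c(t)`
in `O` is moved to `F_* c(t)`, and the diffeomorphisms `Θ_t : α_q → α_{c(t)}` are conjugated by the
isomorphisms `α_q → β_{F_* q}` and `α_{c(t)} → β_{F_* c(t)}`. -/
theorem isPartialKodairaSpencer_push (h : FamilyRelated F Ψ Ψ') {q : TranslationGroupoid Ψ.O}
    {q' : TranslationGroupoid Ψ'.O} (hq : q'.1 = q.1.push F)
    {p : ∀ e : α.nodes, NodeFrame α e.1} {p' : ∀ e : β.nodes, NodeFrame β e.1}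
    (hp : ∀ (e : α.nodes) (e' : β.nodes) (he : Sym2.map (diffeo F) e.1 = e'.1),
      p' e' = (p e).push F he)
    {z : α.nodes → ℂ} {z' : β.nodes → ℂ}
    (hz : ∀ (e : α.nodes) (e' : β.nodes), Sym2.map (diffeo F) e.1 = e'.1 → z' e' = z e)
    {δv : H1 α} {δ : {e : α.nodes // z e ≠ 0} → ℂ} {δ' : {e : β.nodes // z' e ≠ 0} → ℂ}
    (hδ : ∀ e e', Sym2.map (diffeo F) e.1.1 = e'.1.1 → δ' e' = δ e)
    {ξ : H1 (Ψ.functor.obj q)} (H : Ψ.IsPartialKodairaSpencer q p z δv δ ξ) :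
    Ψ'.IsPartialKodairaSpencer q' p' z' (H1.map F δv) δ' (H1.map (h.hom hq) ξ) := by
  obtain ⟨ε, c, Θ, τ, hε, h1, h2, h3, h4, h5, h6⟩ := H
  let c' : ℝ → TranslationGroupoid Ψ'.O := fun t => (transFunctor F h.O).obj (c t)
  let E := h.hom hq
  let Ec : ∀ t, Ψ.functor.obj (c t) ⟶ Ψ'.functor.obj (c' t) := fun t => h.hom rfl
  let Θ' : ∀ t, (Ψ'.functor.obj q') ≃ₘ^∞⟮IP, IP⟯ (Ψ'.functor.obj (c' t)) := fun t =>
    (diffeo (invHom E)).trans ((Θ t).trans (diffeo (Ec t)))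
  have hΘ' : ∀ t s, Θ' t (diffeo E s) = diffeo (Ec t) (Θ t s) := fun t s => by
    change diffeo (Ec t) (Θ t (diffeo (invHom E) (diffeo E s))) = _
    rw [invHom_diffeo]
  have hE : ∀ (z : α) (hz : z ∈ kept φ Ψ.disks q.1.2),
      diffeo E (Glued.mk z hz : Glued φ Ψ.disks q.1.2) =
      (Glued.mk (diffeo F z) ((h.plumbingRelated hq).mem_kept_iff.2 hz) :
        Glued φ Ψ'.disks q'.1.2) := fun z hz => rfl
  have hEc : ∀ t (z : α) (hz : z ∈ kept φ Ψ.disks (c t).1.2),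
      diffeo (Ec t) (Glued.mk z hz : Glued φ Ψ.disks (c t).1.2) =
      (Glued.mk (diffeo F z) ((h.plumbingRelated (q' := c' t) rfl).mem_kept_iff.2 hz) :
        Glued φ Ψ'.disks (c' t).1.2) := fun t z hz => rfl
  refine ⟨ε, c', Θ', pushOmega E τ, hε, ?_, ?_, ?_, ?_, ?_, ?_⟩
  · intro t ht
    obtain ⟨h7, h8⟩ := h1 t ht
    refine ⟨?_, fun e' => ?_⟩
    · change H1.map F (c t).1.1 = _
      rw [h7, map_add, map_smul, show q'.1.1 = H1.map F q.1.1 from congrArg Prod.fst hq]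
    · obtain ⟨e, he⟩ := exists_node_map F e'
      have h9 := (h8 e).push F he
      rw [← hp] at h9
      rw [show (c' t).1.2 e' = ((c t).1.2 e).push F he from Gluing.push_apply F _ e e' he]
      convert h9 using 1
      have hze := hz e e' he
      by_cases hz0 : z e = 0
      · rw [dif_neg (by simpa [hze] using hz0), dif_neg (by simpa using hz0)]
      · have hz0' : z' e' ≠ 0 := by rwa [hze]
        rw [dif_pos hz0', dif_pos hz0, hze, hδ ⟨e, hz0⟩ ⟨e', hz0'⟩ he]
  · intro y hy
    obtain ⟨x, rfl⟩ := exists_diffeo_eq F y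
    have hx := (h.plumbingRelated hq).mem_kept_iff.1 hy
    obtain ⟨h7, h8⟩ := h2 x hx
    refine ⟨(h.plumbingRelated (q' := c' 0) rfl).mem_kept_iff.2 h7, ?_⟩
    refine (hΘ' 0 (Glued.mk x hx)).trans ?_
    exact (congrArg (diffeo (Ec 0)) h8).trans (hEc 0 _ _)
  · intro t ht y hy
    obtain ⟨x, rfl⟩ := exists_diffeo_eq F y
    obtain ⟨h7, h8, h9⟩ := h3 t ht x (by
      refine hy.imp (map_mem_marked_iff F).1 ?_
      rintro ⟨e', h7, h8⟩
      obtain ⟨e, he⟩ := exists_node_map F e'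
      refine ⟨e, ?_, ?_⟩
      · rw [← mem_map_node F, he]; exact h7
      · rw [← (h.plumbingRelated hq).modulus_eq e e' he]; exact h8)
    refine ⟨(h.plumbingRelated hq).mem_kept_iff.2 h7,
      (h.plumbingRelated (q' := c' t) rfl).mem_kept_iff.2 h8, ?_⟩
    refine (hΘ' t (Glued.mk x h7)).trans ?_
    exact (congrArg (diffeo (Ec t)) h9).trans (hEc t _ _)
  · intro s'
    obtain ⟨s, rfl⟩ := exists_diffeo_eq E s'
    obtain ⟨η, W, hW, hη, hηW⟩ := h4 s
    have hm : ContMDiff (𝓘(ℝ, ℝ).prod IP) (𝓘(ℝ, ℝ).prod IP) ∞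
        (fun y : ℝ × Ψ'.functor.obj q' => (y.1, diffeo (invHom E) y.2)) :=
      contMDiff_fst.prodMk ((diffeo (invHom E)).contMDiff.comp contMDiff_snd)
    refine ⟨fun y => diffeo F (η (y.1, diffeo (invHom E) y.2)),
      (fun y : ℝ × Ψ'.functor.obj q' => (y.1, diffeo (invHom E) y.2)) ⁻¹' W, ?_, ?_, ?_⟩
    · refine hm.continuous.continuousAt ?_
      change W ∈ 𝓝 ((0, diffeo (invHom E) (diffeo E s)) : ℝ × Ψ.functor.obj q)
      rwa [invHom_diffeo]
    · exact (diffeo F).contMDiff.comp_contMDiffOn (hη.comp hm.contMDiffOn fun y hy => hy)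
    · rintro ⟨t, y⟩ hy
      obtain ⟨x, rfl⟩ := exists_diffeo_eq E y
      obtain ⟨h7, h8⟩ := hηW _ hy
      refine ⟨(h.plumbingRelated (q' := c' t) rfl).mem_interior_kept_iff.2 h7, ?_⟩
      exact (congrArg (diffeo (Ec t)) h8).trans (hEc t _ _)
  · intro s' w'
    obtain ⟨s, rfl⟩ := exists_diffeo_eq E s'
    obtain ⟨w, rfl⟩ := mfderiv_diffeo_surjective (diffeo E) s w'
    have h7 := hasDerivAt_clm_comp (mfderiv IP IP (diffeo E) s) (h5 s w)
    rw [show ((pushOmega E τ).1 (diffeo E s) (mfderiv IP IP (diffeo E) s w) : Plane) = _ from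
      (related_pushOmega E τ s w).symm]
    refine h7.congr_of_eventuallyEq (Eventually.of_forall fun t => ?_)
    -- The pull backs by `Θ_t` and `Θ'_t` of the complex structures correspond to each other under `E`.
    have h8 : Related (diffeo E) (conjEnd (Θ t).symm (Ψ.functor.obj (c t)).j)
        (conjEnd (Θ' t).symm (Ψ'.functor.obj (c' t)).j) := by
      have h9 := ((related_conjEnd (Θ t).symm (Ψ.functor.obj (c t)).j).symm.trans
        (related_diffeo (Ec t))).trans (related_conjEnd (Θ' t).symm (Ψ'.functor.obj (c' t)).j)
      have h10 : (((Θ t).symm.symm.trans (diffeo (Ec t))).trans (Θ' t).symm) = diffeo E := by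
        refine Diffeomorph.ext fun x => ?_
        change (Θ' t).symm (diffeo (Ec t) (Θ t x)) = _
        rw [← hΘ', Diffeomorph.symm_apply_apply]
      rwa [h10] at h9
    refine (conjEnd_symm_apply (Θ' t) (Ψ'.functor.obj (c' t)).j (diffeo E s) _).trans ?_
    refine (h8 s w).symm.trans ?_
    exact congrArg (mfderiv IP IP (diffeo E) s)
      (conjEnd_symm_apply (Θ t) (Ψ.functor.obj (c t)).j s w).symm
  · rw [← H1.map_mk, h6]

end

/-! ### Transport of good uniformizers -/

/-- The functor `F⁻¹_*` from the translation groupoid of the image `F_* O`, written as a preimage, to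
that of `O`. -/
def pullFunctor (F : α ⟶ β) (O : Set (Param α)) :
    TranslationGroupoid (Param.push (invHom F) ⁻¹' O) ⥤ TranslationGroupoid O :=
  transFunctor (invHom F) fun _ => Iff.rfl

theorem plumbingRelated_pullFunctor (F : α ⟶ β) (Ψ : PlumbingFamily φ α)
    (q : TranslationGroupoid (Param.push (invHom F) ⁻¹' Ψ.O)) :
    PlumbingRelated F Ψ.disks (Ψ.disks.push F) ((pullFunctor F Ψ.O).obj q).1.2 q.1.2 :=
  ⟨Ψ.disks.related_push F, (Gluing.push_push_invHom F q.1.2).symm⟩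

theorem exists_push_str (F : α ⟶ β) (Ψ : PlumbingFamily φ α)
    (q : TranslationGroupoid (Param.push (invHom F) ⁻¹' Ψ.O)) :
    ∃ s : StableStructure (Glued φ (Ψ.disks.push F) q.1.2),
      IsPlumbing φ (Ψ.disks.push F) ((Ψ.j (H1.map (invHom F) q.1.1)).push (diffeo F)) q.1.2 s :=
  exists_isPlumbing (plumbingRelated_pullFunctor F Ψ q)
    (Ψ.isPlumbing ((pullFunctor F Ψ.O).obj q)) (AlmostComplex.related_push _ _)

/-- The image of a plumbing family under an isomorphism. The images of `V` and `O` are written as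
preimages under `F⁻¹`, and the structures on the glued surfaces are chosen: they are unique. -/
def PlumbingFamily.push (F : α ⟶ β) (Ψ : PlumbingFamily φ α) : PlumbingFamily φ β where
  disks := Ψ.disks.push F
  V := H1.map (invHom F) ⁻¹' Ψ.V
  j v := (Ψ.j (H1.map (invHom F) v)).push (diffeo F)
  good := Ψ.good.push F
  O := Param.push (invHom F) ⁻¹' Ψ.O
  subset q hq := Ψ.subset _ hq
  isOpen := Ψ.isOpen.preimage (Param.continuous_push _)
  zero_mem a ha := by
    have h1 := Ψ.zero_mem (a.push (invHom F)) fun e =>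
      (GluingParam.modulus_push (invHom F) _ _).trans (ha _)
    have h2 : Param.push (invHom F) ((0, a) : H1 β × Gluing β) =
        ((0, a.push (invHom F)) : H1 α × Gluing α) := Prod.ext (map_zero _) rfl
    have h3 : Param.push (invHom F) ((0, a) : H1 β × Gluing β) ∈ Ψ.O :=
      Set.mem_of_eq_of_mem h2 h1
    exact h3
  invariant g q hq := by
    have h1 := Ψ.invariant ((isoOfHom F).conjAut.symm g) _ hq
    have h2 := conjAut_smul_push (invHom F) g q
    rw [mem_preimage, ← h2]
    exact h1
  str q := (exists_push_str F Ψ q).choose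
  isPlumbing q := (exists_push_str F Ψ q).choose_spec
  mor {q q'} g :=
    invHom (gluedHom (plumbingRelated_pullFunctor F Ψ q) (Ψ.isPlumbing ((pullFunctor F Ψ.O).obj q))
      (exists_push_str F Ψ q).choose_spec (AlmostComplex.related_push _ _)) ≫
    Ψ.mor ((pullFunctor F Ψ.O).map g) ≫
    gluedHom (plumbingRelated_pullFunctor F Ψ q') (Ψ.isPlumbing ((pullFunctor F Ψ.O).obj q'))
      (exists_push_str F Ψ q').choose_spec (AlmostComplex.related_push _ _)
  mor_induced {q q'} g := by
    intro y hy
    obtain ⟨h1, h2⟩ := Ψ.mor_induced ((pullFunctor F Ψ.O).map g) (diffeo (invHom F) y)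
      ((plumbingRelated_pullFunctor F Ψ q).symm.mem_kept_iff.2 hy)
    have h3 : diffeo F (diffeo ((pullFunctor F Ψ.O).map g).1.hom (diffeo (invHom F) y)) =
        diffeo g.1.hom y := by
      change diffeo F (diffeo (invHom F) (diffeo g.1.hom (diffeo F (diffeo (invHom F) y)))) = _
      rw [diffeo_invHom_apply, diffeo_invHom_apply]
    have h4 := (plumbingRelated_pullFunctor F Ψ q').mem_kept_iff.2 h1
    refine ⟨by rwa [h3] at h4, ?_⟩
    refine (congrArg (gluedMap (plumbingRelated_pullFunctor F Ψ q')) h2).trans ?_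
    exact glued_mk_congr h3

theorem familyRelated_push (F : α ⟶ β) (Ψ : PlumbingFamily φ α) :
    FamilyRelated F Ψ (Ψ.push F) where
  disks := Ψ.disks.related_push F
  V v := by
    change H1.map (invHom F) (H1.map F v) ∈ Ψ.V ↔ _
    rw [H1.map_invHom_map]
  j v _ := by
    change Related _ _ ((Ψ.j (H1.map (invHom F) (H1.map F v))).push (diffeo F)).J
    rw [H1.map_invHom_map]
    exact AlmostComplex.related_push _ _
  O q := by
    change (q.push F).push (invHom F) ∈ Ψ.O ↔ _
    rw [Param.push_invHom_push]

/-- A plumbing family is determined by the choices which define it: the structures on the glued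
surfaces are unique, and so are the morphisms, since they are induced by maps of `S`. -/
theorem FamilyRelated.unique {F : α ⟶ β} {Ψ : PlumbingFamily φ α} {Ψ₁ Ψ₂ : PlumbingFamily φ β}
    (h₁ : FamilyRelated F Ψ Ψ₁) (h₂ : FamilyRelated F Ψ Ψ₂) : Ψ₁ = Ψ₂ := by
  have hd : Ψ₁.disks = Ψ₂.disks := h₁.disks.unique h₂.disks
  have hV : Ψ₁.V = Ψ₂.V := by
    ext v
    rw [← H1.map_map_invHom F v, h₁.V, h₂.V]
  have hO : Ψ₁.O = Ψ₂.O := by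
    ext q
    rw [← Param.push_push_invHom F q, h₁.O, h₂.O]
  have hj : Ψ₁.j = Ψ₂.j := by
    funext v
    by_cases hv : v ∈ Ψ₁.V
    · have hv' : H1.map (invHom F) v ∈ Ψ.V := by rwa [← h₁.V, H1.map_map_invHom]
      have h := almostComplex_ext_related (h₁.j _ hv') (h₂.j _ hv')
      rwa [H1.map_map_invHom] at h
    · rw [Ψ₁.good.outside v hv, Ψ₂.good.outside v (hV ▸ hv)]
  clear h₁ h₂
  obtain ⟨d, V, j, _, O, _, _, _, _, str, hstr, mor, hmor⟩ := Ψ₁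
  obtain ⟨d', V', j', _, O', _, _, _, _, str', hstr', mor', hmor'⟩ := Ψ₂
  obtain rfl : d = d' := hd
  obtain rfl : V = V' := hV
  obtain rfl : O = O' := hO
  obtain rfl : j = j' := hj
  obtain rfl : str = str' := funext fun q => (hstr q).unique (hstr' q)
  have hm : @mor = @mor' := by
    funext q q' g
    refine Hom.ext' fun x => ?_
    exact congrFun (InducedBy.unique (hmor g) (hmor' g)) x
  subst hm
  rfl

theorem GoodUniformizer.ext' {Ψ₁ Ψ₂ : GoodUniformizer φ α}
    (h : Ψ₁.toPlumbingFamily = Ψ₂.toPlumbingFamily) : Ψ₁ = Ψ₂ := by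
  obtain ⟨Ψ₁, _, _, _, _, _, _⟩ := Ψ₁
  obtain ⟨Ψ₂, _, _, _, _, _, _⟩ := Ψ₂
  obtain rfl : Ψ₁ = Ψ₂ := h
  rfl

/-- The bijection between nodal pairs induced by a morphism. -/
def nodeEquiv (F : α ⟶ β) : α.nodes ≃ β.nodes where
  toFun e := ⟨_, map_mem_nodes F e.2⟩
  invFun e := ⟨_, map_mem_nodes (invHom F) e.2⟩
  left_inv e := Subtype.ext (map_invHom_map F e.1)
  right_inv e := Subtype.ext (map_invHom_map (invHom F) e.1)

/-- The image of a good uniformizer under an isomorphism. Each property is carried over by the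
natural equivalence between the family and its image. -/
def GoodUniformizer.push (F : α ⟶ β) (Ψ : GoodUniformizer φ α) : GoodUniformizer φ β :=
  have h := familyRelated_push F Ψ.toPlumbingFamily
  { toPlumbingFamily := Ψ.toPlumbingFamily.push F
    full := by
      have := Ψ.full
      have := (transFunctor_isEquivalence (invHom F) h.symm.O).full
      exact Functor.Full.of_iso h.symm.natIso.symm
    faithful := by
      have := Ψ.faithful
      have := (transFunctor_isEquivalence (invHom F) h.symm.O).faithful
      exact Functor.Faithful.of_iso h.symm.natIso.symm
    isOpenEmbedding := by
      rw [← h.symm.orbitMap_comp]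
      exact Ψ.isOpenEmbedding.comp (orbitHomeo _ _).isOpenEmbedding
    mem_range := by
      obtain ⟨x, hx⟩ := Ψ.mem_range
      rw [← h.orbitMap_comp] at hx
      exact ⟨_, hx.trans (Quot.sound ⟨isoOfHom F⟩)⟩
    partialKodairaSpencer := by
      intro q' p' z' hp'
      let q : TranslationGroupoid Ψ.O := (transFunctor (invHom F) h.symm.O).obj q'
      have hq : q'.1 = q.1.push F := (Param.push_push_invHom F q'.1).symm
      let p : ∀ e : α.nodes, NodeFrame α e.1 := fun e =>
        (p' (nodeEquiv F e)).push (invHom F) (map_invHom_map F e.1)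
      let z : α.nodes → ℂ := fun e => z' (nodeEquiv F e)
      have hnode : ∀ (e : α.nodes) (e' : β.nodes), Sym2.map (diffeo F) e.1 = e'.1 →
          nodeEquiv F e = e' := fun e e' he => Subtype.ext he
      have hnode' : ∀ (e' : β.nodes) (e : α.nodes), Sym2.map (diffeo (invHom F)) e'.1 = e.1 →
          nodeEquiv F e = e' := fun e' e he => hnode e e' (map_eq_symm (invHom F) he)
      have hp₁ : ∀ (e' : β.nodes) (e : α.nodes) (he : Sym2.map (diffeo (invHom F)) e'.1 = e.1),
          p e = (p' e').push (invHom F) he := by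
        intro e' e he
        obtain rfl := hnode' e' e he
        rfl
      have hp₂ : ∀ (e : α.nodes) (e' : β.nodes) (he : Sym2.map (diffeo F) e.1 = e'.1),
          p' e' = (p e).push F he := by
        intro e e' he
        obtain rfl := hnode e e' he
        exact ((p' (nodeEquiv F e)).push_invHom_push (invHom F) (map_invHom_map F e.1) he).symm
      have hz₁ : ∀ (e' : β.nodes) (e : α.nodes), Sym2.map (diffeo (invHom F)) e'.1 = e.1 →
          z e = z' e' := fun e' e he => congrArg z' (hnode' e' e he)
      obtain ⟨L, hL⟩ := Ψ.partialKodairaSpencer q p z fun e => by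
        have h1 := (hp' (nodeEquiv F e)).push (invHom F) (map_invHom_map F e.1)
        have h2 : q.1.2 e = (q'.1.2 (nodeEquiv F e)).push (invHom F) (map_invHom_map F e.1) :=
          Gluing.push_apply (invHom F) q'.1.2 (nodeEquiv F e) e (map_invHom_map F e.1)
        rw [h2]
        exact h1
      -- The differential at `q'` is the differential at `q` conjugated by `F`.
      let B : {e : α.nodes // z e ≠ 0} ≃ {e : β.nodes // z' e ≠ 0} :=
        (nodeEquiv F).subtypeEquiv fun e => Iff.rfl
      let E := h.symm.hom (q := q') (q' := q) rfl
      let L' : (H1 β × ({e : β.nodes // z' e ≠ 0} → ℂ)) ≃ₗ[ℝ]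
          H1 ((Ψ.toPlumbingFamily.push F).functor.obj q') :=
        (((H1.equiv (invHom F)).restrictScalars ℝ).prodCongr
          (LinearEquiv.funCongrLeft ℝ ℂ B)).trans
            (L.trans ((H1.equiv E).symm.restrictScalars ℝ))
      refine ⟨L', fun δv' δ' ξ' => ?_⟩
      have h1 : L (H1.map (invHom F) δv', δ' ∘ B) = H1.map E ξ' ↔ L' (δv', δ') = ξ' :=
        (LinearEquiv.symm_apply_eq (H1.equiv E)).symm
      rw [← h1, ← hL]
      constructor
      · intro H
        refine isPartialKodairaSpencer_push h.symm rfl hp₁ hz₁ ?_ H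
        intro e' e he
        exact congrArg δ' (Subtype.ext (hnode' _ _ he))
      · intro H
        have H' := isPartialKodairaSpencer_push h hq hp₂ (z' := z')
          (fun e e' he => (congrArg z' (hnode e e' he)).symm) (δ' := δ')
          (fun e e' he => (congrArg δ' (Subtype.ext (hnode _ _ he))).symm) H
        rw [H1.map_map_invHom, ← H1.map_comp] at H'
        have h2 : E ≫ h.hom hq = 𝟙 _ := h.hom_symm_comp_hom hq rfl
        rwa [h2, H1.map_id] at H'
    proper := by
      intro q'
      let T := transHomeo (invHom F) h.symm.O
      obtain ⟨U, hU, hq, H⟩ := Ψ.proper (T q')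
      refine ⟨T ⁻¹' U, hU.preimage T.continuous, hq, ?_⟩
      rintro s hs ⟨y, hy⟩
      obtain ⟨q₀, hq₀, i, hi, hlim⟩ := H (fun k => T (s k)) hs ⟨y, by
        refine hy.congr fun k => ?_
        exact (h.symm.orbitMap_mk (s k)).symm⟩
      refine ⟨T.symm q₀, ?_, i, hi, ?_⟩
      · rw [← T.preimage_closure, mem_preimage, T.apply_symm_apply]
        exact hq₀
      · refine ((T.symm.continuous.tendsto q₀).comp hlim).congr fun k => ?_
        exact T.symm_apply_apply _ }

/-- `IsTransport` describes `V'` and `O'` as images, `FamilyRelated` by membership, which is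
symmetric in the two families. -/
theorem isTransport_iff {F : α ⟶ β} {Ψ : GoodUniformizer φ α} {Ψ' : GoodUniformizer φ β} :
    IsTransport F Ψ Ψ' ↔ FamilyRelated F Ψ.toPlumbingFamily Ψ'.toPlumbingFamily := by
  constructor
  · rintro ⟨h1, h2, h3, h4⟩
    refine ⟨h1, fun v => ?_, fun v hv x w => (h3 v hv x w).symm, fun q => ?_⟩
    · have hinj : Function.Injective (H1.map F) := (H1.equiv F).injective
      rw [h2, hinj.mem_set_image]
    · have hinj : Function.Injective (Param.push F) :=
        Function.LeftInverse.injective (Param.push_invHom_push F)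
      rw [h4, hinj.mem_set_image]
  · rintro ⟨h1, h2, h3, h4⟩
    refine ⟨h1, ?_, fun v hv x w => (h3 v hv x w).symm, ?_⟩
    · ext v
      constructor
      · intro hv
        exact ⟨H1.map (invHom F) v, (h2 _).1 (by rwa [H1.map_map_invHom]), H1.map_map_invHom F v⟩
      · rintro ⟨v, hv, rfl⟩
        exact (h2 v).2 hv
    · ext q
      constructor
      · intro hq
        exact ⟨q.push (invHom F), (h4 _).1 (by rwa [Param.push_push_invHom]),
          Param.push_push_invHom F q⟩
      · rintro ⟨q, hq, rfl⟩
        exact (h4 q).2 hq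

theorem IsTransport.unique {F : α ⟶ β} {Ψ : GoodUniformizer φ α} {Ψ₁ Ψ₂ : GoodUniformizer φ β}
    (h₁ : IsTransport F Ψ Ψ₁) (h₂ : IsTransport F Ψ Ψ₂) : Ψ₁ = Ψ₂ :=
  GoodUniformizer.ext' ((isTransport_iff.1 h₁).unique (isTransport_iff.1 h₂))

theorem isTransport_push (F : α ⟶ β) (Ψ : GoodUniformizer φ α) : IsTransport F Ψ (Ψ.push F) :=
  isTransport_iff.2 (familyRelated_push F Ψ.toPlumbingFamily)

theorem isTransport_id (Ψ : GoodUniformizer φ α) : IsTransport (𝟙 α) Ψ Ψ := by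
  refine isTransport_iff.2 ⟨fun x => (image_id _).symm, fun v => by rw [H1.map_id],
    fun v _ x w => ?_, fun q => by rw [Param.push_id]⟩
  rw [H1.map_id]
  exact (mfderiv_diffeo_refl x _).trans
      (congrArg ((Ψ.j v).J x) (mfderiv_diffeo_refl x w)).symm

theorem IsTransport.comp {F : α ⟶ β} {G : β ⟶ γ} {Ψ : GoodUniformizer φ α}
    {Ψ' : GoodUniformizer φ β} {Ψ'' : GoodUniformizer φ γ} (h : IsTransport F Ψ Ψ')
    (h' : IsTransport G Ψ' Ψ'') : IsTransport (F ≫ G) Ψ Ψ'' := by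
  rw [isTransport_iff] at h h' ⊢
  refine ⟨fun x => ?_, fun v => ?_, fun v hv => ?_, fun q => ?_⟩
  · rw [diffeo_comp_apply, h'.disks, h.disks, image_image]
    rfl
  · rw [H1.map_comp, h'.V, h.V]
  · rw [H1.map_comp]
    exact (h.j v hv).trans (h'.j _ ((h.V v).2 hv))
  · rw [Param.push_comp, h'.O, h.O]

/-- The functor `𝓡 → SET`, `α ↦ F(α)`. Functoriality follows from the uniqueness of transports. -/
def uniformizerFunctor (φ : GluingProfile) : UniformizerFunctor φ where
  map F Ψ := Ψ.push F
  map_id α Ψ := (isTransport_push (𝟙 α) Ψ).unique (isTransport_id Ψ)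
  map_comp F G Ψ := (isTransport_push (F ≫ G) Ψ).unique
    ((isTransport_push F Ψ).comp (isTransport_push G (Ψ.push F)))

/-! ### Change of coordinates -/

theorem rotate_rotate (a b : ℂ) (u : TangentBundle IP α) :
    rotate a (rotate b u) = rotate (a * b) u := by
  refine congrArg (fun v => (⟨u.proj, v⟩ : TangentBundle IP α)) ?_
  change a.re • (b.re • u.snd + b.im • α.j u.proj u.snd) +
    a.im • α.j u.proj (b.re • u.snd + b.im • α.j u.proj u.snd) = _
  rw [map_add, map_smul, map_smul, j_sq, Complex.mul_re, Complex.mul_im]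
  module

/-- The complex line `T_xS` is spanned by every nonzero vector. -/
theorem exists_rotate_eq {u w : TangentBundle IP α} (h : u.proj = w.proj) (hu : u.snd ≠ 0)
    (hw : w.snd ≠ 0) : ∃ c : ℂ, c ≠ 0 ∧ w = rotate c u := by
  obtain ⟨x, v⟩ := u
  obtain ⟨x', v'⟩ := w
  obtain rfl : x = x' := h
  let T : ℂ →ₗ[ℝ] Plane :=
    Complex.reLm.smulRight (v : Plane) + Complex.imLm.smulRight (α.j x v : Plane)
  have hinj : Function.Injective T := by
    rw [injective_iff_map_eq_zero]
    intro c hc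
    by_contra h0
    exact rotate_ne_zero (u := (⟨x, v⟩ : TangentBundle IP α)) h0 hu hc
  have hsurj : Function.Surjective T :=
    (LinearMap.injective_iff_surjective_of_finrank_eq_finrank (by
      rw [Complex.finrank_real_complex, finrank_euclideanSpace_fin])).1 hinj
  obtain ⟨c, hc⟩ := hsurj v'
  refine ⟨c, ?_, ?_⟩
  · rintro rfl
    exact hw (hc.symm.trans (map_zero T))
  · exact congrArg (fun v => (⟨x, v⟩ : TangentBundle IP α)) hc.symm

theorem exists_circle_eq {c : ℂ} (hc : c ≠ 0) : ∃ θ : Circle, (θ : ℂ) = c / ‖c‖ := by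
  refine ⟨Circle.exp c.arg, ?_⟩
  have h : (‖c‖ : ℂ) ≠ 0 := by simpa using hc
  rw [Circle.coe_exp, eq_div_iff h, mul_comm]
  exact Complex.norm_mul_exp_arg_mul_I c

/-- Two coordinates on the gluing parameters of a nodal pair differ by the multiplication with
a unit complex number. -/
theorem NodeFrame.exists_hasCoord_mul {e : Sym2 α} (p q : NodeFrame α e) :
    ∃ l : ℂ, ∀ (b : GluingParam α e) (z : ℂ), p.HasCoord b z → q.HasCoord b (l * z) := by
  have hmk : ∀ c d : ℂ, c ≠ 0 → d ≠ 0 →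
      ((q.u = rotate c p.u ∧ q.w = rotate d p.w) ∨ (q.u = rotate c p.w ∧ q.w = rotate d p.u)) →
      ∃ l : ℂ, ∀ (b : GluingParam α e) (z : ℂ), p.HasCoord b z → q.HasCoord b (l * z) := by
    intro c d hc hd hcd
    have hc' : (‖c‖ : ℂ) ≠ 0 := by simpa using hc
    have hd' : (‖d‖ : ℂ) ≠ 0 := by simpa using hd
    -- `[c p.u, z l d p.w] = [p.u, z p.w]` up to positive factors for this unit number `l`, and also
    -- with `p.u` and `p.w` interchanged.
    let l : ℂ := (‖c‖ / c) * (‖d‖ / d)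
    have hl : ‖l‖ = 1 := by
      simp [l, hc, hd]
    refine ⟨l, ?_⟩
    rintro _ z ⟨hz, rfl⟩
    have hlz : ‖l * z‖ = ‖z‖ := by rw [norm_mul, hl, one_mul]
    refine ⟨by rwa [hlz], ?_⟩
    refine (Quot.sound ?_).symm
    -- All expressions with `r = 0` are equal; there the lines carry no information.
    by_cases hz0 : z = 0
    · left
      simp [hz0]
    · right
      have hl0 : l * z ≠ 0 := by rwa [← norm_ne_zero_iff, hlz, norm_ne_zero_iff]
      have hz' : (‖z‖ : ℂ) ≠ 0 := by simpa using hz0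
      refine ⟨hlz.symm, ?_⟩
      rcases hcd with ⟨h1, h2⟩ | ⟨h1, h2⟩
      · obtain ⟨θ, hθ⟩ := exists_circle_eq hc
        refine ⟨θ, ‖c‖, ‖d‖, norm_pos_iff.2 hc, norm_pos_iff.2 hd, Or.inl ⟨?_, ?_⟩⟩
        · change q.u = rotate _ p.u
          rw [h1, hθ]
          congr 1
          field_simp
        · change rotate (if l * z = 0 then 1 else l * z) q.w =
            rotate _ (rotate (if z = 0 then 1 else z) p.w)
          rw [if_neg hl0, if_neg hz0, h2, rotate_rotate, rotate_rotate, Circle.coe_inv, hθ]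
          congr 1
          simp only [l]
          field_simp
      · obtain ⟨θ, hθ⟩ := exists_circle_eq (div_ne_zero hz0 hc)
        refine ⟨θ, ‖z‖ * ‖d‖, ‖c‖ / ‖z‖, by positivity, by positivity, Or.inr ⟨?_, ?_⟩⟩
        · change rotate (if l * z = 0 then 1 else l * z) q.w = rotate _ p.u
          rw [if_neg hl0, h2, rotate_rotate, hθ]
          congr 1
          simp only [l, norm_div]
          push_cast
          field_simp
        · change q.u = rotate _ (rotate (if z = 0 then 1 else z) p.w)
          rw [if_neg hz0, h1, rotate_rotate, Circle.coe_inv, hθ]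
          congr 1
          simp only [norm_div]
          push_cast
          field_simp
  have h : s(p.u.proj, p.w.proj) = s(q.u.proj, q.w.proj) := p.above.trans q.above.symm
  rcases Sym2.eq_iff.1 h with ⟨h1, h2⟩ | ⟨h1, h2⟩
  · obtain ⟨c, hc, h3⟩ := exists_rotate_eq h1 p.u_ne q.u_ne
    obtain ⟨d, hd, h4⟩ := exists_rotate_eq h2 p.w_ne q.w_ne
    exact hmk c d hc hd (Or.inl ⟨h3, h4⟩)
  · obtain ⟨c, hc, h3⟩ := exists_rotate_eq h2 p.w_ne q.u_ne
    obtain ⟨d, hd, h4⟩ := exists_rotate_eq h1 p.u_ne q.w_ne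
    exact hmk c d hc hd (Or.inr ⟨h3, h4⟩)

/-- In coordinates, `F_*` is linear on `H¹` and diagonal, up to the permutation of the nodal pairs, on
the gluing parameters. -/
theorem isSmoothOn_transFunctor (F : α ⟶ β) {O : Set (Param α)} {O' : Set (Param β)}
    (hO : ∀ q, q.push F ∈ O' ↔ q ∈ O) (W : Set (TranslationGroupoid O)) :
    IsSmoothOn (transFunctor F hO).obj W := by
  intro n n' κ κ'
  have hl : ∀ e' : β.nodes, ∃ l : ℂ, ∀ (b : GluingParam α ((nodeEquiv F).symm e').1) (z : ℂ),
      (κ.frame ((nodeEquiv F).symm e')).HasCoord b z →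
      (κ'.frame e').HasCoord (b.push F (map_map_symm F e'.1)) (l * z) := by
    intro e'
    obtain ⟨l, hl⟩ := ((κ.frame ((nodeEquiv F).symm e')).push F
      (map_map_symm F e'.1)).exists_hasCoord_mul (κ'.frame e')
    exact ⟨l, fun b z hz => hl _ _ (hz.push F _)⟩
  choose l hl using hl
  let A : (Fin n → ℂ) →ₗ[ℝ] (Fin n' → ℂ) :=
    ((κ'.lin.toLinearMap ∘ₗ H1.map F) ∘ₗ κ.lin.symm.toLinearMap).restrictScalars ℝ
  have hA : ContDiff ℝ ∞ A := A.toContinuousLinearMap.contDiff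
  refine ⟨fun y => (A y.1, fun e' => l e' * y.2 ((nodeEquiv F).symm e')), ?_, ?_⟩
  · refine ContDiff.contDiffOn ((hA.comp contDiff_fst).prodMk (contDiff_pi.2 fun e' => ?_))
    exact contDiff_const.mul ((contDiff_apply ℝ ℂ _).comp contDiff_snd)
  · rintro q - y ⟨h1, h2⟩
    refine ⟨?_, fun e' => hl e' _ _ (h2 _)⟩
    change κ'.lin (H1.map F q.1.1) = κ'.lin (H1.map F (κ.lin.symm y.1))
    rw [← h1, LinearEquiv.symm_apply_apply]

theorem isSmoothEquivalence_transFunctor (F : α ⟶ β) {O : Set (Param α)} {O' : Set (Param β)}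
    (hO : ∀ q, q.push F ∈ O' ↔ q ∈ O) : IsSmoothEquivalence (transFunctor F hO) where
  isEquivalence := transFunctor_isEquivalence F hO
  smooth_obj := isSmoothOn_transFunctor F hO univ
  smooth_mor _ _ _ := Eventually.of_forall fun _ _ _ h => congrArg (isoOfHom F).conjAut h
  local_diffeo _ := ⟨univ, isOpen_univ, trivial, (transHomeo F hO).isOpenMap _ isOpen_univ,
    (transFunctor (invHom F) (param_iff_symm hO)).obj, fun q _ => (transHomeo F hO).left_inv q,
    isSmoothOn_transFunctor _ _ _⟩

/-- Two morphisms induced by the same map agree. Their targets are only propositionally equal, hence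
the heterogeneous equality. -/
theorem heq_of_inducedBy {Ψ : PlumbingFamily φ α} {Ψ' : PlumbingFamily φ β} {f : α → β}
    {q : TranslationGroupoid Ψ.O} {a a' : TranslationGroupoid Ψ'.O} (h : a = a')
    {u : Ψ.functor.obj q ⟶ Ψ'.functor.obj a} {u' : Ψ.functor.obj q ⟶ Ψ'.functor.obj a'}
    (hu : InducedBy (φ := φ) (𝒟 := Ψ.disks) (𝒟' := Ψ'.disks) (a := q.1.2) (a' := a.1.2) f
      (diffeo u))
    (hu' : InducedBy (φ := φ) (𝒟 := Ψ.disks) (𝒟' := Ψ'.disks) (a := q.1.2) (a' := a'.1.2) f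
      (diffeo u')) : HEq u u' := by
  subst h
  exact heq_of_eq (Hom.ext' fun x => congrFun (InducedBy.unique hu hu') x)

/-- As `Ψ` is faithful and all morphisms are invertible, a naturality square determines the morphism
`m`. -/
theorem heq_of_naturality {Ψ : PlumbingFamily φ α} (hΨ : Ψ.functor.Faithful) {A B : StableSurface}
    {G : A ⟶ B} {a b a' b' : TranslationGroupoid Ψ.O} (ha : a = a') (hb : b = b')
    {m : a ⟶ b} {m' : a' ⟶ b'} {u : A ⟶ Ψ.functor.obj a} {u' : A ⟶ Ψ.functor.obj a'}
    {v : B ⟶ Ψ.functor.obj b} {v' : B ⟶ Ψ.functor.obj b'} (hu : HEq u u') (hv : HEq v v')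
    (hm : G ≫ v = u ≫ Ψ.functor.map m) (hm' : G ≫ v' = u' ≫ Ψ.functor.map m') : HEq m m' := by
  subst ha hb
  obtain rfl := eq_of_heq hu
  obtain rfl := eq_of_heq hv
  have h : (isoOfHom u).hom ≫ Ψ.functor.map m = (isoOfHom u).hom ≫ Ψ.functor.map m' :=
    hm.symm.trans hm'
  rw [cancel_epi] at h
  exact heq_of_eq (hΨ.map_injective h)

end NodedRiemann.StableSurface

theorem mainTheorem1 (φ : GluingProfile) :
    ∃ F : UniformizerFunctor φ,
      (∀ (α α' : StableSurface) (Φ : α ⟶ α') (Ψ : GoodUniformizer φ α),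
        IsTransport Φ Ψ (F.map Φ Ψ)) ∧
      (∀ F' : UniformizerFunctor φ,
        (∀ (α α' : StableSurface) (Φ : α ⟶ α') (Ψ : GoodUniformizer φ α),
          IsTransport Φ Ψ (F'.map Φ Ψ)) → F' = F) ∧
      ∀ (α α' : StableSurface) (Φ : α ≅ α') (Ψ : GoodUniformizer φ α)
        (Ψ' : GoodUniformizer φ α'), Ψ' = F.map Φ.hom Ψ →
        ∃ f : TranslationGroupoid Ψ.O ⥤ TranslationGroupoid Ψ'.O,
          IsSmoothEquivalence f ∧
          (∀ q, (f.obj q).1 = q.1.push Φ.hom) ∧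
          (∀ (q q' : TranslationGroupoid Ψ.O) (g : q ⟶ q'), (f.map g).1 = Φ.conjAut g.1) ∧
          (∃! Γ : Ψ.functor ≅ f ⋙ Ψ'.functor, ∀ q : TranslationGroupoid Ψ.O,
            InducedBy (φ := φ) (𝒟 := Ψ.disks) (𝒟' := Ψ'.disks) (a := q.1.2)
              (a' := (f.obj q).1.2) (diffeo Φ.hom) (diffeo (Γ.hom.app q))) ∧
          ∀ f' : TranslationGroupoid Ψ.O ⥤ TranslationGroupoid Ψ'.O,
            (∀ q, (f'.obj q).1 = q.1.push Φ.hom) →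
            (∃ Γ : Ψ.functor ≅ f' ⋙ Ψ'.functor, ∀ q : TranslationGroupoid Ψ.O,
              InducedBy (φ := φ) (𝒟 := Ψ.disks) (𝒟' := Ψ'.disks) (a := q.1.2)
                (a' := (f'.obj q).1.2) (diffeo Φ.hom) (diffeo (Γ.hom.app q))) →
            f' = f := by
  refine ⟨uniformizerFunctor φ, fun α α' Φ Ψ => isTransport_push Φ Ψ, fun F' hF' => ?_, ?_⟩
  · apply UniformizerFunctor.ext
    funext α α' Φ Ψ
    exact (hF' α α' Φ Ψ).unique (isTransport_push Φ Ψ)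
  · intro α α' Φ Ψ Ψ' hΨ'
    have h : FamilyRelated Φ.hom Ψ.toPlumbingFamily Ψ'.toPlumbingFamily := by
      rw [hΨ']
      exact familyRelated_push Φ.hom Ψ.toPlumbingFamily
    have hind : ∀ q : TranslationGroupoid Ψ.O,
        InducedBy (φ := φ) (𝒟 := Ψ.disks) (𝒟' := Ψ'.disks) (a := q.1.2)
          (a' := ((transFunctor Φ.hom h.O).obj q).1.2) (diffeo Φ.hom)
          (diffeo (h.natIso.hom.app q)) := fun q =>
      inducedBy_gluedMap (h.plumbingRelated (q' := (transFunctor Φ.hom h.O).obj q) rfl)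
    refine ⟨transFunctor Φ.hom h.O, isSmoothEquivalence_transFunctor Φ.hom h.O, fun q => rfl,
      fun q q' g => ?_, ⟨h.natIso, hind, fun Γ hΓ => ?_⟩, fun f' hf' hΓ' => ?_⟩
    · change (isoOfHom Φ.hom).conjAut g.1 = _
      rw [isoOfHom_hom]
    · apply Iso.ext
      ext q : 2
      exact eq_of_heq (heq_of_inducedBy rfl (hΓ q) (hind q))
    · obtain ⟨Γ', hΓ'⟩ := hΓ'
      have hobj : ∀ q, f'.obj q = (transFunctor Φ.hom h.O).obj q := fun q =>
        Subtype.ext (hf' q)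
      refine CategoryTheory.Functor.hext hobj fun q q' g => ?_
      exact heq_of_naturality Ψ'.faithful (hobj q) (hobj q')
        (heq_of_inducedBy (hobj q) (hΓ' q) (hind q)) (heq_of_inducedBy (hobj q') (hΓ' q') (hind q'))
        (Γ'.hom.naturality g) (h.natIso.hom.naturality g)

end
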